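/- **Setting.** A *derivator* is a 2-functor $\mathscr{D}\colon \mathrm{Cat}^{op}\to \mathrm{CAT}$ on small categories satisfying the usual axioms (Der1)–(Der4): coproducts are sent to products, isomorphisms are detected pointwise, restriction functors $u^*$ have left and right adjoints $u_!$, $u_*$ (Kan extensions), and Kan extensions are computed pointwise by slice categories. It is *stable* if $\mathscr{D}(\mathbb{1})$ has a zero object and a coherent square $X\in\mathscr{D}([1]\times[1])$ is cartesian if and only if it is cocartesian. For a small category $B$ let $\mathscr{D}^B$ be the shifted derivator $\mathscr{D}^B(A)=\mathscr{D}(B\times A)$. Morphisms of (pre)derivators are pseudonatural transformations and natural isomorphisms between them are invertible modifications. Let $\mathscr{D}$ be a stable derivator, $n\ge 1$, and let $Q$ be an $A_n$-quiver, that is, an orientation of the path $1 - 2 - \cdots - n$ (identified with its free category). *Reflection functors.* If $a$ is a sink of $Q$, let $\sigma_aQ$ be the quiver obtained by reversing the arrows adjacent to $a$. The reflection functor $s_a^+\colon\mathscr{D}^Q\to\mathscr{D}^{\sigma_aQ}$ is the following composite: if $a$ has fewer than two neighbours, first add for each missing neighbour ($a-1$ or $a+1$) a vertex mapping to $a$ and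 extend by zero (a left Kan extension); then form by right Kan extension the cartesian square whose lower right part is $a-1\to a\leftarrow a+1$; finally restrict to $\sigma_a Q$, where the vertex $a$ of $\sigma_aQ$ is placed at the new upper left corner of that square. (So $s_a^+$ is given by a fibre if $a$ has exactly one neighbour, and by the loop functor $\Omega$ if $n=1$.) Dually, a source $b$ yields $s_b^-\colon\mathscr{D}^Q\to\mathscr{D}^{\sigma_bQ}$, using extension by zero by a right Kan extension and cocartesian squares. *Admissible sequences.* An admissible sequence of sinks is a total ordering $(a_1,\dots,a_n)$ of the vertices of $Q$ such that $a_i$ is a sink of $\sigma_{a_{i-1}}\cdots\sigma_{a_1}Q$ for all $i$; admissible sequences of sources are defined dually. The associated composites are $$\Phi^+_{(a_1,\dots,a_n)}=s^+_{a_n}\circ\dots\circ s^+_{a_1}\colon\mathscr{D}^Q\to\mathscr{D}^Q,\qquad \Phi^-_{(b_1,\dots,b_n)}=s^-_{b_n}\circ\dots\circ s^-_{b_1}\colon\mathscr{D}^Q\to\mathscr{D}^Q .$$ *Mesh category.* Let $M_n$ be the poset with elements $(k,l)$, $k\in\mathbb{Z}$, $0\le l\le n+1$, generated by $(k,l)\to(k,l+1)$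 and $(k,l+1)\to(k+1,l)$. Let $\mathscr{D}^{M_n,\mathrm{ex}}\subseteq\mathscr{D}^{M_n}$ be the full subprederivator of the coherent diagrams that vanish at all $(k,0)$ and $(k,n+1)$ and make all squares $(k,l+1)\to(k,l+2),\ (k+1,l)\to(k+1,l+1)$, $0\le l<n$, bicartesian (in $\mathscr{D}^{M_n,\mathrm{ex}}(A)$ these conditions are imposed on the value at each object of $A$). Restriction along $t(k,l)=(k-1,l)$ and along $t^{-1}$ induces the Auslander–Reiten translation $\tau=t^*$ and its inverse $\tau^-=(t^{-1})^*$ on $\mathscr{D}^{M_n,\mathrm{ex}}$. *The embedding of $Q$.* Let $Q_{\mathrm{ext}}$ be obtained from $Q$ by adding vertices $0,n+1$ and arrows $1\to 0$, $n\to n+1$. The repetitive quiver $\widehat{R}$ of a quiver $R$ has vertices $(k,r)$, $k\in\mathbb{Z}$, and for each arrow $r\to r'$ of $R$ arrows $(k,r)\to(k,r')$ and $(k,r')\to(k+1,r)$. An isomorphism $\varphi$ from $\widehat{Q_{\mathrm{ext}}}$ to the repetitive quiver of $0\to1\to\dots\to n+1$ determines an embedding $i_Q\colon Q\to M_n$,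 $q\mapsto\varphi(0,q)$. **Statement.** 1. Admissible sequences of sinks in $Q$ exist; for each of them the composite $\Phi^+_{(a_1,\dots,a_n)}$ exists; and for any two of them $\Phi^+_{(a_1,\dots,a_n)}\cong\Phi^+_{(a'_1,\dots,a'_n)}\colon\mathscr{D}^Q\to\mathscr{D}^Q$ naturally. 2. The same holds for admissible sequences of sources and the composites $\Phi^-_{(b_1,\dots,b_n)}$. Hence the Coxeter functors $\Phi_Q^+$ and $\Phi_Q^-$, defined by these composites for an arbitrary admissible sequence of sinks, respectively sources, are well defined up to natural isomorphism. 3. Isomorphisms $\varphi$ as above exist, and for each of them $i_Q^*\colon\mathscr{D}^{M_n,\mathrm{ex}}\to\mathscr{D}^Q$ is an equivalence. For every inverse equivalence $F_Q\colon\mathscr{D}^Q\to\mathscr{D}^{M_n,\mathrm{ex}}$ there are natural isomorphisms $$F_Q\circ\Phi_Q^+\cong\tau\circ F_Q,\qquad F_Q\circ\Phi^-_Q\cong\tau^-\circ F_Q .$$ -/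

import Mathlib

open CategoryTheory
open scoped Bicategory Pseudofunctor.StrongTrans

universe w v u

/-! ## Strict 2-functors and pseudonatural transformations -/

/-- The bicategory of small categories with reversed 1-cells is strict. -/
instance catOpStrict : Bicategory.Strict Cat.{w,w}ᵒᵖ where
  id_comp f := congrArg Quiver.Hom.op (Category.comp_id f.unop)
  comp_id f := congrArg Quiver.Hom.op (Category.id_comp f.unop)
  assoc f g h := congrArg Quiver.Hom.op (Category.assoc h.unop g.unop f.unop).symm

theorem eq_conj_eqToHom {B : Type*} [Category* B] {a b : B} {x y : a ⟶ b} (h : x = y) (p : a = a) (q : b = b) : x = eqToHom p ≫ y ≫ eqToHom q := by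
  simp [h]

/-- The 2-functor `A ↦ B × A` on small categories (with reversed 1-cells). -/
def prodLeft (B : Cat.{w,w}) : StrictPseudofunctor Cat.{w,w}ᵒᵖ Cat.{w,w}ᵒᵖ :=
  StrictPseudofunctor.mk'' {
    obj A := Opposite.op (Cat.of (B × A.unop))
    map f := (((𝟭 B).prod f.unop.toFunctor).toCatHom).op
    map₂ η := Bicategory.Opposite.op2 (NatTrans.toCatHom₂ (NatTrans.prod (𝟙 (𝟭 B)) η.unop2.toNatTrans))
    map₂_id := fun f => rfl
    map₂_comp := fun η θ => by
      apply congrArg Bicategory.Opposite.op2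
      apply congrArg NatTrans.toCatHom₂
      ext X
      · exact (Category.id_comp _).symm
      · rfl
    map₂_whisker_left := fun f g g' η => by
      refine eq_conj_eqToHom ?_ _ _
      apply congrArg Bicategory.Opposite.op2
      apply congrArg NatTrans.toCatHom₂
      ext X <;> rfl
    map₂_whisker_right := fun η g => by
      refine eq_conj_eqToHom ?_ _ _
      apply congrArg Bicategory.Opposite.op2
      apply congrArg NatTrans.toCatHom₂
      ext X
      · rfl
      · rfl
    }

/-- A strictly natural family of 1-cells between strict 2-functors is a pseudonatural transformation. -/
def strictTrans {B C : Type*} [Bicategory B] [Bicategory C] [Bicategory.Strict B] [Bicategory.Strict C]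
    {F G : StrictPseudofunctor B C} (app : ∀ a, F.obj a ⟶ G.obj a)
    (h : ∀ {a b : B} (f : a ⟶ b), F.map f ≫ app b = app a ≫ G.map f)
    (h₂ : ∀ {a b : B} {f g : a ⟶ b} (η : f ⟶ g),
      F.map₂ η ▷ app b = eqToHom (h f) ≫ app a ◁ G.map₂ η ≫ eqToHom (h g).symm) :
    F.toPseudofunctor ⟶ G.toPseudofunctor where
  app := app
  naturality f := eqToIso (h f)
  naturality_naturality η := by simp [h₂]
  naturality_id a := by
    have := F.mapId_eq_eqToIso a
    have := G.mapId_eq_eqToIso a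
    simp_all [Bicategory.Strict.leftUnitor_eqToIso, Bicategory.Strict.rightUnitor_eqToIso]
  naturality_comp f g := by
    simp [F.mapComp_eq_eqToIso, G.mapComp_eq_eqToIso, Bicategory.Strict.associator_eqToIso]

theorem map₂_square {B C : Type*} [Bicategory B] [Bicategory C] (G : StrictPseudofunctor B C)
    {a b c d : B} {f g : a ⟶ b} {f' g' : c ⟶ d} {x : b ⟶ d} {y : a ⟶ c} (η : f ⟶ g) (η' : f' ⟶ g')
    (hf : f ≫ x = y ≫ f') (hg : g ≫ x = y ≫ g')
    (h : η ▷ x = eqToHom hf ≫ y ◁ η' ≫ eqToHom hg.symm)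
    (p : G.map f ≫ G.map x = G.map y ≫ G.map f') (q : G.map y ≫ G.map g' = G.map g ≫ G.map x) :
    G.map₂ η ▷ G.map x = eqToHom p ≫ G.map y ◁ G.map₂ η' ≫ eqToHom q := by
  have := congrArg G.map₂ h
  simp only [G.map₂_comp, G.map₂_whisker_right, G.map₂_whisker_left, PrelaxFunctor.map₂_eqToHom,
    G.mapComp_eq_eqToIso, eqToIso.hom, eqToIso.inv] at this
  rw [← cancel_epi (eqToHom (G.map_comp f x)), ← cancel_mono (eqToHom (G.map_comp g x).symm)]
  simpa using this

/-! ## Prederivators -/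

set_option linter.checkUnivs false in
/-- A prederivator: a 2-functor from small categories (1-cells reversed, 2-cells not reversed) to
not necessarily small categories. Morphisms of prederivators are the 1-cells, and transformations the
2-cells, of the bicategory of pseudofunctors, pseudonatural transformations and modifications. -/
abbrev Prederivator := StrictPseudofunctor Cat.{w,w}ᵒᵖ Cat.{v,u}

namespace Prederivator

/-- The category `D(A)` of coherent diagrams of shape `A`. -/
abbrev Diag (D : Prederivator.{w,v,u}) (A : Type w) [SmallCategory A] : Cat.{v,u} :=
  D.obj (Opposite.op (Cat.of A))

/-- The restriction functor `u^* : D(B) ⥤ D(A)`. -/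
abbrev res (D : Prederivator.{w,v,u}) {A B : Type w} [SmallCategory A] [SmallCategory B]
    (p : A ⥤ B) : D.Diag B ⥤ D.Diag A :=
  (D.map p.toCatHom.op).toFunctor

/-- The natural transformation `u^* ⟶ v^*` induced by a natural transformation `u ⟶ v`. -/
abbrev resTrans (D : Prederivator.{w,v,u}) {A B : Type w} [SmallCategory A] [SmallCategory B]
    {p q : A ⥤ B} (α : p ⟶ q) : D.res p ⟶ D.res q :=
  (D.map₂ (Bicategory.Opposite.op2 α.toCatHom₂)).toNatTrans

/-- The identification `(u ⋙ v)^* = v^* ⋙ u^*` as an isomorphism. -/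
abbrev resComp (D : Prederivator.{w,v,u}) {A B C : Type w} [SmallCategory A] [SmallCategory B]
    [SmallCategory C] (p : A ⥤ B) (q : B ⥤ C) : D.res (p ⋙ q) ≅ D.res q ⋙ D.res p :=
  Cat.Hom.toNatIso (D.mapComp q.toCatHom.op p.toCatHom.op)

/-- The terminal category. -/
abbrev One : Type w := Discrete PUnit.{w+1}

/-- Evaluation `D(A) ⥤ D(1)` at an object of `A`. -/
abbrev ev (D : Prederivator.{w,v,u}) {A : Type w} [SmallCategory A] (a : A) :
    D.Diag A ⥤ D.Diag One.{w} :=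
  D.res (Functor.fromPUnit a)

theorem res_comp_obj (D : Prederivator.{w,v,u}) {A B C : Type w} [SmallCategory A]
    [SmallCategory B] [SmallCategory C] (p : A ⥤ B) (q : B ⥤ C) (X : D.Diag C) :
    (D.res (p ⋙ q)).obj X = (D.res p).obj ((D.res q).obj X) :=
  congrArg (fun t : D.Diag C ⟶ D.Diag A => t.toFunctor.obj X)
    (D.map_comp q.toCatHom.op p.toCatHom.op)

/-! ## Derivators -/

/-- The restriction of the 2-cell `u ∘ p ⟶ b ∘ π` of the slice square of `(u/b)`. -/
def sliceTransLeft (D : Prederivator.{w,v,u}) {A B : Type w} [SmallCategory A] [SmallCategory B]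
    (p : A ⥤ B) (b : B) :
    D.res p ⋙ D.res (CostructuredArrow.proj p b) ⟶
      D.ev b ⋙ D.res (Functor.star (CostructuredArrow p b)) :=
  (D.resComp (CostructuredArrow.proj p b) p).inv ≫
    D.resTrans (p := CostructuredArrow.proj p b ⋙ p) (q := Functor.star _ ⋙ Functor.fromPUnit b)
      { app := fun X => X.hom
        naturality := fun _ _ f => (CostructuredArrow.w f).trans (Category.comp_id _).symm } ≫
    (D.resComp (Functor.star (CostructuredArrow p b)) (Functor.fromPUnit b)).hom

/-- The restriction of the 2-cell `b ∘ π ⟶ u ∘ q` of the slice square of `(b/u)`. -/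
def sliceTransRight (D : Prederivator.{w,v,u}) {A B : Type w} [SmallCategory A] [SmallCategory B]
    (p : A ⥤ B) (b : B) :
    D.ev b ⋙ D.res (Functor.star (StructuredArrow b p)) ⟶
      D.res p ⋙ D.res (StructuredArrow.proj b p) :=
  (D.resComp (Functor.star (StructuredArrow b p)) (Functor.fromPUnit b)).inv ≫
    D.resTrans (p := Functor.star _ ⋙ Functor.fromPUnit b) (q := StructuredArrow.proj b p ⋙ p)
      { app := fun X => X.hom
        naturality := fun _ _ f => (Category.id_comp _).trans (StructuredArrow.w f).symm } ≫
    (D.resComp (StructuredArrow.proj b p) p).hom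

/-- The axioms of a derivator. In (Der4) the adjoints are arbitrary, which amounts to one choice. -/
structure IsDerivator (D : Prederivator.{w,v,u}) : Prop where
  der1 : ∀ {I : Type w} (A : I → Type w) [∀ i, SmallCategory (A i)],
    (Functor.pi' fun i => D.res (Sigma.incl (C := A) i) :
      D.Diag (Σ i, A i) ⥤ ∀ i, D.Diag (A i)).IsEquivalence
  der2 : ∀ {A : Type w} [SmallCategory A] {X Y : D.Diag A} (f : X ⟶ Y),
    (∀ a : A, IsIso ((D.ev a).map f)) → IsIso f
  der3_left : ∀ {A B : Type w} [SmallCategory A] [SmallCategory B] (p : A ⥤ B),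
    (D.res p).IsRightAdjoint
  der3_right : ∀ {A B : Type w} [SmallCategory A] [SmallCategory B] (p : A ⥤ B),
    (D.res p).IsLeftAdjoint
  der4_left : ∀ {A B : Type w} [SmallCategory A] [SmallCategory B] (p : A ⥤ B) (b : B)
    (L : D.Diag A ⥤ D.Diag B) (adj : L ⊣ D.res p)
    (colim : D.Diag (CostructuredArrow p b) ⥤ D.Diag One.{w})
    (adj' : colim ⊣ D.res (Functor.star (CostructuredArrow p b))),
    IsIso ((CategoryTheory.mateEquiv adj adj').symm
      (TwoSquare.mk _ _ _ _ (D.sliceTransLeft p b))).natTrans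
  der4_right : ∀ {A B : Type w} [SmallCategory A] [SmallCategory B] (p : A ⥤ B) (b : B)
    (R : D.Diag A ⥤ D.Diag B) (adj : D.res p ⊣ R)
    (lim : D.Diag (StructuredArrow b p) ⥤ D.Diag One.{w})
    (adj' : D.res (Functor.star (StructuredArrow b p)) ⊣ lim),
    IsIso (CategoryTheory.mateEquiv adj adj'
      (TwoSquare.mk _ _ _ _ (D.sliceTransRight p b))).natTrans

end Prederivator

/-! ## Posets as small categories -/

/-- A preordered set in `Type`, regarded as a small category in an arbitrary universe. -/
@[ext]
structure Pos (α : Type) : Type w where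
  pt : α

instance Pos.preorder (α : Type) [Preorder α] : Preorder (Pos.{w} α) := Preorder.lift Pos.pt

/-- The functor of posets given by a monotone map. -/
def Pos.map {α β : Type} [Preorder α] [Preorder β] (f : α → β) (hf : Monotone f) :
    Pos.{w} α ⥤ Pos.{w} β :=
  Monotone.functor (f := fun x : Pos.{w} α => (⟨f x.pt⟩ : Pos.{w} β)) (fun _ _ h => hf h)

/-- The square `[1] × [1]`. -/
abbrev Sq : Type := Fin 2 × Fin 2

/-- The square without its terminal object. -/
abbrev SqUL : Type := {x : Sq // x ≠ (1, 1)}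

/-- The square without its initial object. -/
abbrev SqLR : Type := {x : Sq // x ≠ (0, 0)}

namespace Prederivator

/-- Cocartesian squares: the essential image of left Kan extension from the upper left corner. -/
def IsCocartesian (D : Prederivator.{w,v,u}) (X : D.Diag (Pos.{w} Sq)) : Prop :=
  ∃ (L : D.Diag (Pos.{w} SqUL) ⥤ D.Diag (Pos.{w} Sq)),
    Nonempty (L ⊣ D.res (Pos.map.{w} (Subtype.val : SqUL → Sq) (fun _ _ h => h))) ∧ L.essImage X

/-- Cartesian squares: the essential image of right Kan extension from the lower right corner. -/
def IsCartesian (D : Prederivator.{w,v,u}) (X : D.Diag (Pos.{w} Sq)) : Prop :=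
  ∃ (R : D.Diag (Pos.{w} SqLR) ⥤ D.Diag (Pos.{w} Sq)),
    Nonempty (D.res (Pos.map.{w} (Subtype.val : SqLR → Sq) (fun _ _ h => h)) ⊣ R) ∧ R.essImage X

theorem IsCocartesian.of_iso {D : Prederivator.{w,v,u}} {X Y : D.Diag (Pos.{w} Sq)} (e : X ≅ Y)
    (h : D.IsCocartesian X) : D.IsCocartesian Y := by
  obtain ⟨L, hL, hX⟩ := h
  exact ⟨L, hL, Functor.essImage.ofIso e hX⟩

theorem IsCartesian.of_iso {D : Prederivator.{w,v,u}} {X Y : D.Diag (Pos.{w} Sq)} (e : X ≅ Y)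
    (h : D.IsCartesian X) : D.IsCartesian Y := by
  obtain ⟨R, hR, hX⟩ := h
  exact ⟨R, hR, Functor.essImage.ofIso e hX⟩

/-- A stable derivator: a pointed derivator in which cartesian and cocartesian squares coincide. -/
structure IsStableDerivator (D : Prederivator.{w,v,u}) : Prop extends IsDerivator D where
  pointed : Limits.HasZeroObject (D.Diag One.{w})
  cartesian_iff : ∀ X : D.Diag (Pos.{w} Sq), D.IsCartesian X ↔ D.IsCocartesian X

/-! ## Shifted prederivators and restriction morphisms -/

/-- The shifted prederivator `D^B`, with `D^B(A) = D(B × A)`. -/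
def shift (D : Prederivator.{w,v,u}) (B : Type w) [SmallCategory B] : Prederivator.{w,v,u} :=
  (prodLeft (Cat.of B)).comp D

/-- Morphisms of prederivators: pseudonatural transformations. -/
abbrev Mor (D E : Prederivator.{w,v,u}) := D.toPseudofunctor ⟶ E.toPseudofunctor

/-- The restriction morphism `p^* : D^C ⟶ D^B`. -/
def resMor (D : Prederivator.{w,v,u}) {B C : Type w}
    [SmallCategory B] [SmallCategory C] (p : B ⥤ C) :
   Mor (D.shift C) (D.shift B) :=
  strictTrans (F := D.shift C) (G := D.shift B)
   (fun A => D.map ((p.prod (𝟭 A.unop)).toCatHom).op)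
   (fun {a b} f =>
     (D.map_comp ((prodLeft (Cat.of C)).map f) ((p.prod (𝟭 b.unop)).toCatHom).op).symm.trans
     (D.map_comp ((p.prod (𝟭 a.unop)).toCatHom).op ((prodLeft (Cat.of B)).map f)))
   (fun {a b f g} η => map₂_square D ((prodLeft (Cat.of C)).map₂ η) ((prodLeft (Cat.of B)).map₂ η) rfl rfl (by
      refine eq_conj_eqToHom ?_ _ _
      apply congrArg Bicategory.Opposite.op2
      apply congrArg NatTrans.toCatHom₂
      ext X : 2
      exact Prod.ext (p.map_id _).symm rfl) _ _)

/-! ### Full sub-prederivators -/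

theorem hom_eqToHom {C : Type*} [Category* C] {P : ObjectProperty C} {X Y : P.FullSubcategory} (h : X = Y) :
    (eqToHom h).hom = eqToHom (congrArg ObjectProperty.FullSubcategory.obj h) := by
  subst h; rfl

theorem functor_eq_of_ι {C E : Type*} [Category* C] [Category* E] {P : ObjectProperty E}
    {F G : C ⥤ P.FullSubcategory} (h : F ⋙ P.ι = G ⋙ P.ι) : F = G := by
  refine CategoryTheory.Functor.ext
    (fun X => ObjectProperty.FullSubcategory.ext (Functor.congr_obj h X)) (fun X Y k => ?_)
  refine ObjectProperty.hom_ext _ ?_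
  simp only [ObjectProperty.FullSubcategory.comp_hom, hom_eqToHom]
  exact Functor.congr_hom h k

theorem hom_app_conj {A : Cat.{v,u}} {C : Type u} [Category.{v} C] {P : ObjectProperty C}
    {F F' G' G : A ⟶ Cat.of P.FullSubcategory} (h : F = F') (α : F' ⟶ G') (h' : G' = G) (X : A) :
    InducedCategory.Hom.hom ((eqToHom h ≫ α ≫ eqToHom h').toNatTrans.app X) =
      eqToHom (by rw [h]) ≫ InducedCategory.Hom.hom (α.toNatTrans.app X) ≫ eqToHom (by rw [h']) := by
  subst h h'
  simp only [eqToHom_refl, Category.id_comp, Category.comp_id]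

theorem app_conj {A C : Cat.{v,u}} {F F' G' G : A ⟶ C} (h : F = F') (α : F' ⟶ G') (h' : G' = G)
    (X : A) : (eqToHom h ≫ α ≫ eqToHom h').toNatTrans.app X =
      eqToHom (by rw [h]) ≫ α.toNatTrans.app X ≫ eqToHom (by rw [h']) := by
  subst h h'
  simp only [eqToHom_refl, Category.id_comp, Category.comp_id]

/-- The full sub-prederivator on a class of objects closed under restriction. -/
def fullSub (E : Prederivator.{w,v,u}) (P : ∀ A, ObjectProperty (E.obj A))
    (hP : ∀ {A B} (f : A ⟶ B) X, P A X → P B ((E.map f).toFunctor.obj X)) : Prederivator.{w,v,u} :=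
  StrictPseudofunctor.mk'' {
    obj A := Cat.of (P A).FullSubcategory
    map {A B} f := ((P B).lift ((P A).ι ⋙ (E.map f).toFunctor) (fun X => hP f X.obj X.property)).toCatHom
    map₂ {A B f g} η := NatTrans.toCatHom₂
      { app X := ObjectProperty.homMk ((E.map₂ η).toNatTrans.app X.obj)
        naturality X Y k := by
          ext
          exact (E.map₂ η).toNatTrans.naturality k.hom }
    map₂_id f := by
      refine Cat.Hom₂.ext (NatTrans.ext (funext fun X => ObjectProperty.hom_ext _ ?_))
      exact congrArg (fun t => t.toNatTrans.app X.obj) (E.map₂_id f)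
    map₂_comp η θ := by
      refine Cat.Hom₂.ext (NatTrans.ext (funext fun X => ObjectProperty.hom_ext _ ?_))
      exact congrArg (fun t => t.toNatTrans.app X.obj) (E.map₂_comp η θ)
    map_id A := Cat.ext (functor_eq_of_ι
      (congrArg (fun t : E.obj A ⟶ E.obj A => (P A).ι ⋙ t.toFunctor) (E.map_id A)))
    map_comp {A B C} f g := Cat.ext (functor_eq_of_ι
      (congrArg (fun t : E.obj A ⟶ E.obj C => (P A).ι ⋙ t.toFunctor) (E.map_comp f g)))
    map₂_whisker_left f g g' η := by
      refine Cat.Hom₂.ext (NatTrans.ext (funext fun X => ObjectProperty.hom_ext _ ?_))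
      refine Eq.trans ?_ (hom_app_conj _ _ _ X).symm
      have := E.map₂_whisker_left f η
      rw [E.mapComp_eq_eqToIso, E.mapComp_eq_eqToIso] at this
      exact (congrArg (fun t => t.toNatTrans.app X.obj) this).trans
        (app_conj (E.map_comp f g) _ (E.map_comp f g').symm X.obj)
    map₂_whisker_right {_ _ _ f f'} η g := by
      refine Cat.Hom₂.ext (NatTrans.ext (funext fun X => ObjectProperty.hom_ext _ ?_))
      refine Eq.trans ?_ (hom_app_conj _ _ _ X).symm
      have := E.map₂_whisker_right η g
      rw [E.mapComp_eq_eqToIso, E.mapComp_eq_eqToIso] at this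
      exact (congrArg (fun t => t.toNatTrans.app X.obj) this).trans
        (app_conj (E.map_comp f g) _ (E.map_comp f' g).symm X.obj)
  }

/-- The inclusion of a full sub-prederivator. -/
def incl (E : Prederivator.{w,v,u}) (P : ∀ A, ObjectProperty (E.obj A))
    (hP : ∀ {A B} (f : A ⟶ B) X, P A X → P B ((E.map f).toFunctor.obj X)) :
   Mor (E.fullSub P hP) E :=
  strictTrans (F := E.fullSub P hP) (G := E) (fun A => (P A).ι.toCatHom) (fun _ => rfl)
   (fun _ => eq_conj_eqToHom rfl _ _)

theorem fullSub_mapId (E : Prederivator.{w,v,u}) (P : ∀ A, ObjectProperty (E.obj A))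
    (hP : ∀ {A B} (f : A ⟶ B) X, P A X → P B ((E.map f).toFunctor.obj X)) (A) (X : (E.fullSub P hP).obj A) :
   InducedCategory.Hom.hom (((E.fullSub P hP).mapId A).hom.toNatTrans.app X) = (E.mapId A).hom.toNatTrans.app X.obj := by
  rw [(E.fullSub P hP).mapId_eq_eqToIso, E.mapId_eq_eqToIso]
  simp only [eqToIso.hom, Cat.eqToHom_app]
  exact hom_eqToHom _

theorem fullSub_mapComp (E : Prederivator.{w,v,u}) (P : ∀ A, ObjectProperty (E.obj A))
    (hP : ∀ {A B} (f : A ⟶ B) X, P A X → P B ((E.map f).toFunctor.obj X)) {A B C} (f : A ⟶ B) (g : B ⟶ C)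
    (X : (E.fullSub P hP).obj A) :
   InducedCategory.Hom.hom (((E.fullSub P hP).mapComp f g).hom.toNatTrans.app X) = (E.mapComp f g).hom.toNatTrans.app X.obj := by
  rw [(E.fullSub P hP).mapComp_eq_eqToIso, E.mapComp_eq_eqToIso]
  simp only [eqToIso.hom, Cat.eqToHom_app]
  exact hom_eqToHom _

/-- The morphism of full sub-prederivators induced by a morphism preserving the defining classes. -/
def liftTrans {E E' : Prederivator.{w,v,u}} {P : ∀ A, ObjectProperty (E.obj A)}
    {hP : ∀ {A B} (f : A ⟶ B) X, P A X → P B ((E.map f).toFunctor.obj X)}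
    {P' : ∀ A, ObjectProperty (E'.obj A)}
    {hP' : ∀ {A B} (f : A ⟶ B) X, P' A X → P' B ((E'.map f).toFunctor.obj X)}
    (σ : Mor E E')
    (hσ : ∀ A X, P A X → P' A ((σ.app A).toFunctor.obj X)) :
    Mor (E.fullSub P hP) (E'.fullSub P' hP') where
  app A := ((P' A).lift ((P A).ι ⋙ (σ.app A).toFunctor) (fun X => hσ A X.obj X.property)).toCatHom
  naturality {A B} f := Cat.Hom.isoMk (NatIso.ofComponents
    (fun X => (P' B).isoMk ((Cat.Hom.toNatIso (σ.naturality f)).app X.obj))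
    (fun {X Y} k => ObjectProperty.hom_ext _ ((σ.naturality f).hom.toNatTrans.naturality k.hom)))
  naturality_naturality {A B f g} η := by
    refine Cat.Hom₂.ext (NatTrans.ext (funext fun X => ObjectProperty.hom_ext _ ?_))
    exact congrArg (fun t => t.toNatTrans.app X.obj) (σ.naturality_naturality η)
  naturality_id A := by
    refine Cat.Hom₂.ext (NatTrans.ext (funext fun X => ObjectProperty.hom_ext _ ?_))
    refine Eq.trans ?_ ((congrArg (fun t => t.toNatTrans.app X.obj) (σ.naturality_id A)).trans ?_)
    · exact congrArg (fun t => ((σ.naturality (𝟙 A)).hom.toNatTrans.app X.obj) ≫ t)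
        (E'.fullSub_mapId P' hP' A ⟨_, hσ A X.obj X.property⟩)
    · exact congrArg (fun t => (σ.app A).toFunctor.map t ≫ _) (E.fullSub_mapId P hP A X).symm
  naturality_comp f g := by
    refine Cat.Hom₂.ext (NatTrans.ext (funext fun X => ObjectProperty.hom_ext _ ?_))
    refine Eq.trans ?_ ((congrArg (fun t => t.toNatTrans.app X.obj) (σ.naturality_comp f g)).trans ?_)
    · exact congrArg (fun t => ((σ.naturality (f ≫ g)).hom.toNatTrans.app X.obj) ≫ t)
        (E'.fullSub_mapComp P' hP' f g ⟨_, hσ _ X.obj X.property⟩)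
    · exact congrArg (fun t => (σ.app _).toFunctor.map t ≫ _) (E.fullSub_mapComp P hP f g X).symm

end Prederivator

/-! ## Quivers of type `A_n` -/

/-- An `A_n`-quiver: an orientation of the path `1 — 2 — ⋯ — n`. -/
@[ext]
structure AnQuiver (n : ℕ) where
  /-- `Arrow i j` says that there is an arrow from `i` to `j`. -/
  Arrow : ℕ → ℕ → Prop
  arrow_mem : ∀ i j, Arrow i j → (1 ≤ i ∧ i ≤ n) ∧ (1 ≤ j ∧ j ≤ n) ∧ (j = i + 1 ∨ i = j + 1)
  orient : ∀ i, 1 ≤ i → i < n → Xor (Arrow i (i + 1)) (Arrow (i + 1) i)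

namespace AnQuiver

variable {n : ℕ}

/-- The vertices of an `A_n`-quiver, placed in an arbitrary universe. -/
@[ext]
structure Vert (Q : AnQuiver n) : Type w where
  pos : ℕ
  one_le : 1 ≤ pos
  le : pos ≤ n

instance vertQuiver (Q : AnQuiver n) : Quiver.{0} (Q.Vert : Type w) where
  Hom x y := PLift (Q.Arrow x.pos y.pos)

/-- The free category on an `A_n`-quiver. -/
abbrev Free (Q : AnQuiver n) : Type w := Paths (Q.Vert : Type w)

/-- A sink: a vertex at which no arrow starts. -/
def IsSink (Q : AnQuiver n) (a : ℕ) : Prop := (1 ≤ a ∧ a ≤ n) ∧ ∀ j, ¬ Q.Arrow a j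

/-- A source: a vertex at which no arrow ends. -/
def IsSource (Q : AnQuiver n) (a : ℕ) : Prop := (1 ≤ a ∧ a ≤ n) ∧ ∀ j, ¬ Q.Arrow j a

/-- The reflected quiver: the arrows adjacent to `a` are reversed. -/
def reflect (Q : AnQuiver n) (a : ℕ) : AnQuiver n where
  Arrow i j := if i = a ∨ j = a then Q.Arrow j i else Q.Arrow i j
  arrow_mem i j h := by
    split_ifs at h
    · obtain ⟨h1, h2, h3⟩ := Q.arrow_mem j i h
      exact ⟨h2, h1, h3.symm⟩
    · exact Q.arrow_mem i j h
  orient i h1 h2 := by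
    by_cases h : i = a ∨ i + 1 = a
    · rw [if_pos h, if_pos h.symm]
      exact (Q.orient i h1 h2).symm
    · rw [if_neg h, if_neg (fun h' => h h'.symm)]
      exact Q.orient i h1 h2

/-- Each entry of the list is a sink of the quiver reflected successively at the earlier entries. -/
def SinkChain : AnQuiver n → List ℕ → Prop
  | _, [] => True
  | Q, a :: as => Q.IsSink a ∧ SinkChain (Q.reflect a) as

/-- Each entry of the list is a source of the quiver reflected successively at the earlier entries. -/
def SourceChain : AnQuiver n → List ℕ → Prop
  | _, [] => True
  | Q, b :: bs => Q.IsSource b ∧ SourceChain (Q.reflect b) bs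

/-- Admissible sequences of sinks: total orderings of all the vertices that form a chain of sinks. -/
def IsAdmissibleSinks (Q : AnQuiver n) (as : List ℕ) : Prop :=
  as.Nodup ∧ (∀ a, a ∈ as ↔ 1 ≤ a ∧ a ≤ n) ∧ Q.SinkChain as

/-- Admissible sequences of sources. -/
def IsAdmissibleSources (Q : AnQuiver n) (bs : List ℕ) : Prop :=
  bs.Nodup ∧ (∀ b, b ∈ bs ↔ 1 ≤ b ∧ b ≤ n) ∧ Q.SourceChain bs

/-! ## The shapes defining reflection functors -/

/-- Shape for the reflection at a sink `a`: the vertices of `Q`, a vertex `a - 1` or `a + 1` where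
the sink `a` has no neighbour in `Q`, and one further vertex. -/
inductive SinkShape (Q : AnQuiver n) (a : ℕ) : Type
  | old (l : ℕ) (h : (1 ≤ l ∧ l ≤ n) ∨ l + 1 = a ∨ l = a + 1)
  | new

/-- The generating arrows: those of `Q`, arrows from `a - 1` and `a + 1` to `a`, and arrows from the
new vertex to `a - 1` and `a + 1`. -/
def SinkShape.Arrow {Q : AnQuiver n} {a : ℕ} : SinkShape Q a → SinkShape Q a → Prop
  | .old i _, .old j _ => Q.Arrow i j ∨ (j = a ∧ (i + 1 = a ∨ i = a + 1))
  | .new, .old j _ => j + 1 = a ∨ j = a + 1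
  | _, .new => False

/-- The poset generated by these arrows; in it the square formed by the new vertex, `a - 1`, `a + 1`
and `a` commutes. -/
instance SinkShape.preorder (Q : AnQuiver n) (a : ℕ) : Preorder (SinkShape Q a) where
  le := Relation.ReflTransGen SinkShape.Arrow
  le_refl _ := Relation.ReflTransGen.refl
  le_trans _ _ _ := Relation.ReflTransGen.trans

/-- The part of the shape without the new vertex. -/
abbrev SinkShapeOld (Q : AnQuiver n) (a : ℕ) : Type := {x : SinkShape Q a // x ≠ .new}

/-- The inclusion of `Q` in the shape without the new vertex (a cosieve if `a` is a sink). -/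
def sinkIn (Q : AnQuiver n) (a : ℕ) : (Q.Free : Type w) ⥤ Pos.{w} (SinkShapeOld Q a) :=
  Paths.lift
    { obj := fun x => ⟨⟨.old x.pos (Or.inl ⟨x.one_le, x.le⟩), by exact fun h => by cases h⟩⟩
      map := fun {_ _} f => homOfLE (Relation.ReflTransGen.single
        (show SinkShape.Arrow _ _ from Or.inl f.down)) }

/-- The inclusion of the shape without the new vertex in the whole shape. -/
def sinkMid (Q : AnQuiver n) (a : ℕ) : Pos.{w} (SinkShapeOld Q a) ⥤ Pos.{w} (SinkShape Q a) :=
  Pos.map Subtype.val (fun _ _ h => h)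

/-- The position in the shape of a vertex of the reflected quiver: `a` is sent to the new vertex. -/
def sinkOutObj (Q : AnQuiver n) (a : ℕ) (x : ((Q.reflect a).Vert : Type w)) : SinkShape Q a :=
  if x.pos = a then .new else .old x.pos (Or.inl ⟨x.one_le, x.le⟩)

/-- The inclusion of the reflected quiver in the shape. -/
def sinkOut (Q : AnQuiver n) (a : ℕ) (ha : Q.IsSink a) :
    ((Q.reflect a).Free : Type w) ⥤ Pos.{w} (SinkShape Q a) :=
  Paths.lift
    { obj := fun x => ⟨sinkOutObj Q a x⟩
      map := fun {x y} f => homOfLE (Relation.ReflTransGen.single (by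
        obtain ⟨f⟩ := f
        change (if x.pos = a ∨ y.pos = a then Q.Arrow y.pos x.pos else Q.Arrow x.pos y.pos) at f
        change SinkShape.Arrow (sinkOutObj Q a x) (sinkOutObj Q a y)
        unfold sinkOutObj
        by_cases hx : x.pos = a
        · rw [if_pos (Or.inl hx)] at f
          have hy : y.pos ≠ a := fun h => ha.2 _ (h ▸ f)
          rw [if_pos hx, if_neg hy]
          have := (Q.arrow_mem _ _ f).2.2
          rw [hx] at this
          rcases this with h | h
          · exact Or.inl h.symm
          · exact Or.inr h
        · by_cases hy : y.pos = a
          · rw [if_pos (Or.inr hy), hy] at f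
            exact absurd f (ha.2 _)
          · rw [if_neg (fun h => h.elim hx hy)] at f
            rw [if_neg hx, if_neg hy]
            exact Or.inl f)) }

/-- Shape for the reflection at a source `b`: the vertices of `Q`, a vertex `b - 1` or `b + 1` where
the source `b` has no neighbour in `Q`, and one further vertex. -/
inductive SourceShape (Q : AnQuiver n) (b : ℕ) : Type
  | old (l : ℕ) (h : (1 ≤ l ∧ l ≤ n) ∨ l + 1 = b ∨ l = b + 1)
  | new

/-- The generating arrows: those of `Q`, arrows from `b` to `b - 1` and `b + 1`, and arrows from
`b - 1` and `b + 1` to the new vertex. -/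
def SourceShape.Arrow {Q : AnQuiver n} {b : ℕ} : SourceShape Q b → SourceShape Q b → Prop
  | .old i _, .old j _ => Q.Arrow i j ∨ (i = b ∧ (j + 1 = b ∨ j = b + 1))
  | .old i _, .new => i + 1 = b ∨ i = b + 1
  | .new, _ => False

/-- The poset generated by these arrows; in it the square formed by `b`, `b - 1`, `b + 1` and the new
vertex commutes. -/
instance SourceShape.preorder (Q : AnQuiver n) (b : ℕ) : Preorder (SourceShape Q b) where
  le := Relation.ReflTransGen SourceShape.Arrow
  le_refl _ := Relation.ReflTransGen.refl
  le_trans _ _ _ := Relation.ReflTransGen.trans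

/-- The part of the shape without the new vertex. -/
abbrev SourceShapeOld (Q : AnQuiver n) (b : ℕ) : Type := {x : SourceShape Q b // x ≠ .new}

/-- The inclusion of `Q` in the shape without the new vertex (a sieve if `b` is a source). -/
def sourceIn (Q : AnQuiver n) (b : ℕ) : (Q.Free : Type w) ⥤ Pos.{w} (SourceShapeOld Q b) :=
  Paths.lift
    { obj := fun x => ⟨⟨.old x.pos (Or.inl ⟨x.one_le, x.le⟩), by exact fun h => by cases h⟩⟩
      map := fun {_ _} f => homOfLE (Relation.ReflTransGen.single
        (show SourceShape.Arrow _ _ from Or.inl f.down)) }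

/-- The inclusion of the shape without the new vertex in the whole shape. -/
def sourceMid (Q : AnQuiver n) (b : ℕ) :
    Pos.{w} (SourceShapeOld Q b) ⥤ Pos.{w} (SourceShape Q b) :=
  Pos.map Subtype.val (fun _ _ h => h)

/-- The position in the shape of a vertex of the reflected quiver: `b` is sent to the new vertex. -/
def sourceOutObj (Q : AnQuiver n) (b : ℕ) (x : ((Q.reflect b).Vert : Type w)) : SourceShape Q b :=
  if x.pos = b then .new else .old x.pos (Or.inl ⟨x.one_le, x.le⟩)

/-- The inclusion of the reflected quiver in the shape. -/
def sourceOut (Q : AnQuiver n) (b : ℕ) (hb : Q.IsSource b) :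
    ((Q.reflect b).Free : Type w) ⥤ Pos.{w} (SourceShape Q b) :=
  Paths.lift
    { obj := fun x => ⟨sourceOutObj Q b x⟩
      map := fun {x y} f => homOfLE (Relation.ReflTransGen.single (by
        obtain ⟨f⟩ := f
        change (if x.pos = b ∨ y.pos = b then Q.Arrow y.pos x.pos else Q.Arrow x.pos y.pos) at f
        change SourceShape.Arrow (sourceOutObj Q b x) (sourceOutObj Q b y)
        unfold sourceOutObj
        by_cases hy : y.pos = b
        · rw [if_pos (Or.inr hy)] at f
          have hx : x.pos ≠ b := fun h => hb.2 _ (h ▸ f)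
          rw [if_pos hy, if_neg hx]
          have := (Q.arrow_mem _ _ f).2.2
          rw [hy] at this
          rcases this with h | h
          · exact Or.inr h
          · exact Or.inl h.symm
        · by_cases hx : x.pos = b
          · rw [if_pos (Or.inl hx), hx] at f
            exact absurd f (hb.2 _)
          · rw [if_neg (fun h => h.elim hx hy)] at f
            rw [if_neg hx, if_neg hy]
            exact Or.inl f)) }

end AnQuiver

/-! ## Mesh categories -/

/-- The vertices `(k, l)`, `k ∈ ℤ`, `0 ≤ l ≤ n + 1`, of the repetitive quivers on `n + 2` points. -/
@[ext]
structure MeshPt (n : ℕ) : Type where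
  k : ℤ
  l : ℕ
  le : l ≤ n + 1

/-- The arrows of the repetitive quiver of a quiver with arrows `r` on the vertices `0, …, n + 1`:
an arrow `p → q` yields arrows `(k, p) → (k, q)` and `(k, q) → (k + 1, p)`. -/
def RepArrow (r : ℕ → ℕ → Prop) {n : ℕ} (x y : MeshPt n) : Prop :=
  (y.k = x.k ∧ r x.l y.l) ∨ (y.k = x.k + 1 ∧ r y.l x.l)

/-- The arrows of the linearly oriented quiver `0 → 1 → ⋯ → n + 1`. -/
def linArrow (i j : ℕ) : Prop := j = i + 1

/-- The mesh category `M_n` is a poset: it is the poset generated by the arrows of the repetitive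
quiver of `0 → 1 → ⋯ → n + 1`. -/
instance MeshPt.preorder (n : ℕ) : Preorder (MeshPt n) where
  le := Relation.ReflTransGen (RepArrow linArrow)
  le_refl _ := Relation.ReflTransGen.refl
  le_trans _ _ _ := Relation.ReflTransGen.trans

/-- The mesh category `M_n`. -/
abbrev Mesh (n : ℕ) : Type w := Pos.{w} (MeshPt n)

namespace Mesh

variable {n : ℕ}

theorem le_of_arrow {x y : MeshPt n} (h : RepArrow linArrow x y) : x ≤ y :=
  Relation.ReflTransGen.single h

/-- The translation `(k, l) ↦ (k + c, l)` of vertices. -/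
def translatePt (c : ℤ) (x : MeshPt n) : MeshPt n := ⟨x.k + c, x.l, x.le⟩

theorem translatePt_mono (c : ℤ) : Monotone (translatePt c : MeshPt n → MeshPt n) := by
  intro x y h
  refine Relation.ReflTransGen.lift (r := RepArrow linArrow) (translatePt c) (fun a b hab => ?_) _ _ h
  rcases hab with ⟨h1, h2⟩ | ⟨h1, h2⟩
  · exact Or.inl ⟨congrArg (· + c) h1, h2⟩
  · exact Or.inr ⟨(congrArg (· + c) h1).trans (add_right_comm _ _ _), h2⟩

/-- The translation `(k, l) ↦ (k + c, l)` of the mesh category. -/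
def translate (c : ℤ) : Mesh.{w} n ⥤ Mesh.{w} n := Pos.map (translatePt c) (translatePt_mono c)

/-- The corners of the mesh square starting at `(k, l + 1)`. -/
def squarePt (k : ℤ) (l : ℕ) (hl : l < n) (s : Sq) : MeshPt n :=
  if s.1 = 0 then
    if s.2 = 0 then ⟨k, l + 1, by omega⟩ else ⟨k + 1, l, by omega⟩
  else
    if s.2 = 0 then ⟨k, l + 2, by omega⟩ else ⟨k + 1, l + 1, by omega⟩

theorem squarePt_mono (k : ℤ) (l : ℕ) (hl : l < n) : Monotone (squarePt k l hl) := by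
  have h1 : squarePt k l hl (0, 0) ≤ squarePt k l hl (1, 0) := le_of_arrow (Or.inl ⟨rfl, rfl⟩)
  have h2 : squarePt k l hl (0, 0) ≤ squarePt k l hl (0, 1) := le_of_arrow (Or.inr ⟨rfl, rfl⟩)
  have h3 : squarePt k l hl (1, 0) ≤ squarePt k l hl (1, 1) := le_of_arrow (Or.inr ⟨rfl, rfl⟩)
  have h4 : squarePt k l hl (0, 1) ≤ squarePt k l hl (1, 1) := le_of_arrow (Or.inl ⟨rfl, rfl⟩)
  rintro ⟨a, b⟩ ⟨c, d⟩ ⟨hac, hbd⟩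
  fin_cases a <;> fin_cases b <;> fin_cases c <;> fin_cases d <;>
    first
    | exact le_refl _
    | exact h1
    | exact h2
    | exact h3
    | exact h4
    | exact h1.trans h3
    | exact absurd hac (by decide)
    | exact absurd hbd (by decide)

theorem translatePt_squarePt (c k : ℤ) (l : ℕ) (hl : l < n) (s : Sq) :
    translatePt c (squarePt k l hl s) = squarePt (k + c) l hl s := by
  unfold squarePt
  split_ifs
  · rfl
  · exact MeshPt.ext (add_right_comm _ _ _) rfl
  · rfl
  · exact MeshPt.ext (add_right_comm _ _ _) rfl

/-- The mesh square `(k, l + 1) → (k, l + 2), (k + 1, l) → (k + 1, l + 1)`. -/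
def square (k : ℤ) (l : ℕ) (hl : l < n) : Pos.{w} Sq ⥤ Mesh.{w} n :=
  Pos.map (squarePt k l hl) (squarePt_mono k l hl)

end Mesh

namespace AnQuiver

variable {n : ℕ}

/-- The arrows of the extended quiver of `Q`: those of `Q` and arrows `1 → 0` and `n → n + 1`. -/
def extArrow (Q : AnQuiver n) (i j : ℕ) : Prop :=
  Q.Arrow i j ∨ (i = 1 ∧ j = 0) ∨ (i = n ∧ j = n + 1)

/-- An isomorphism from the repetitive quiver of the extended quiver of `Q` to the repetitive quiver
of `0 → 1 → ⋯ → n + 1`. -/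
structure RepIso (Q : AnQuiver n) where
  toEquiv : MeshPt n ≃ MeshPt n
  arrow_iff : ∀ x y, RepArrow Q.extArrow x y ↔ RepArrow linArrow (toEquiv x) (toEquiv y)

/-- The embedding `i_Q : Q ⥤ M_n` determined by such an isomorphism, `q ↦ φ(0, q)`. -/
def RepIso.embedding {Q : AnQuiver n} (φ : Q.RepIso) : (Q.Free : Type w) ⥤ Mesh.{w} n :=
  Paths.lift
    { obj := fun x => ⟨φ.toEquiv ⟨0, x.pos, x.le.trans (Nat.le_succ n)⟩⟩
      map := fun {_ _} f => homOfLE (Mesh.le_of_arrow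
        ((φ.arrow_iff _ _).1 (Or.inl ⟨rfl, Or.inl f.down⟩))) }

end AnQuiver

namespace Prederivator

/-! ## Coherent Auslander--Reiten quivers -/

/-- A coherent diagram on `M_n` that vanishes at all `(k, 0)` and `(k, n + 1)` and makes all mesh
squares bicartesian. -/
structure IsARDiagram (D : Prederivator.{w,v,u}) (n : ℕ) (X : D.Diag (Mesh.{w} n)) : Prop where
  zero_bot : ∀ k : ℤ, Limits.IsZero ((D.ev (⟨⟨k, 0, by omega⟩⟩ : Mesh.{w} n)).obj X)
  zero_top : ∀ k : ℤ, Limits.IsZero ((D.ev (⟨⟨k, n + 1, le_rfl⟩⟩ : Mesh.{w} n)).obj X)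
  cartesian : ∀ (k : ℤ) (l : ℕ) (hl : l < n),
    D.IsCartesian ((D.res (Mesh.square.{w} k l hl)).obj X)
  cocartesian : ∀ (k : ℤ) (l : ℕ) (hl : l < n),
    D.IsCocartesian ((D.res (Mesh.square.{w} k l hl)).obj X)

/-- The diagrams in `D(M_n × A)` whose values `X_a` in `D(M_n)`, for `a` in `A`, satisfy the vanishing
and exactness conditions. -/
def arProp (D : Prederivator.{w,v,u}) (n : ℕ) (A : Cat.{w,w}ᵒᵖ) :
    ObjectProperty ((D.shift (Mesh.{w} n)).obj A) :=
  fun X => ∀ a : A.unop, D.IsARDiagram n ((D.res (Prod.sectL (Mesh.{w} n) a)).obj X)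

theorem arProp_map (D : Prederivator.{w,v,u}) (n : ℕ) {A B : Cat.{w,w}ᵒᵖ} (f : A ⟶ B)
    (X : (D.shift (Mesh.{w} n)).obj A) (hX : D.arProp n A X) :
    D.arProp n B (((D.shift (Mesh.{w} n)).map f).toFunctor.obj X) := by
  intro b
  have h : Prod.sectL (Mesh.{w} n) b ⋙ (𝟭 (Mesh.{w} n)).prod f.unop.toFunctor =
      Prod.sectL (Mesh.{w} n) (f.unop.toFunctor.obj b) := by
    refine CategoryTheory.Functor.ext (fun _ => rfl) (fun x y g => ?_)
    refine eq_conj_eqToHom ?_ _ _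
    refine Prod.ext rfl ?_
    exact f.unop.toFunctor.map_id b
  have e := (D.res_comp_obj (Prod.sectL (Mesh.{w} n) b)
    ((𝟭 (Mesh.{w} n)).prod f.unop.toFunctor) X).symm.trans (congrArg (fun p => (D.res p).obj X) h)
  exact e ▸ hX (f.unop.toFunctor.obj b)

/-- The full sub-prederivator `D^{M_n,ex}` of `D^{M_n}`. -/
def meshEx (D : Prederivator.{w,v,u}) (n : ℕ) : Prederivator.{w,v,u} :=
  (D.shift (Mesh.{w} n)).fullSub (D.arProp n) (D.arProp_map n)

theorem IsARDiagram.translate {D : Prederivator.{w,v,u}} {n : ℕ} {X : D.Diag (Mesh.{w} n)}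
    (hX : D.IsARDiagram n X) (c : ℤ) : D.IsARDiagram n ((D.res (Mesh.translate.{w} c)).obj X) := by
  have hev : ∀ x : MeshPt n, (D.ev (⟨x⟩ : Mesh.{w} n)).obj ((D.res (Mesh.translate.{w} c)).obj X) =
      (D.ev (⟨Mesh.translatePt c x⟩ : Mesh.{w} n)).obj X := fun x =>
    (D.res_comp_obj _ _ X).symm.trans (congrArg (fun p => (D.res p).obj X)
      (CategoryTheory.Functor.ext (fun _ => rfl) (fun _ _ _ => Subsingleton.elim _ _)))
  have hsq : ∀ (k : ℤ) (l : ℕ) (hl : l < n),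
      (D.res (Mesh.square.{w} k l hl)).obj ((D.res (Mesh.translate.{w} c)).obj X) =
        (D.res (Mesh.square.{w} (k + c) l hl)).obj X := fun k l hl =>
    (D.res_comp_obj _ _ X).symm.trans (congrArg (fun p => (D.res p).obj X)
      (CategoryTheory.Functor.ext
        (fun s => congrArg Pos.mk (Mesh.translatePt_squarePt c k l hl s.pt))
        (fun _ _ _ => Subsingleton.elim _ _)))
  refine ⟨fun k => ?_, fun k => ?_, fun k l hl => ?_, fun k l hl => ?_⟩
  · rw [hev]
    exact hX.zero_bot (k + c)
  · rw [hev]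
    exact hX.zero_top (k + c)
  · rw [hsq]
    exact hX.cartesian (k + c) l hl
  · rw [hsq]
    exact hX.cocartesian (k + c) l hl

theorem arProp_translate (D : Prederivator.{w,v,u}) (n : ℕ) (c : ℤ) (A : Cat.{w,w}ᵒᵖ)
    (X : (D.shift (Mesh.{w} n)).obj A) (hX : D.arProp n A X) :
    D.arProp n A (((D.resMor (Mesh.translate.{w} (n := n) c)).app A).toFunctor.obj X) := by
  intro a
  have e := (D.res_comp_obj (Prod.sectL (Mesh.{w} n) a)
      ((Mesh.translate.{w} (n := n) c).prod (𝟭 A.unop)) X).symm.trans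
    (D.res_comp_obj (Mesh.translate.{w} (n := n) c) (Prod.sectL (Mesh.{w} n) a) X)
  exact e ▸ (hX a).translate c

/-- The morphism of `D^{M_n,ex}` induced by the translation `(k, l) ↦ (k + c, l)` of `M_n`. -/
def meshTranslate (D : Prederivator.{w,v,u}) (n : ℕ) (c : ℤ) : Mor (D.meshEx n) (D.meshEx n) :=
  liftTrans (D.resMor (Mesh.translate.{w} c)) (D.arProp_translate n c)

/-- The Auslander--Reiten translation `τ = t^*`, where `t(k, l) = (k - 1, l)`. -/
def arTau (D : Prederivator.{w,v,u}) (n : ℕ) : Mor (D.meshEx n) (D.meshEx n) :=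
  D.meshTranslate n (-1)

/-- The inverse Auslander--Reiten translation `τ^- = (t^{-1})^*`. -/
def arTauInv (D : Prederivator.{w,v,u}) (n : ℕ) : Mor (D.meshEx n) (D.meshEx n) :=
  D.meshTranslate n 1

variable {n : ℕ}

/-- The prederivator `D^Q` of coherent representations of `Q`. -/
abbrev rep (D : Prederivator.{w,v,u}) (Q : AnQuiver n) : Prederivator.{w,v,u} :=
  D.shift (Q.Free : Type w)

/-- The restriction morphism `i_Q^* : D^{M_n,ex} ⟶ D^Q`. -/
def iStar (D : Prederivator.{w,v,u}) {Q : AnQuiver n} (φ : Q.RepIso) :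
    Mor (D.meshEx n) (D.rep Q) :=
  incl _ (D.arProp n) (D.arProp_map n) ≫ D.resMor φ.embedding.{w}

/-- `F` is a morphism `F_Q : D^Q ⟶ D^{M_n,ex}` such that `(F_Q, i_Q^*)` is an equivalence. -/
def IsInverseToIStar (D : Prederivator.{w,v,u}) {Q : AnQuiver n} (φ : Q.RepIso)
    (F : Mor (D.rep Q) (D.meshEx n)) : Prop :=
  Nonempty (F ≫ D.iStar φ ≅ 𝟙 _) ∧ Nonempty (D.iStar φ ≫ F ≅ 𝟙 _)

/-! ## Reflection functors and Coxeter functors -/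

/-- The reflection functors at a sink `a`: left extension by zero (a left adjoint, in the 2-category
of prederivators, of restriction along a cosieve), which provides zero objects in place of the missing
neighbours of `a`; then right Kan extension to a cartesian square ending at `a`; then restriction to
the reflected quiver. -/
def IsSinkReflection (D : Prederivator.{w,v,u}) (Q : AnQuiver n) (a : ℕ) (ha : Q.IsSink a)
    (s : Mor (D.rep Q) (D.rep (Q.reflect a))) : Prop :=
  ∃ (L : Mor (D.rep Q) (D.shift (Pos.{w} (Q.SinkShapeOld a))))
    (R : Mor (D.shift (Pos.{w} (Q.SinkShapeOld a))) (D.shift (Pos.{w} (Q.SinkShape a)))),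
    Nonempty (Bicategory.Adjunction L (D.resMor (Q.sinkIn a))) ∧
    Nonempty (Bicategory.Adjunction (D.resMor (Q.sinkMid a)) R) ∧
    Nonempty (s ≅ L ≫ R ≫ D.resMor (Q.sinkOut a ha))

/-- The reflection functors at a source `b`: right extension by zero, which provides zero objects in
place of the missing neighbours of `b`; then left Kan extension to a cocartesian square starting at
`b`; then restriction to the reflected quiver. -/
def IsSourceReflection (D : Prederivator.{w,v,u}) (Q : AnQuiver n) (b : ℕ) (hb : Q.IsSource b)
    (s : Mor (D.rep Q) (D.rep (Q.reflect b))) : Prop :=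
  ∃ (R : Mor (D.rep Q) (D.shift (Pos.{w} (Q.SourceShapeOld b))))
    (L : Mor (D.shift (Pos.{w} (Q.SourceShapeOld b))) (D.shift (Pos.{w} (Q.SourceShape b)))),
    Nonempty (Bicategory.Adjunction (D.resMor (Q.sourceIn b)) R) ∧
    Nonempty (Bicategory.Adjunction L (D.resMor (Q.sourceMid b))) ∧
    Nonempty (s ≅ R ≫ L ≫ D.resMor (Q.sourceOut b hb))

/-- `IsSinkComposite D Q Q' (a₁, …, aₘ) Φ`: the quiver `Q'` is `Q` reflected successively at
`a₁, …, aₘ`, and `Φ` is a composite of reflection functors at these sinks, first `a₁`, last `aₘ`. -/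
inductive IsSinkComposite (D : Prederivator.{w,v,u}) :
    (Q Q' : AnQuiver n) → List ℕ → Mor (D.rep Q) (D.rep Q') → Prop
  | nil (Q : AnQuiver n) : IsSinkComposite D Q Q [] (𝟙 _)
  | cons {Q Q' : AnQuiver n} {a : ℕ} {as : List ℕ} (ha : Q.IsSink a)
      {s : Mor (D.rep Q) (D.rep (Q.reflect a))} (hs : D.IsSinkReflection Q a ha s)
      {Φ : Mor (D.rep (Q.reflect a)) (D.rep Q')}
      (hΦ : IsSinkComposite D (Q.reflect a) Q' as Φ) :
      IsSinkComposite D Q Q' (a :: as) (s ≫ Φ)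

/-- `IsSourceComposite D Q Q' (b₁, …, bₘ) Φ`: the quiver `Q'` is `Q` reflected successively at
`b₁, …, bₘ`, and `Φ` is a composite of reflection functors at these sources, first `b₁`, last `bₘ`. -/
inductive IsSourceComposite (D : Prederivator.{w,v,u}) :
    (Q Q' : AnQuiver n) → List ℕ → Mor (D.rep Q) (D.rep Q') → Prop
  | nil (Q : AnQuiver n) : IsSourceComposite D Q Q [] (𝟙 _)
  | cons {Q Q' : AnQuiver n} {b : ℕ} {bs : List ℕ} (hb : Q.IsSource b)
      {s : Mor (D.rep Q) (D.rep (Q.reflect b))} (hs : D.IsSourceReflection Q b hb s)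
      {Φ : Mor (D.rep (Q.reflect b)) (D.rep Q')}
      (hΦ : IsSourceComposite D (Q.reflect b) Q' bs Φ) :
      IsSourceComposite D Q Q' (b :: bs) (s ≫ Φ)

/-- The Coxeter functors `Φ^+_Q : D^Q ⟶ D^Q`: composites along admissible sequences of sinks. -/
def IsCoxeterPlus (D : Prederivator.{w,v,u}) (Q : AnQuiver n) (Φ : Mor (D.rep Q) (D.rep Q)) : Prop :=
  ∃ as, Q.IsAdmissibleSinks as ∧ D.IsSinkComposite Q Q as Φ

/-- The Coxeter functors `Φ^-_Q : D^Q ⟶ D^Q`: composites along admissible sequences of sources. -/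
def IsCoxeterMinus (D : Prederivator.{w,v,u}) (Q : AnQuiver n) (Φ : Mor (D.rep Q) (D.rep Q)) : Prop :=
  ∃ bs, Q.IsAdmissibleSources bs ∧ D.IsSourceComposite Q Q bs Φ

end Prederivator

/-! Everything happens inside the mesh category. Give the vertex (k, l) the height 2k + l. A copy of
an orientation of the path on 1, …, n in the mesh category is the interior of a section: one vertex
at each level, neighbouring heights differing by one. An exact diagram on the mesh category is
determined by its values on any section, and reflecting the quiver at a sink or source only moves
the section at one vertex, by two units of height.

For the equivalence, fix a section that has peaks on the boundary. An exact diagram is recovered in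
four steps: extend by zero to the boundary above the section (right Kan extension), fill in the
cocartesian squares upwards (left Kan extension), extend by zero to the remaining boundary (left Kan
extension), and fill in the cartesian squares downwards (right Kan extension). Stability says that
squares filled in either way are bicartesian. `IsStableDerivator.isARDiagram_iff` expresses
exactness by these four conditions, and `isEquivalence_of_chain` turns them into an equivalence.
That the image of every isomorphism of repetitive quivers gives such a section is
`RepIso.isEmbedding` with `IsEmbedding.isSection`.

For the reflections, place the shape that defines a reflection at a sink in the mesh category: the
missing neighbours land on the boundary, where exact diagrams vanish, and the new square lands on a
mesh square, which is cartesian. Hence the restriction of an exact diagram to the shape already is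
the iterated Kan extension in the definition, and `IsEmbedding.nonempty_restrEx_sinkReflection`
identifies restriction to a section followed by the reflection with restriction to the moved
section. Sources are dual. Along an admissible sequence each vertex moves exactly once, so the
section is translated by one mesh as a whole: restricting and then applying a Coxeter functor is
translating and then restricting. Since restriction is an equivalence, this determines the composite
up to isomorphism, whatever the sequence, and gives the comparison with the Auslander–Reiten
translation.

Kan extensions are handled without choosing adjoints. Being a left Kan extension along p is
expressed by `FullyFaithfulFrom` (restriction along p is bijective on morphisms out of the diagram),
which by (Der2) and (Der4) can be tested pointwise as a colimit condition on slices
(`IsDerivator.fullyFaithfulFrom_iff`); dually with `FullyFaithfulTo`. -/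

/-! ## Universal arrows -/

section Universal

variable {C E : Type*} [Category* C] [Category* E]

/-- `f : X ⟶ G Z` is a universal arrow from `X` to `G`. -/
def IsUniversalArrow (G : E ⥤ C) {X : C} {Z : E} (f : X ⟶ G.obj Z) : Prop :=
  ∀ W, Function.Bijective (fun g : Z ⟶ W => f ≫ G.map g)

/-- `f : G Z ⟶ X` is a universal arrow from `G` to `X`. -/
def IsCouniversalArrow (G : E ⥤ C) {X : C} {Z : E} (f : G.obj Z ⟶ X) : Prop :=
  ∀ W, Function.Bijective (fun g : W ⟶ Z => G.map g ≫ f)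

theorem isUniversalArrow_iso_comp (G : E ⥤ C) {X X' : C} {Z : E} (e : X' ⟶ X) [IsIso e]
    (f : X ⟶ G.obj Z) : IsUniversalArrow G (e ≫ f) ↔ IsUniversalArrow G f := by
  refine forall_congr' fun W => ?_
  have : (fun g : Z ⟶ W => (e ≫ f) ≫ G.map g) = (fun h => e ≫ h) ∘ fun g => f ≫ G.map g := by
    funext g; simp
  rw [this]
  exact (Iso.homFromEquiv (asIso e)).symm.bijective.of_comp_iff' _ |>.trans Iff.rfl

theorem isCouniversalArrow_comp_iso (G : E ⥤ C) {X X' : C} {Z : E} (e : X ⟶ X') [IsIso e]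
    (f : G.obj Z ⟶ X) : IsCouniversalArrow G (f ≫ e) ↔ IsCouniversalArrow G f := by
  refine forall_congr' fun W => ?_
  have : (fun g : W ⟶ Z => G.map g ≫ f ≫ e) = (fun h => h ≫ e) ∘ fun g => G.map g ≫ f := by
    funext g; simp
  rw [this]
  exact (Iso.homToEquiv (asIso e)).bijective.of_comp_iff' _

/-- Under the adjunction, composing with f becomes precomposition with its transpose, and by Yoneda
the latter is always bijective exactly when the transpose is invertible. -/
theorem isUniversalArrow_iff_isIso {G : E ⥤ C} {L : C ⥤ E} (adj : L ⊣ G) {X : C} {Z : E}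
    (f : X ⟶ G.obj Z) : IsUniversalArrow G f ↔ IsIso ((adj.homEquiv X Z).symm f) := by
  rw [isIso_iff_coyoneda_map_bijective]
  refine forall_congr' fun W => ?_
  have : (fun g : Z ⟶ W => f ≫ G.map g) =
      adj.homEquiv X W ∘ fun g => (adj.homEquiv X Z).symm f ≫ g := by
    funext g
    simp [Adjunction.homEquiv_naturality_right]
  rw [this]
  exact (adj.homEquiv X W).bijective.of_comp_iff' _

theorem isCouniversalArrow_iff_isIso {G : E ⥤ C} {R : C ⥤ E} (adj : G ⊣ R) {X : C} {Z : E}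
    (f : G.obj Z ⟶ X) : IsCouniversalArrow G f ↔ IsIso (adj.homEquiv Z X f) := by
  rw [isIso_iff_yoneda_map_bijective]
  refine forall_congr' fun W => ?_
  have : (fun g : W ⟶ Z => G.map g ≫ f) =
      (adj.homEquiv W X).symm ∘ fun g => g ≫ adj.homEquiv Z X f := by
    funext g
    simp [Adjunction.homEquiv_naturality_left_symm]
  rw [this]
  exact (adj.homEquiv W X).symm.bijective.of_comp_iff' _

/-- `F` is bijective on morphisms out of `X`. -/
def FullyFaithfulFrom (F : C ⥤ E) (X : C) : Prop :=
  ∀ Y, Function.Bijective (fun f : X ⟶ Y => F.map f)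

/-- `F` is bijective on morphisms into `Y`. -/
def FullyFaithfulTo (F : C ⥤ E) (Y : C) : Prop :=
  ∀ X, Function.Bijective (fun f : X ⟶ Y => F.map f)

theorem isUniversalArrow_iff_of_isIso (G : E ⥤ C) {X : C} {Z : E} (f : X ⟶ G.obj Z) [IsIso f] :
    IsUniversalArrow G f ↔ FullyFaithfulFrom G Z := by
  refine forall_congr' fun W => ?_
  exact (Iso.homFromEquiv (asIso f)).symm.bijective.of_comp_iff' (fun g : Z ⟶ W => G.map g)

theorem isCouniversalArrow_iff_of_isIso (G : E ⥤ C) {X : C} {Z : E} (f : G.obj Z ⟶ X) [IsIso f] :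
    IsCouniversalArrow G f ↔ FullyFaithfulTo G Z := by
  refine forall_congr' fun W => ?_
  exact (Iso.homToEquiv (asIso f)).bijective.of_comp_iff' (fun g : W ⟶ Z => G.map g)

/-- The counit is the transpose of the identity of G Z. When L is fully faithful the condition
singles out the essential image of L, but it is phrased through G alone. -/
theorem fullyFaithfulFrom_iff_isIso_counit {G : E ⥤ C} {L : C ⥤ E} (adj : L ⊣ G) (Z : E) :
    FullyFaithfulFrom G Z ↔ IsIso (adj.counit.app Z) := by
  rw [← isUniversalArrow_iff_of_isIso G (𝟙 (G.obj Z)), isUniversalArrow_iff_isIso adj]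
  simp [Adjunction.homEquiv_counit]

theorem fullyFaithfulTo_iff_isIso_unit {G : E ⥤ C} {R : C ⥤ E} (adj : G ⊣ R) (Z : E) :
    FullyFaithfulTo G Z ↔ IsIso (adj.unit.app Z) := by
  rw [← isCouniversalArrow_iff_of_isIso G (𝟙 (G.obj Z)), isCouniversalArrow_iff_isIso adj]
  simp [Adjunction.homEquiv_unit]

theorem FullyFaithfulFrom.of_iso {F : C ⥤ E} {X X' : C} (e : X ≅ X') (h : FullyFaithfulFrom F X) :
    FullyFaithfulFrom F X' := by
  intro Y
  have : (fun f : X' ⟶ Y => F.map f) =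
      (fun g => F.map e.inv ≫ g) ∘ (fun f : X ⟶ Y => F.map f) ∘ fun f => e.hom ≫ f := by
    funext f
    change F.map f = F.map e.inv ≫ F.map (e.hom ≫ f)
    rw [← F.map_comp, e.inv_hom_id_assoc]
  rw [this]
  exact (Iso.homFromEquiv (F.mapIso e)).bijective.comp
    ((h Y).comp (Iso.homFromEquiv e).symm.bijective)

theorem FullyFaithfulTo.of_iso {F : C ⥤ E} {X X' : C} (e : X ≅ X') (h : FullyFaithfulTo F X) :
    FullyFaithfulTo F X' := by
  intro Y
  have : (fun f : Y ⟶ X' => F.map f) =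
      (fun g => g ≫ F.map e.hom) ∘ (fun f : Y ⟶ X => F.map f) ∘ fun f => f ≫ e.inv := by
    funext f
    change F.map f = F.map (f ≫ e.inv) ≫ F.map e.hom
    rw [← F.map_comp, Category.assoc, e.inv_hom_id, Category.comp_id]
  rw [this]
  exact (Iso.homToEquiv (F.mapIso e)).bijective.comp
    ((h Y).comp (Iso.homToEquiv e).symm.bijective)

end Universal

/-! ### Strict functoriality of restriction -/

namespace Prederivator

section Restriction

variable (D : Prederivator.{w,v,u}) {A B C : Type w} [SmallCategory A] [SmallCategory B]
  [SmallCategory C]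

theorem res_comp (p : A ⥤ B) (q : B ⥤ C) : D.res (p ⋙ q) = D.res q ⋙ D.res p :=
  congrArg Cat.Hom.toFunctor (D.map_comp q.toCatHom.op p.toCatHom.op)

theorem res_id : D.res (𝟭 A) = 𝟭 _ :=
  congrArg Cat.Hom.toFunctor (D.map_id (Opposite.op (Cat.of A)))

theorem res_id_obj (X : D.Diag A) : (D.res (𝟭 A)).obj X = X := by
  rw [res_id]; rfl

theorem resComp_hom_app (p : A ⥤ B) (q : B ⥤ C) (X : D.Diag C) :
    (D.resComp p q).hom.app X = eqToHom (D.res_comp_obj p q X) := by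
  have := congrArg Iso.hom (D.mapComp_eq_eqToIso q.toCatHom.op p.toCatHom.op)
  exact (congrArg (fun t => t.toNatTrans.app X) this).trans (Cat.eqToHom_app _ _ (D.map_comp _ _) X)

theorem resComp_inv_app (p : A ⥤ B) (q : B ⥤ C) (X : D.Diag C) :
    (D.resComp p q).inv.app X = eqToHom (D.res_comp_obj p q X).symm := by
  have := congrArg Iso.inv (D.mapComp_eq_eqToIso q.toCatHom.op p.toCatHom.op)
  exact (congrArg (fun t => t.toNatTrans.app X) this).trans (Cat.eqToHom_app _ _ (D.map_comp _ _).symm X)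

theorem resTrans_id (p : A ⥤ B) : D.resTrans (𝟙 p) = 𝟙 _ :=
  congrArg Cat.Hom₂.toNatTrans (D.map₂_id p.toCatHom.op)

theorem resTrans_comp {p q r : A ⥤ B} (α : p ⟶ q) (β : q ⟶ r) :
    D.resTrans (α ≫ β) = D.resTrans α ≫ D.resTrans β :=
  congrArg Cat.Hom₂.toNatTrans (D.map₂_comp (Bicategory.Opposite.op2 α.toCatHom₂)
    (Bicategory.Opposite.op2 β.toCatHom₂))

theorem resTrans_eqToHom_app {p q : A ⥤ B} (h : p = q) (X : D.Diag B) :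
    (D.resTrans (eqToHom h)).app X = eqToHom (by rw [h]) := by
  subst h
  rw [eqToHom_refl, resTrans_id]
  rfl

/-- Reversing 1-cells exchanges the two sides of whiskering, hence the appeal to
`map₂_whisker_right`; strictness makes the structure isomorphisms into `eqToHom`. -/
theorem resTrans_whiskerLeft_app (p : A ⥤ B) {q q' : B ⥤ C} (α : q ⟶ q') (X : D.Diag C) :
    (D.resTrans (Functor.whiskerLeft p α)).app X = eqToHom (D.res_comp_obj p q X) ≫
      (D.res p).map ((D.resTrans α).app X) ≫ eqToHom (D.res_comp_obj p q' X).symm := by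
  have := congrArg (fun t => t.toNatTrans.app X)
    (D.map₂_whisker_right (Bicategory.Opposite.op2 α.toCatHom₂) p.toCatHom.op)
  refine this.trans ?_
  rw [← resComp_hom_app, ← resComp_inv_app]
  rfl

theorem resTrans_whiskerRight_app {p p' : A ⥤ B} (α : p ⟶ p') (q : B ⥤ C) (X : D.Diag C) :
    (D.resTrans (Functor.whiskerRight α q)).app X = eqToHom (D.res_comp_obj p q X) ≫
      (D.resTrans α).app ((D.res q).obj X) ≫ eqToHom (D.res_comp_obj p' q X).symm := by
  have := congrArg (fun t => t.toNatTrans.app X)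
    (D.map₂_whisker_left q.toCatHom.op (Bicategory.Opposite.op2 α.toCatHom₂))
  refine this.trans ?_
  rw [← resComp_hom_app, ← resComp_inv_app]
  rfl

theorem res_comp_map (p : A ⥤ B) (q : B ⥤ C) {X Y : D.Diag C} (f : X ⟶ Y) :
    (D.res (p ⋙ q)).map f = eqToHom (D.res_comp_obj p q X) ≫
      (D.res p).map ((D.res q).map f) ≫ eqToHom (D.res_comp_obj p q Y).symm :=
  Functor.congr_hom (D.res_comp p q) f

end Restriction

end Prederivator

theorem eqToHom_conj_comp {C : Type*} [Category* C] {a b : C} (h₁ : a = a)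
    (h₂ : b = b) (h₃ : a = a) (f : a ⟶ b) (g : b ⟶ a) (h : f ≫ g = 𝟙 a) :
    eqToHom h₁ ≫ f ≫ eqToHom h₂ ≫ g ≫ eqToHom h₃ = 𝟙 a := by
  simp [h]

/-! ### Restriction along adjoint functors and constant diagrams -/

namespace Prederivator

section Adjunction

variable (D : Prederivator.{w,v,u}) {A B C : Type w} [SmallCategory A] [SmallCategory B]
  [SmallCategory C]

theorem res_map_resTrans_app (p : A ⥤ B) {q q' : B ⥤ C} (α : q ⟶ q') (X : D.Diag C) :
    (D.res p).map ((D.resTrans α).app X) = eqToHom (D.res_comp_obj p q X).symm ≫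
      (D.resTrans (Functor.whiskerLeft p α)).app X ≫ eqToHom (D.res_comp_obj p q' X) := by
  rw [resTrans_whiskerLeft_app]
  simp

theorem resTrans_app_res_obj {p p' : A ⥤ B} (α : p ⟶ p') (q : B ⥤ C) (X : D.Diag C) :
    (D.resTrans α).app ((D.res q).obj X) = eqToHom (D.res_comp_obj p q X).symm ≫
      (D.resTrans (Functor.whiskerRight α q)).app X ≫ eqToHom (D.res_comp_obj p' q X) := by
  rw [resTrans_whiskerRight_app]
  simp

/-- The unit of `resAdj`. -/
def resAdjUnit {l : A ⥤ B} {r : B ⥤ A} (adj : l ⊣ r) : 𝟭 _ ⟶ D.res r ⋙ D.res l :=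
  eqToHom D.res_id.symm ≫ D.resTrans adj.unit ≫ (D.resComp l r).hom

/-- The counit of `resAdj`. -/
def resAdjCounit {l : A ⥤ B} {r : B ⥤ A} (adj : l ⊣ r) : D.res l ⋙ D.res r ⟶ 𝟭 _ :=
  (D.resComp r l).inv ≫ D.resTrans adj.counit ≫ eqToHom D.res_id

theorem resAdjUnit_app {l : A ⥤ B} {r : B ⥤ A} (adj : l ⊣ r) (X : D.Diag A) :
    (D.resAdjUnit adj).app X = eqToHom (D.res_id_obj X).symm ≫ (D.resTrans adj.unit).app X ≫
      eqToHom (D.res_comp_obj l r X) := by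
  rw [← D.resComp_hom_app]
  exact congrArg (fun t => t ≫ _) (eqToHom_app _ _)

theorem resAdjCounit_app {l : A ⥤ B} {r : B ⥤ A} (adj : l ⊣ r) (X : D.Diag B) :
    (D.resAdjCounit adj).app X = eqToHom (D.res_comp_obj r l X).symm ≫
      (D.resTrans adj.counit).app X ≫ eqToHom (D.res_id_obj X) := by
  rw [← D.resComp_inv_app]
  exact congrArg (fun t => _ ≫ _ ≫ t) (eqToHom_app _ _)

/-- Restriction turns an adjunction `l ⊣ r` into an adjunction `r^* ⊣ l^*`. -/
def resAdj {l : A ⥤ B} {r : B ⥤ A} (adj : l ⊣ r) : D.res r ⊣ D.res l where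
  unit := D.resAdjUnit adj
  counit := D.resAdjCounit adj
  left_triangle_components X := by
    -- The triangle identity of the given adjunction, carried over by 2-functoriality; what remains
    -- afterwards is the cancellation of `eqToHom`s.
    have h : D.resTrans (p := r) (q := r ⋙ l ⋙ r) (Functor.whiskerLeft r adj.unit) ≫
        D.resTrans (p := r ⋙ l ⋙ r) (q := r) (Functor.whiskerRight adj.counit r) = 𝟙 (D.res r) := by
      refine (D.resTrans_comp _ _).symm.trans ((congrArg D.resTrans ?_).trans (D.resTrans_id r))
      ext; simp
    rw [D.resAdjUnit_app, D.resAdjCounit_app, D.resTrans_app_res_obj, Functor.map_comp,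
      Functor.map_comp, D.res_map_resTrans_app, eqToHom_map, eqToHom_map]
    simp only [Category.assoc, eqToHom_trans_assoc, eqToHom_trans]
    exact eqToHom_conj_comp _ _ _ _ _ (congrArg (fun t => t.app X) h)
  right_triangle_components X := by
    have h : D.resTrans (p := l) (q := l ⋙ r ⋙ l) (Functor.whiskerRight adj.unit l) ≫
        D.resTrans (p := l ⋙ r ⋙ l) (q := l) (Functor.whiskerLeft l adj.counit) = 𝟙 (D.res l) := by
      refine (D.resTrans_comp _ _).symm.trans ((congrArg D.resTrans ?_).trans (D.resTrans_id l))
      ext; simp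
    rw [D.resAdjUnit_app, D.resAdjCounit_app, D.resTrans_app_res_obj, Functor.map_comp,
      Functor.map_comp, D.res_map_resTrans_app, eqToHom_map, eqToHom_map]
    simp only [Category.assoc, eqToHom_trans_assoc, eqToHom_trans]
    exact eqToHom_conj_comp _ _ _ _ _ (congrArg (fun t => t.app X) h)

theorem res_res_obj {p : A ⥤ B} {q : B ⥤ C} {r : A ⥤ C} (h : p ⋙ q = r) (X : D.Diag C) :
    (D.res p).obj ((D.res q).obj X) = (D.res r).obj X := by
  rw [← h, res_comp_obj]

theorem res_res_map {p : A ⥤ B} {q : B ⥤ C} {r : A ⥤ C} (h : p ⋙ q = r) {X Y : D.Diag C}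
    (f : X ⟶ Y) : (D.res p).map ((D.res q).map f) = eqToHom (D.res_res_obj h X) ≫
      (D.res r).map f ≫ eqToHom (D.res_res_obj h Y).symm := by
  subst h
  rw [res_comp_map]
  simp

theorem star_obj (r : A ⥤ B) (V : D.Diag One.{w}) :
    (D.res r).obj ((D.res (Functor.star B)).obj V) = (D.res (Functor.star A)).obj V :=
  D.res_res_obj rfl V

theorem star_map (r : A ⥤ B) {V W : D.Diag One.{w}} (g : V ⟶ W) :
    (D.res r).map ((D.res (Functor.star B)).map g) = eqToHom (D.star_obj r V) ≫
      (D.res (Functor.star A)).map g ≫ eqToHom (D.star_obj r W).symm :=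
  D.res_res_map rfl g

theorem resTrans_app_of_eq {p q : A ⥤ B} {s : B ⥤ C} {t : A ⥤ C} (hp : p ⋙ s = t)
    (hq : q ⋙ s = t) (α : p ⟶ q) (hα : Functor.whiskerRight α s = eqToHom (hp.trans hq.symm))
    (V : D.Diag C) : (D.resTrans α).app ((D.res s).obj V) =
      eqToHom ((D.res_res_obj hp V).trans (D.res_res_obj hq V).symm) := by
  rw [D.resTrans_app_res_obj, hα, resTrans_eqToHom_app]
  simp

/-- On a diagram pulled back from the point, only α whiskered with the functor to the point matters,
and the point has no nontrivial morphisms. -/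
theorem resTrans_star_app {p q : A ⥤ B} (α : p ⟶ q) (V : D.Diag One.{w}) :
    (D.resTrans α).app ((D.res (Functor.star B)).obj V) =
      eqToHom ((D.star_obj p V).trans (D.star_obj q V).symm) :=
  D.resTrans_app_of_eq (t := Functor.star A) rfl rfl α (by ext; exact Subsingleton.elim _ _) V

theorem bijective_comp_isIso {C : Type*} [Category* C] (X : C) {Y Z : C} (f : Y ⟶ Z) [IsIso f] :
    Function.Bijective (fun t : X ⟶ Y => t ≫ f) :=
  (Iso.homToEquiv (asIso f)).bijective

theorem bijective_isIso_comp {C : Type*} [Category* C] (Z : C) {X Y : C} (f : X ⟶ Y) [IsIso f] :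
    Function.Bijective (fun t : Y ⟶ Z => f ≫ t) :=
  (Iso.homFromEquiv (asIso f)).symm.bijective

/-- Restriction along a right adjoint is bijective on morphisms to constant diagrams. -/
theorem bijective_res_map_star {l : A ⥤ B} {r : B ⥤ A} (adj : l ⊣ r) (Y : D.Diag A)
    (V : D.Diag One.{w}) : Function.Bijective
      (fun f : Y ⟶ (D.res (Functor.star A)).obj V => (D.res r).map f) := by
  -- Restricting a constant diagram along l gives the constant diagram again, so transposition along
  -- `resAdj` has the right source and target. It agrees with restriction along r because the counit
  -- is an identity on constant diagrams.
  have h : (fun f : Y ⟶ (D.res (Functor.star A)).obj V => (D.res r).map f) =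
      (fun g => g ≫ eqToHom (D.star_obj r V).symm) ∘ ((D.resAdj adj).homEquiv _ _).symm ∘
        fun f => f ≫ eqToHom (D.star_obj l V).symm := by
    funext f
    change (D.res r).map f = ((D.resAdj adj).homEquiv _ _).symm (f ≫ _) ≫ _
    rw [Adjunction.homEquiv_counit]
    change _ = ((D.res r).map (f ≫ _) ≫ (D.resAdjCounit adj).app _) ≫ _
    rw [resAdjCounit_app, D.resTrans_star_app, Functor.map_comp, eqToHom_map]
    simp only [Category.assoc, eqToHom_trans, eqToHom_refl, Category.comp_id]
  rw [h]
  exact (bijective_comp_isIso _ _).comp (((D.resAdj adj).homEquiv _ _).symm.bijective.comp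
    (bijective_comp_isIso _ _))

/-- Colimits may be computed after restriction along a right adjoint. -/
theorem isUniversalArrow_star_iff {l : A ⥤ B} {r : B ⥤ A} (adj : l ⊣ r) {Y : D.Diag A}
    {V : D.Diag One.{w}} (f : Y ⟶ (D.res (Functor.star A)).obj V) :
    IsUniversalArrow (D.res (Functor.star A)) f ↔
      IsUniversalArrow (D.res (Functor.star B)) ((D.res r).map f ≫ eqToHom (D.star_obj r V)) := by
  refine forall_congr' fun W => ?_
  have h : (fun g : V ⟶ W => ((D.res r).map f ≫ eqToHom (D.star_obj r V)) ≫
      (D.res (Functor.star B)).map g) = (fun t => t ≫ eqToHom (D.star_obj r W)) ∘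
        (fun t => (D.res r).map t) ∘ fun g => f ≫ (D.res (Functor.star A)).map g := by
    funext g
    change _ = (D.res r).map (f ≫ (D.res (Functor.star A)).map g) ≫ _
    rw [Functor.map_comp, star_map]
    simp
  rw [h]
  exact (((bijective_comp_isIso _ (eqToHom (D.star_obj r W))).comp
    (D.bijective_res_map_star adj Y W)).of_comp_iff' _).symm

/-- Restriction along a left adjoint is bijective on morphisms from constant diagrams. -/
theorem bijective_res_map_star' {l : A ⥤ B} {r : B ⥤ A} (adj : l ⊣ r) (Y : D.Diag B)
    (V : D.Diag One.{w}) : Function.Bijective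
      (fun f : (D.res (Functor.star B)).obj V ⟶ Y => (D.res l).map f) := by
  have h : (fun f : (D.res (Functor.star B)).obj V ⟶ Y => (D.res l).map f) =
      (fun g => eqToHom (D.star_obj l V) ≫ g) ∘ ((D.resAdj adj).homEquiv _ _) ∘
        fun f => eqToHom (D.star_obj r V) ≫ f := by
    funext f
    change (D.res l).map f = _ ≫ (D.resAdj adj).homEquiv _ _ (_ ≫ f)
    rw [Adjunction.homEquiv_unit]
    change _ = _ ≫ (D.resAdjUnit adj).app _ ≫ (D.res l).map (_ ≫ f)
    rw [resAdjUnit_app, D.resTrans_star_app, Functor.map_comp, eqToHom_map]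
    simp only [eqToHom_trans_assoc, eqToHom_refl, Category.id_comp, Category.assoc]
  rw [h]
  exact (bijective_isIso_comp _ _).comp (((D.resAdj adj).homEquiv _ _).bijective.comp
    (bijective_isIso_comp _ _))

/-- Limits may be computed after restriction along a left adjoint. -/
theorem isCouniversalArrow_star_iff {l : A ⥤ B} {r : B ⥤ A} (adj : l ⊣ r) {Y : D.Diag B}
    {V : D.Diag One.{w}} (f : (D.res (Functor.star B)).obj V ⟶ Y) :
    IsCouniversalArrow (D.res (Functor.star B)) f ↔ IsCouniversalArrow (D.res (Functor.star A))
      (eqToHom (D.star_obj l V).symm ≫ (D.res l).map f) := by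
  refine forall_congr' fun W => ?_
  have h : (fun g : W ⟶ V => (D.res (Functor.star A)).map g ≫ eqToHom (D.star_obj l V).symm ≫
      (D.res l).map f) = (fun t => eqToHom (D.star_obj l W).symm ≫ t) ∘
        (fun t => (D.res l).map t) ∘ fun g => (D.res (Functor.star B)).map g ≫ f := by
    funext g
    change _ = _ ≫ (D.res l).map ((D.res (Functor.star B)).map g ≫ f)
    rw [Functor.map_comp, star_map]
    simp
  rw [h]
  exact (((bijective_isIso_comp _ (eqToHom (D.star_obj l W).symm)).comp
    (D.bijective_res_map_star' adj Y W)).of_comp_iff' _).symm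

end Adjunction

end Prederivator

theorem isUniversalArrow_comp_map_iso {C E : Type*} [Category* C] [Category* E] (G : E ⥤ C) {X : C}
    {Z Z' : E} (f : X ⟶ G.obj Z) (e : Z ⟶ Z') [IsIso e] :
    IsUniversalArrow G (f ≫ G.map e) ↔ IsUniversalArrow G f := by
  refine forall_congr' fun W => ?_
  have : (fun g : Z' ⟶ W => (f ≫ G.map e) ≫ G.map g) =
      (fun g => f ≫ G.map g) ∘ fun g => e ≫ g := by
    funext g; simp
  rw [this]
  exact Function.Bijective.of_comp_iff _ (Prederivator.bijective_isIso_comp W e)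

theorem isCouniversalArrow_map_iso_comp {C E : Type*} [Category* C] [Category* E] (G : E ⥤ C) {X : C}
    {Z Z' : E} (f : G.obj Z ⟶ X) (e : Z' ⟶ Z) [IsIso e] :
    IsCouniversalArrow G (G.map e ≫ f) ↔ IsCouniversalArrow G f := by
  refine forall_congr' fun W => ?_
  have : (fun g : W ⟶ Z' => G.map g ≫ G.map e ≫ f) =
      (fun g => G.map g ≫ f) ∘ fun g => g ≫ e := by
    funext g; simp
  rw [this]
  exact Function.Bijective.of_comp_iff _ (Prederivator.bijective_comp_isIso W e)

/-! ### Colimits and limits inside a coherent diagram -/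

namespace Prederivator

section Cocones

variable (D : Prederivator.{w,v,u}) {J K A B C : Type w} [SmallCategory J] [SmallCategory K]
  [SmallCategory A] [SmallCategory B] [SmallCategory C]

theorem ev_res_obj (g : B ⥤ C) (b : B) (X : D.Diag C) :
    (D.ev b).obj ((D.res g).obj X) = (D.ev (g.obj b)).obj X :=
  D.res_res_obj (p := Functor.fromPUnit b) (q := g) (r := Functor.fromPUnit (g.obj b))
    (CategoryTheory.Functor.ext (fun _ => rfl) (fun _ _ _ => by simp)) X

/-- The morphism from a coherent diagram to a constant one determined by a cocone in the shape. -/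
def coconeArrow {q : J ⥤ B} (c : Limits.Cocone q) (X : D.Diag B) :
    (D.res q).obj X ⟶ (D.res (Functor.star J)).obj ((D.ev c.pt).obj X) :=
  (D.resTrans (q := Functor.star J ⋙ Functor.fromPUnit c.pt) c.ι).app X ≫
    eqToHom (D.res_comp_obj (Functor.star J) (Functor.fromPUnit c.pt) X)

/-- The morphism from a constant coherent diagram determined by a cone in the shape. -/
def coneArrow {q : J ⥤ B} (c : Limits.Cone q) (X : D.Diag B) :
    (D.res (Functor.star J)).obj ((D.ev c.pt).obj X) ⟶ (D.res q).obj X :=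
  eqToHom (D.res_comp_obj (Functor.star J) (Functor.fromPUnit c.pt) X).symm ≫
    (D.resTrans (p := Functor.star J ⋙ Functor.fromPUnit c.pt) c.π).app X

/-- The value of `X` at the point of the cocone `c` is the colimit of the restriction of `X`. -/
def IsColimAt {q : J ⥤ B} (c : Limits.Cocone q) (X : D.Diag B) : Prop :=
  IsUniversalArrow (D.res (Functor.star J)) (D.coconeArrow c X)

/-- The value of `X` at the point of the cone `c` is the limit of the restriction of `X`. -/
def IsLimAt {q : J ⥤ B} (c : Limits.Cone q) (X : D.Diag B) : Prop :=
  IsCouniversalArrow (D.res (Functor.star J)) (D.coneArrow c X)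

theorem coconeArrow_whisker {q : J ⥤ B} (c : Limits.Cocone q) (r : K ⥤ J) (X : D.Diag B) :
    (D.res r).map (D.coconeArrow c X) ≫ eqToHom (D.star_obj r _) =
      eqToHom (D.res_comp_obj r q X).symm ≫ D.coconeArrow (c.whisker r) X := by
  unfold coconeArrow
  rw [Functor.map_comp, D.res_map_resTrans_app, eqToHom_map]
  simp only [Category.assoc, eqToHom_trans]
  rfl

theorem coneArrow_whisker {q : J ⥤ B} (c : Limits.Cone q) (r : K ⥤ J) (X : D.Diag B) :
    eqToHom (D.star_obj r _).symm ≫ (D.res r).map (D.coneArrow c X) =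
      D.coneArrow (c.whisker r) X ≫ eqToHom (D.res_comp_obj r q X) := by
  unfold coneArrow
  rw [Functor.map_comp, D.res_map_resTrans_app, eqToHom_map]
  simp only [Category.assoc, eqToHom_trans_assoc]
  rfl

theorem coconeArrow_res {q : J ⥤ B} (c : Limits.Cocone q) (g : B ⥤ C) (X : D.Diag C) :
    D.coconeArrow c ((D.res g).obj X) = eqToHom (D.res_comp_obj q g X).symm ≫
      D.coconeArrow (g.mapCocone c) X ≫
        (D.res (Functor.star J)).map (eqToHom (D.ev_res_obj g c.pt X).symm) := by
  -- The two constant functors differ on morphisms by g applied to an identity, so they are equal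
  -- but not definitionally.
  have h : (Functor.star J : J ⥤ One.{w}) ⋙ Functor.fromPUnit (g.mapCocone c).pt =
      (Functor.star J ⋙ Functor.fromPUnit c.pt) ⋙ g :=
    CategoryTheory.Functor.ext (fun _ => rfl) (fun _ _ _ => by simp)
  have h' : Functor.whiskerRight (H := Functor.star J ⋙ Functor.fromPUnit c.pt) c.ι g =
      (show q ⋙ g ⟶ (Functor.star J : J ⥤ One.{w}) ⋙ Functor.fromPUnit (g.mapCocone c).pt from
        (g.mapCocone c).ι) ≫ eqToHom h := by
    ext j
    simp [eqToHom_app]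
  unfold coconeArrow
  rw [D.resTrans_app_res_obj, h', D.resTrans_comp, NatTrans.comp_app, D.resTrans_eqToHom_app,
    eqToHom_map]
  simp only [Category.assoc, eqToHom_trans]

theorem coneArrow_res {q : J ⥤ B} (c : Limits.Cone q) (g : B ⥤ C) (X : D.Diag C) :
    D.coneArrow c ((D.res g).obj X) =
      (D.res (Functor.star J)).map (eqToHom (D.ev_res_obj g c.pt X)) ≫
        D.coneArrow (g.mapCone c) X ≫ eqToHom (D.res_comp_obj q g X) := by
  have h : (Functor.star J : J ⥤ One.{w}) ⋙ Functor.fromPUnit (g.mapCone c).pt =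
      (Functor.star J ⋙ Functor.fromPUnit c.pt) ⋙ g :=
    CategoryTheory.Functor.ext (fun _ => rfl) (fun _ _ _ => by simp)
  have h' : Functor.whiskerRight (G := Functor.star J ⋙ Functor.fromPUnit c.pt) c.π g =
      eqToHom h.symm ≫ (show (Functor.star J : J ⥤ One.{w}) ⋙ Functor.fromPUnit (g.mapCone c).pt ⟶ q ⋙ g from
        (g.mapCone c).π) := by
    ext j
    simp [eqToHom_app]
  unfold coneArrow
  rw [D.resTrans_app_res_obj, h', D.resTrans_comp, NatTrans.comp_app, D.resTrans_eqToHom_app,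
    eqToHom_map]
  simp only [Category.assoc, eqToHom_trans_assoc]

/-- Right adjoints are final, in the homotopical sense needed here. All later changes of indexing
shape for colimits use this form of finality. -/
theorem isColimAt_whisker_iff {q : J ⥤ B} (c : Limits.Cocone q) {l : J ⥤ K} {r : K ⥤ J} (adj : l ⊣ r)
    (X : D.Diag B) : D.IsColimAt (c.whisker r) X ↔ D.IsColimAt c X := by
  unfold IsColimAt
  rw [D.isUniversalArrow_star_iff adj, D.coconeArrow_whisker, isUniversalArrow_iso_comp]

theorem isLimAt_whisker_iff {q : J ⥤ B} (c : Limits.Cone q) {l : K ⥤ J} {r : J ⥤ K} (adj : l ⊣ r)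
    (X : D.Diag B) : D.IsLimAt (c.whisker l) X ↔ D.IsLimAt c X := by
  unfold IsLimAt
  rw [D.isCouniversalArrow_star_iff adj, D.coneArrow_whisker, isCouniversalArrow_comp_iso]

/-- Colimit conditions on a restricted diagram become conditions on the ambient diagram, so that all
of them can be compared in one place. -/
theorem isColimAt_res_iff {q : J ⥤ B} (c : Limits.Cocone q) (g : B ⥤ C) (X : D.Diag C) :
    D.IsColimAt c ((D.res g).obj X) ↔ D.IsColimAt (g.mapCocone c) X := by
  unfold IsColimAt
  rw [D.coconeArrow_res, isUniversalArrow_iso_comp, isUniversalArrow_comp_map_iso]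

theorem isLimAt_res_iff {q : J ⥤ B} (c : Limits.Cone q) (g : B ⥤ C) (X : D.Diag C) :
    D.IsLimAt c ((D.res g).obj X) ↔ D.IsLimAt (g.mapCone c) X := by
  unfold IsLimAt
  rw [D.coneArrow_res, isCouniversalArrow_map_iso_comp, isCouniversalArrow_comp_iso]

/-- The canonical cocone on a slice. -/
def sliceCocone (p : A ⥤ B) (b : B) : Limits.Cocone (CostructuredArrow.proj p b ⋙ p) where
  pt := b
  ι :=
    { app := fun X => X.hom
      naturality := fun _ _ f => (CostructuredArrow.w f).trans (Category.comp_id _).symm }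

/-- The canonical cone on a coslice. -/
def sliceCone (p : A ⥤ B) (b : B) : Limits.Cone (StructuredArrow.proj b p ⋙ p) where
  pt := b
  π :=
    { app := fun X => X.hom
      naturality := fun _ _ f => (Category.id_comp _).trans (StructuredArrow.w f).symm }

theorem sliceTransLeft_app (p : A ⥤ B) (b : B) (X : D.Diag B) : (D.sliceTransLeft p b).app X =
    eqToHom (D.res_comp_obj _ _ X).symm ≫ D.coconeArrow (sliceCocone p b) X := by
  unfold sliceTransLeft
  rw [NatTrans.comp_app, NatTrans.comp_app, D.resComp_inv_app, D.resComp_hom_app]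
  rfl

theorem sliceTransRight_app (p : A ⥤ B) (b : B) (X : D.Diag B) : (D.sliceTransRight p b).app X =
    D.coneArrow (sliceCone p b) X ≫ eqToHom (D.res_comp_obj _ _ X) := by
  unfold sliceTransRight
  rw [NatTrans.comp_app, NatTrans.comp_app, D.resComp_inv_app, D.resComp_hom_app]
  exact (Category.assoc _ _ _).symm

theorem isUniversalArrow_sliceTransLeft (p : A ⥤ B) (b : B) (X : D.Diag B) :
    IsUniversalArrow (Z := (D.ev b).obj X) (D.res (Functor.star (CostructuredArrow p b)))
      ((D.sliceTransLeft p b).app X) ↔ D.IsColimAt (sliceCocone p b) X :=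
  (iff_of_eq (congrArg (fun t => IsUniversalArrow (Z := (D.ev b).obj X)
    (D.res (Functor.star (CostructuredArrow p b))) t) (D.sliceTransLeft_app p b X))).trans
    (isUniversalArrow_iso_comp (D.res (Functor.star (CostructuredArrow p b))) (eqToHom _)
      (D.coconeArrow (sliceCocone p b) X))

theorem isCouniversalArrow_sliceTransRight (p : A ⥤ B) (b : B) (X : D.Diag B) :
    IsCouniversalArrow (Z := (D.ev b).obj X) (D.res (Functor.star (StructuredArrow b p)))
      ((D.sliceTransRight p b).app X) ↔ D.IsLimAt (sliceCone p b) X :=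
  (iff_of_eq (congrArg (fun t => IsCouniversalArrow (Z := (D.ev b).obj X)
    (D.res (Functor.star (StructuredArrow b p))) t) (D.sliceTransRight_app p b X))).trans
    (isCouniversalArrow_comp_iso (D.res (Functor.star (StructuredArrow b p))) (eqToHom _)
      (D.coneArrow (sliceCone p b) X))

end Cocones

/-! ### Kan extensions are pointwise -/

section Pointwise

variable {D : Prederivator.{w,v,u}} {A B C : Type w} [SmallCategory A] [SmallCategory B]
  [SmallCategory C]

/-- `X` is a left Kan extension along `p` if and only if it is so pointwise. -/
theorem IsDerivator.fullyFaithfulFrom_iff (hD : D.IsDerivator) (p : A ⥤ B) (X : D.Diag B) :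
    FullyFaithfulFrom (D.res p) X ↔ ∀ b, D.IsColimAt (sliceCocone p b) X := by
  have := hD.der3_left p
  let adj := Adjunction.ofIsRightAdjoint (D.res p)
  rw [fullyFaithfulFrom_iff_isIso_counit adj]
  have h2 : IsIso (adj.counit.app X) ↔ ∀ b, IsIso ((D.ev b).map (adj.counit.app X)) :=
    ⟨fun _ _ => inferInstance, fun h => hD.der2 _ h⟩
  rw [h2]
  refine forall_congr' fun b => ?_
  have := hD.der3_left (Functor.star (CostructuredArrow p b))
  let adj' := Adjunction.ofIsRightAdjoint (D.res (Functor.star (CostructuredArrow p b)))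
  have h4 := hD.der4_left p b _ adj _ adj'
  -- The transpose of the slice arrow factors as the mate at the restriction of X, followed by the
  -- counit evaluated at b. The mate is invertible by (Der4), so the two conditions agree.
  have h5 := (adj'.homEquiv_counit (g := (D.sliceTransLeft p b).app X)).trans
    (mateEquiv_counit_symm adj adj' (TwoSquare.mk _ _ _ _ (D.sliceTransLeft p b)) X)
  rw [← isUniversalArrow_sliceTransLeft, isUniversalArrow_iff_isIso adj']
  refine Iff.trans ?_ (iff_of_eq (congrArg (fun t => IsIso t) h5.symm))
  exact (isIso_comp_left_iff (((CategoryTheory.mateEquiv adj adj').symm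
      (TwoSquare.mk _ _ _ _ (D.sliceTransLeft p b))).natTrans.app ((D.res p).obj X)) _).symm

/-- `X` is a right Kan extension along `p` if and only if it is so pointwise. -/
theorem IsDerivator.fullyFaithfulTo_iff (hD : D.IsDerivator) (p : A ⥤ B) (X : D.Diag B) :
    FullyFaithfulTo (D.res p) X ↔ ∀ b, D.IsLimAt (sliceCone p b) X := by
  have := hD.der3_right p
  let adj := Adjunction.ofIsLeftAdjoint (D.res p)
  rw [fullyFaithfulTo_iff_isIso_unit adj]
  have h2 : IsIso (adj.unit.app X) ↔ ∀ b, IsIso ((D.ev b).map (adj.unit.app X)) :=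
    ⟨fun _ _ => inferInstance, fun h => hD.der2 _ h⟩
  rw [h2]
  refine forall_congr' fun b => ?_
  have := hD.der3_right (Functor.star (StructuredArrow b p))
  let adj' := Adjunction.ofIsLeftAdjoint (D.res (Functor.star (StructuredArrow b p)))
  have h4 := hD.der4_right p b _ adj _ adj'
  have h5 := (adj'.homEquiv_unit (f := (D.sliceTransRight p b).app X)).trans
    (unit_mateEquiv adj adj' (TwoSquare.mk _ _ _ _ (D.sliceTransRight p b)) X).symm
  rw [← isCouniversalArrow_sliceTransRight, isCouniversalArrow_iff_isIso adj']
  refine Iff.trans ?_ (iff_of_eq (congrArg (fun t => IsIso t) h5.symm))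
  exact (isIso_comp_right_iff _ ((CategoryTheory.mateEquiv adj adj'
      (TwoSquare.mk _ _ _ _ (D.sliceTransRight p b))).natTrans.app ((D.res p).obj X))).symm

theorem isUniversalArrow_unit {C E : Type*} [Category* C] [Category* E] {G : E ⥤ C} {L : C ⥤ E}
    (adj : L ⊣ G) (X : C) : IsUniversalArrow G (adj.unit.app X) := by
  intro W
  have : (fun g : L.obj X ⟶ W => adj.unit.app X ≫ G.map g) = adj.homEquiv X W := by
    funext g
    exact (adj.homEquiv_unit _ _ _).symm
  rw [this]
  exact (adj.homEquiv X W).bijective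

theorem isCouniversalArrow_counit {C E : Type*} [Category* C] [Category* E] {G : E ⥤ C} {R : C ⥤ E}
    (adj : G ⊣ R) (X : C) : IsCouniversalArrow G (adj.counit.app X) := by
  intro W
  have : (fun g : W ⟶ R.obj X => G.map g ≫ adj.counit.app X) = (adj.homEquiv W X).symm := by
    funext g
    exact (adj.homEquiv_counit _ _ _).symm
  rw [this]
  exact (adj.homEquiv W X).symm.bijective

/-- The value of a left Kan extension at `b` is the colimit over the slice. -/
theorem IsDerivator.isUniversalArrow_unit_comp (hD : D.IsDerivator) (p : A ⥤ B)
    {L : D.Diag A ⥤ D.Diag B} (adj : L ⊣ D.res p) (Y : D.Diag A) (b : B) :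
    IsUniversalArrow (D.res (Functor.star (CostructuredArrow p b)))
      ((D.res (CostructuredArrow.proj p b)).map (adj.unit.app Y) ≫
        (D.sliceTransLeft p b).app (L.obj Y)) := by
  have := hD.der3_left (Functor.star (CostructuredArrow p b))
  let adj' := Adjunction.ofIsRightAdjoint (D.res (Functor.star (CostructuredArrow p b)))
  have h4 := hD.der4_left p b _ adj _ adj'
  have h5 := unit_mateEquiv_symm adj adj' (TwoSquare.mk _ _ _ _ (D.sliceTransLeft p b)) Y
  -- The arrow in question is the unit of the colimit adjunction followed by the image of the mate;
  -- the former is universal and the latter is invertible by (Der4).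
  refine (iff_of_eq (congrArg (fun t => IsUniversalArrow (Z := (D.ev b).obj (L.obj Y))
    (D.res (Functor.star (CostructuredArrow p b))) t) h5)).2 ?_
  exact (isUniversalArrow_comp_map_iso (D.res (Functor.star (CostructuredArrow p b)))
    (adj'.unit.app ((D.res (CostructuredArrow.proj p b)).obj Y)) (((CategoryTheory.mateEquiv adj adj').symm
      (TwoSquare.mk _ _ _ _ (D.sliceTransLeft p b))).natTrans.app Y)).2 (isUniversalArrow_unit adj' _)

/-- The value of a right Kan extension at `b` is the limit over the slice. -/
theorem IsDerivator.isCouniversalArrow_counit_comp (hD : D.IsDerivator) (p : A ⥤ B)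
    {R : D.Diag A ⥤ D.Diag B} (adj : D.res p ⊣ R) (Y : D.Diag A) (b : B) :
    IsCouniversalArrow (Z := (D.ev b).obj (R.obj Y)) (D.res (Functor.star (StructuredArrow b p)))
      ((D.sliceTransRight p b).app (R.obj Y) ≫
        (D.res (StructuredArrow.proj b p)).map (adj.counit.app Y)) := by
  have := hD.der3_right (Functor.star (StructuredArrow b p))
  let adj' := Adjunction.ofIsLeftAdjoint (D.res (Functor.star (StructuredArrow b p)))
  have h4 := hD.der4_right p b _ adj _ adj'
  have h5 := mateEquiv_counit adj adj' (TwoSquare.mk _ _ _ _ (D.sliceTransRight p b)) Y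
  refine (iff_of_eq (congrArg (fun t => IsCouniversalArrow (Z := (D.ev b).obj (R.obj Y))
    (D.res (Functor.star (StructuredArrow b p))) t) h5.symm)).2 ?_
  exact (isCouniversalArrow_map_iso_comp (D.res (Functor.star (StructuredArrow b p)))
    (adj'.counit.app ((D.res (StructuredArrow.proj b p)).obj Y)) ((CategoryTheory.mateEquiv adj adj'
      (TwoSquare.mk _ _ _ _ (D.sliceTransRight p b))).natTrans.app Y)).2
        (isCouniversalArrow_counit adj' _)

end Pointwise

end Prederivator

/-! ### Trivial colimits and Kan extensions along fully faithful functors -/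

/-- Up to replacing X by an object in the image, f is the image of some k, and full faithfulness of
G turns universality of f into the Yoneda criterion for k. -/
theorem isIso_of_isUniversalArrow {C E : Type*} [Category* C] [Category* E] (G : E ⥤ C)
    [G.IsEquivalence] {X : C} {Z : E} (f : X ⟶ G.obj Z) (hf : IsUniversalArrow G f) : IsIso f := by
  obtain ⟨k, hk⟩ := G.map_surjective ((G.objObjPreimageIso X).hom ≫ f)
  have h : IsIso k := by
    rw [isIso_iff_coyoneda_map_bijective]
    intro W
    have h1 := (isUniversalArrow_iso_comp G (G.objObjPreimageIso X).hom f).2 hf W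
    rw [← hk] at h1
    have h2 : (fun g : Z ⟶ W => G.map k ≫ G.map g) = (fun t => G.map t) ∘ fun g => k ≫ g := by
      funext g; simp
    rw [h2] at h1
    exact (Function.Bijective.of_comp_iff' (Functor.FullyFaithful.map_bijective
      (Functor.FullyFaithful.ofFullyFaithful G) _ _) _).1 h1
  have : f = (G.objObjPreimageIso X).inv ≫ G.map k := by simp [hk]
  rw [this]
  infer_instance

theorem isIso_of_isCouniversalArrow {C E : Type*} [Category* C] [Category* E] (G : E ⥤ C)
    [G.IsEquivalence] {X : C} {Z : E} (f : G.obj Z ⟶ X) (hf : IsCouniversalArrow G f) : IsIso f := by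
  obtain ⟨k, hk⟩ := G.map_surjective (f ≫ (G.objObjPreimageIso X).inv)
  have h : IsIso k := by
    rw [isIso_iff_yoneda_map_bijective]
    intro W
    have h1 := (isCouniversalArrow_comp_iso G (G.objObjPreimageIso X).inv f).2 hf W
    rw [← hk] at h1
    have h2 : (fun g : W ⟶ Z => G.map g ≫ G.map k) = (fun t => G.map t) ∘ fun g => g ≫ k := by
      funext g; simp
    rw [h2] at h1
    exact (Function.Bijective.of_comp_iff' (Functor.FullyFaithful.map_bijective
      (Functor.FullyFaithful.ofFullyFaithful G) _ _) _).1 h1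
  have : f = G.map k ≫ (G.objObjPreimageIso X).hom := by simp [hk]
  rw [this]
  infer_instance

theorem fullyFaithfulFrom_of_fullyFaithful {C E : Type*} [Category* C] [Category* E] (F : C ⥤ E)
    [F.Full] [F.Faithful] (X : C) : FullyFaithfulFrom F X := fun _ =>
  (Functor.FullyFaithful.ofFullyFaithful F).map_bijective _ _

theorem fullyFaithfulTo_of_fullyFaithful {C E : Type*} [Category* C] [Category* E] (F : C ⥤ E)
    [F.Full] [F.Faithful] (X : C) : FullyFaithfulTo F X := fun _ =>
  (Functor.FullyFaithful.ofFullyFaithful F).map_bijective _ _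

theorem isIso_of_forall_app {C E : Type*} [Category* C] [Category* E] {F G : C ⥤ E} (α : F ⟶ G)
    (h : ∀ X, IsIso (α.app X)) : IsIso α :=
  NatIso.isIso_of_isIso_app α

theorem isIso_map_comp {C E : Type*} [Category* C] [Category* E] (F : C ⥤ E) {X Y Z : C} (f : X ⟶ Y)
    (g : Y ⟶ Z) [IsIso f] [IsIso (F.map g)] : IsIso (F.map (f ≫ g)) := by
  rw [F.map_comp]
  infer_instance

theorem isIso_map_comp' {C E : Type*} [Category* C] [Category* E] (F : C ⥤ E) {X Y Z : C} (f : X ⟶ Y)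
    (g : Y ⟶ Z) [IsIso (F.map f)] [IsIso g] : IsIso (F.map (f ≫ g)) := by
  rw [F.map_comp]
  infer_instance

namespace Prederivator

section

variable {D : Prederivator.{w,v,u}} {J A B C : Type w} [SmallCategory J] [SmallCategory A]
  [SmallCategory B] [SmallCategory C]

instance isIso_resTrans {p q : A ⥤ B} (α : p ⟶ q) [IsIso α] : IsIso (D.resTrans α) :=
  ⟨D.resTrans (inv α), by rw [← D.resTrans_comp, IsIso.hom_inv_id, D.resTrans_id],
    by rw [← D.resTrans_comp, IsIso.inv_hom_id, D.resTrans_id]⟩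

instance isEquivalence_res (p : A ⥤ B) [p.IsEquivalence] : (D.res p).IsEquivalence := by
  let adj := D.resAdj p.asEquivalence.toAdjunction
  have h1 : ∀ X, IsIso (adj.unit.app X) := fun X => by
    change IsIso ((D.resAdjUnit _).app X)
    have : IsIso p.asEquivalence.toAdjunction.unit :=
      inferInstanceAs (IsIso p.asEquivalence.unitIso.hom)
    rw [resAdjUnit_app]
    infer_instance
  have h2 : ∀ X, IsIso (adj.counit.app X) := fun X => by
    change IsIso ((D.resAdjCounit _).app X)
    have : IsIso p.asEquivalence.toAdjunction.counit :=
      inferInstanceAs (IsIso p.asEquivalence.counitIso.hom)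
    rw [resAdjCounit_app]
    infer_instance
  exact adj.toEquivalence.isEquivalence_inverse

instance isEquivalence_star_one : (Functor.star One.{w} : One.{w} ⥤ One.{w}).IsEquivalence := by
  have h : (Functor.star One.{w} : One.{w} ⥤ One.{w}) = 𝟭 _ :=
    CategoryTheory.Functor.ext (fun _ => rfl) (fun _ _ _ => Subsingleton.elim _ _)
  rw [h]
  infer_instance

/-- The functor picking a terminal object is right adjoint to the functor to the point. -/
def starAdj (t : J) (ht : Limits.IsTerminal t) :
    (Functor.star J : J ⥤ One.{w}) ⊣ Functor.fromPUnit t :=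
  Adjunction.mkOfHomEquiv
    { homEquiv X _ :=
        { toFun _ := ht.from X
          invFun _ := eqToHom (by ext)
          left_inv _ := Subsingleton.elim _ _
          right_inv _ := ht.hom_ext _ _ }
      homEquiv_naturality_left_symm _ _ := Subsingleton.elim _ _
      homEquiv_naturality_right _ _ := ht.hom_ext _ _ }

/-- The functor picking an initial object is left adjoint to the functor to the point. -/
def adjStar (t : J) (ht : Limits.IsInitial t) :
    Functor.fromPUnit t ⊣ (Functor.star J : J ⥤ One.{w}) :=
  Adjunction.mkOfHomEquiv
    { homEquiv _ Y :=
        { toFun _ := eqToHom (by ext)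
          invFun _ := ht.to Y
          left_inv _ := ht.hom_ext _ _
          right_inv _ := Subsingleton.elim _ _ }
      homEquiv_naturality_left_symm _ _ := ht.hom_ext _ _
      homEquiv_naturality_right _ _ := Subsingleton.elim _ _ }

theorem isIso_coconeArrow {q : J ⥤ B} (c : Limits.Cocone q) [IsIso c.ι] (X : D.Diag B) :
    IsIso (D.coconeArrow c X) := by
  have h := isIso_resTrans (D := D) (q := Functor.star J ⋙ Functor.fromPUnit c.pt) c.ι
  unfold coconeArrow
  infer_instance

theorem isIso_coneArrow {q : J ⥤ B} (c : Limits.Cone q) [IsIso c.π] (X : D.Diag B) :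
    IsIso (D.coneArrow c X) := by
  have h := isIso_resTrans (D := D) (p := Functor.star J ⋙ Functor.fromPUnit c.pt) c.π
  unfold coneArrow
  infer_instance

/-- The inclusion of a terminal object is a right adjoint, hence final. This reduces to a cocone
over the point with an invertible leg. -/
theorem isColimAt_of_isTerminal {q : J ⥤ B} (c : Limits.Cocone q) (t : J) (ht : Limits.IsTerminal t)
    [IsIso (c.ι.app t)] (X : D.Diag B) : D.IsColimAt c X := by
  rw [← D.isColimAt_whisker_iff c (starAdj t ht)]
  have : IsIso (c.whisker (Functor.fromPUnit.{w} t)).ι :=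
    isIso_of_forall_app _ fun _ => inferInstanceAs (IsIso (c.ι.app t))
  have := isIso_coconeArrow (D := D) (c.whisker (Functor.fromPUnit.{w} t)) X
  exact (isUniversalArrow_iff_of_isIso _ _).2 (fullyFaithfulFrom_of_fullyFaithful _ _)

theorem isLimAt_of_isInitial {q : J ⥤ B} (c : Limits.Cone q) (t : J) (ht : Limits.IsInitial t)
    [IsIso (c.π.app t)] (X : D.Diag B) : D.IsLimAt c X := by
  rw [← D.isLimAt_whisker_iff c (adjStar t ht)]
  have : IsIso (c.whisker (Functor.fromPUnit.{w} t)).π :=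
    isIso_of_forall_app _ fun _ => inferInstanceAs (IsIso (c.π.app t))
  have := isIso_coneArrow (D := D) (c.whisker (Functor.fromPUnit.{w} t)) X
  exact (isCouniversalArrow_iff_of_isIso _ _).2 (fullyFaithfulTo_of_fullyFaithful _ _)

theorem isIso_map_coconeArrow {q : J ⥤ B} (c : Limits.Cocone q) (t : J) [IsIso (c.ι.app t)]
    (X : D.Diag B) : IsIso ((D.res (Functor.fromPUnit.{w} t)).map (D.coconeArrow c X)) := by
  have : IsIso (c.whisker (Functor.fromPUnit.{w} t)).ι :=
    isIso_of_forall_app _ fun _ => inferInstanceAs (IsIso (c.ι.app t))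
  have h2 := isIso_coconeArrow (D := D) (c.whisker (Functor.fromPUnit.{w} t)) X
  have h3 := D.coconeArrow_whisker c (Functor.fromPUnit.{w} t) X
  rw [← isIso_comp_right_iff _ (eqToHom (D.star_obj (Functor.fromPUnit.{w} t) _)), h3]
  infer_instance

theorem isIso_map_coneArrow {q : J ⥤ B} (c : Limits.Cone q) (t : J) [IsIso (c.π.app t)]
    (X : D.Diag B) : IsIso ((D.res (Functor.fromPUnit.{w} t)).map (D.coneArrow c X)) := by
  have : IsIso (c.whisker (Functor.fromPUnit.{w} t)).π :=
    isIso_of_forall_app _ fun _ => inferInstanceAs (IsIso (c.π.app t))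
  have h2 := isIso_coneArrow (D := D) (c.whisker (Functor.fromPUnit.{w} t)) X
  have h3 := D.coneArrow_whisker c (Functor.fromPUnit.{w} t) X
  rw [← isIso_comp_left_iff (eqToHom (D.star_obj (Functor.fromPUnit.{w} t) _).symm), h3]
  infer_instance

theorem isIso_res_res_map_iff {p : A ⥤ B} {q : B ⥤ C} {r : A ⥤ C} (h : p ⋙ q = r) {X Y : D.Diag C}
    (f : X ⟶ Y) : IsIso ((D.res p).map ((D.res q).map f)) ↔ IsIso ((D.res r).map f) := by
  rw [D.res_res_map h, isIso_comp_left_iff, isIso_comp_right_iff]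

/-- The unit of a left Kan extension along a fully faithful functor is invertible. -/
theorem IsDerivator.isIso_unit (hD : D.IsDerivator) (p : A ⥤ B) [p.Full] [p.Faithful]
    {L : D.Diag A ⥤ D.Diag B} (adj : L ⊣ D.res p) (Y : D.Diag A) : IsIso (adj.unit.app Y) := by
  refine hD.der2 _ fun a => ?_
  -- Full faithfulness of p makes the identity terminal in the slice over p a. The colimit formula
  -- for the value of the extension at p a thus collapses to the value at a, and the comparison is
  -- the unit up to invertible factors.
  let t := CostructuredArrow.mk (𝟙 (p.obj a))
  have ht : Limits.IsTerminal t := CostructuredArrow.mkIdTerminal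
  have h := hD.isUniversalArrow_unit_comp p adj Y (p.obj a)
  rw [D.isUniversalArrow_star_iff (starAdj t ht)] at h
  have h := isIso_of_isUniversalArrow _ _ h
  have h1 : IsIso ((sliceCocone p (p.obj a)).ι.app t) := inferInstanceAs (IsIso (𝟙 (p.obj a)))
  have h2 := isIso_map_coconeArrow (D := D) (sliceCocone p (p.obj a)) t (L.obj Y)
  have h3 : IsIso ((D.res (Functor.fromPUnit.{w} t)).map
      ((D.sliceTransLeft p (p.obj a)).app (L.obj Y))) := by
    have h4 := isIso_map_comp (D.res (Functor.fromPUnit.{w} t))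
      (eqToHom (D.res_comp_obj (CostructuredArrow.proj p (p.obj a)) p (L.obj Y)).symm)
      (D.coconeArrow (sliceCocone p (p.obj a)) (L.obj Y))
    exact Eq.mpr (congrArg (fun f => IsIso ((D.res (Functor.fromPUnit.{w} t)).map f))
      (D.sliceTransLeft_app p (p.obj a) (L.obj Y))) h4
  rw [isIso_comp_right_iff, Functor.map_comp, isIso_comp_right_iff] at h
  refine (isIso_res_res_map_iff (CategoryTheory.Functor.ext (fun _ => rfl) (fun _ _ _ => ?_)) _).1 h
  simp
  exact (Category.id_comp _).symm

/-- The counit of a right Kan extension along a fully faithful functor is invertible. -/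
theorem IsDerivator.isIso_counit (hD : D.IsDerivator) (p : A ⥤ B) [p.Full] [p.Faithful]
    {R : D.Diag A ⥤ D.Diag B} (adj : D.res p ⊣ R) (Y : D.Diag A) : IsIso (adj.counit.app Y) := by
  refine hD.der2 _ fun a => ?_
  let t := StructuredArrow.mk (𝟙 (p.obj a))
  have ht : Limits.IsInitial t := StructuredArrow.mkIdInitial
  have h := hD.isCouniversalArrow_counit_comp p adj Y (p.obj a)
  rw [D.isCouniversalArrow_star_iff (adjStar t ht)] at h
  have h := isIso_of_isCouniversalArrow _ _ h
  have h1 : IsIso ((sliceCone p (p.obj a)).π.app t) := inferInstanceAs (IsIso (𝟙 (p.obj a)))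
  have h2 := isIso_map_coneArrow (D := D) (sliceCone p (p.obj a)) t (R.obj Y)
  have h3 : IsIso ((D.res (Functor.fromPUnit.{w} t)).map
      ((D.sliceTransRight p (p.obj a)).app (R.obj Y))) := by
    have h4 := isIso_map_comp' (D.res (Functor.fromPUnit.{w} t))
      (D.coneArrow (sliceCone p (p.obj a)) (R.obj Y))
      (eqToHom (D.res_comp_obj (StructuredArrow.proj (p.obj a) p) p (R.obj Y)))
    exact Eq.mpr (congrArg (fun f => IsIso ((D.res (Functor.fromPUnit.{w} t)).map f))
      (D.sliceTransRight_app p (p.obj a) (R.obj Y))) h4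
  rw [isIso_comp_left_iff, Functor.map_comp, isIso_comp_left_iff] at h
  refine (isIso_res_res_map_iff (CategoryTheory.Functor.ext (fun _ => rfl) (fun _ _ _ => ?_)) _).1 h
  simp
  exact (Category.id_comp _).symm

/-! ### Empty shapes -/

/-- (Der1) for the empty family identifies diagrams on the empty coproduct with an empty product of
categories, and J is equivalent to that coproduct. -/
theorem IsDerivator.unique_hom_of_isEmpty (hD : D.IsDerivator) [IsEmpty J] (X Y : D.Diag J) :
    Nonempty (Unique (X ⟶ Y)) := by
  let T : PEmpty.{w+1} → Type w := fun _ => PEmpty.{w+1}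
  let _ : ∀ i, SmallCategory (T i) := fun i => i.elim
  have h := hD.der1 T
  let F := (Functor.pi' fun i => D.res (Sigma.incl (C := T) i) :
      D.Diag (Σ i, T i) ⥤ ∀ i, D.Diag (T i))
  have h : F.IsEquivalence := h
  let p : (Σ i, T i) ⥤ J := { obj x := x.1.elim, map {x} := x.1.elim, map_id x := x.1.elim, map_comp {x} := x.1.elim }
  have : p.IsEquivalence :=
    { faithful := ⟨fun {x} => x.1.elim⟩, full := ⟨fun {x} => x.1.elim⟩, essSurj := ⟨fun j => isEmptyElim j⟩ }
  have e := (Functor.FullyFaithful.ofFullyFaithful (D.res p ⋙ F)).homEquiv (X := X) (Y := Y)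
  have u : Unique ((D.res p ⋙ F).obj X ⟶ (D.res p ⋙ F).obj Y) :=
    { default := fun i => i.elim, uniq := fun f => funext fun i => i.elim }
  exact ⟨e.unique⟩

theorem IsDerivator.isColimAt_iff_of_isEmpty (hD : D.IsDerivator) [IsEmpty J] {q : J ⥤ B}
    (c : Limits.Cocone q) (X : D.Diag B) :
    D.IsColimAt c X ↔ ∀ W, Nonempty (Unique ((D.ev c.pt).obj X ⟶ W)) := by
  refine forall_congr' fun W => ?_
  obtain ⟨u⟩ := hD.unique_hom_of_isEmpty ((D.res q).obj X) ((D.res (Functor.star J)).obj W)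
  constructor
  · intro h
    exact ⟨(Equiv.ofBijective _ h).unique⟩
  · rintro ⟨v⟩
    exact ⟨fun _ _ _ => Subsingleton.elim _ _, fun _ => ⟨default, Subsingleton.elim _ _⟩⟩

theorem IsDerivator.isLimAt_iff_of_isEmpty (hD : D.IsDerivator) [IsEmpty J] {q : J ⥤ B}
    (c : Limits.Cone q) (X : D.Diag B) :
    D.IsLimAt c X ↔ ∀ W, Nonempty (Unique (W ⟶ (D.ev c.pt).obj X)) := by
  refine forall_congr' fun W => ?_
  obtain ⟨u⟩ := hD.unique_hom_of_isEmpty ((D.res (Functor.star J)).obj W) ((D.res q).obj X)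
  constructor
  · intro h
    exact ⟨(Equiv.ofBijective _ h).unique⟩
  · rintro ⟨v⟩
    exact ⟨fun _ _ _ => Subsingleton.elim _ _, fun _ => ⟨default, Subsingleton.elim _ _⟩⟩

/-- An empty colimit is an initial object, which is zero as soon as there is a zero object. In this
way vanishing conditions become Kan extension conditions. -/
theorem IsDerivator.isColimAt_iff_isZero (hD : D.IsDerivator)
    (h0 : Limits.HasZeroObject (D.Diag One.{w})) [IsEmpty J] {q : J ⥤ B} (c : Limits.Cocone q)
    (X : D.Diag B) : D.IsColimAt c X ↔ Limits.IsZero ((D.ev c.pt).obj X) := by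
  rw [hD.isColimAt_iff_of_isEmpty]
  refine ⟨fun h => ?_, fun h => h.unique_to⟩
  obtain ⟨Z, hZ⟩ := h0
  have hi : Limits.IsInitial ((D.ev c.pt).obj X) :=
    Limits.IsInitial.ofUniqueHom (fun W => (h W).some.default) (fun W m => (h W).some.uniq m)
  exact hZ.of_iso (hi.uniqueUpToIso hZ.isInitial)

theorem IsDerivator.isLimAt_iff_isZero (hD : D.IsDerivator)
    (h0 : Limits.HasZeroObject (D.Diag One.{w})) [IsEmpty J] {q : J ⥤ B} (c : Limits.Cone q)
    (X : D.Diag B) : D.IsLimAt c X ↔ Limits.IsZero ((D.ev c.pt).obj X) := by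
  rw [hD.isLimAt_iff_of_isEmpty]
  refine ⟨fun h => ?_, fun h => h.unique_from⟩
  obtain ⟨Z, hZ⟩ := h0
  have hi : Limits.IsTerminal ((D.ev c.pt).obj X) :=
    Limits.IsTerminal.ofUniqueHom (fun W => (h W).some.default) (fun W m => (h W).some.uniq m)
  exact hZ.of_iso (hi.uniqueUpToIso hZ.isTerminal)

/-! ### Kan extensions with parameters -/

/-- The inclusion of a slice in a slice with parameters. -/
def sliceProd (p : A ⥤ B) (b : B) (c : C) :
    CostructuredArrow p b ⥤ CostructuredArrow (p.prod (𝟭 C)) (b, c) where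
  obj X := CostructuredArrow.mk (Y := (X.left, c)) (show (p.obj X.left, c) ⟶ (b, c) from (X.hom, 𝟙 c))
  map f := CostructuredArrow.homMk (f.left, 𝟙 c)
    (Prod.ext (CostructuredArrow.w f) (Category.id_comp _))
  map_id _ := rfl
  map_comp _ _ := by
    exact CostructuredArrow.hom_ext _ _ (Prod.ext rfl (Category.id_comp _).symm)

/-- The projection of a slice with parameters. -/
def sliceFst (p : A ⥤ B) (b : B) (c : C) :
    CostructuredArrow (p.prod (𝟭 C)) (b, c) ⥤ CostructuredArrow p b where
  obj X := CostructuredArrow.mk (Y := X.left.1) X.hom.1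
  map f := CostructuredArrow.homMk f.left.1 (congrArg Prod.fst (CostructuredArrow.w f))
  map_id _ := rfl
  map_comp _ _ := rfl

/-- `sliceFst` is left adjoint to `sliceProd`. -/
def sliceFstAdj (p : A ⥤ B) (b : B) (c : C) : sliceFst p b c ⊣ sliceProd p b c :=
  Adjunction.mkOfHomEquiv
    { homEquiv X Y :=
        { toFun f := CostructuredArrow.homMk (f.left, X.hom.2)
            (Prod.ext (CostructuredArrow.w f) (Category.comp_id _))
          invFun g := CostructuredArrow.homMk g.left.1 (congrArg Prod.fst (CostructuredArrow.w g))
          left_inv _ := rfl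
          right_inv g := by
            refine CostructuredArrow.hom_ext _ _ (Prod.ext rfl ?_)
            exact ((congrArg Prod.snd (CostructuredArrow.w g)).symm.trans (Category.comp_id _)) }
      homEquiv_naturality_left_symm _ _ := rfl
      homEquiv_naturality_right f g := by
        exact CostructuredArrow.hom_ext _ _ (Prod.ext rfl (Category.comp_id _).symm) }

/-- The inclusion of a coslice in a coslice with parameters. -/
def cosliceProd (p : A ⥤ B) (b : B) (c : C) :
    StructuredArrow b p ⥤ StructuredArrow (b, c) (p.prod (𝟭 C)) where
  obj X := StructuredArrow.mk (Y := (X.right, c)) (show (b, c) ⟶ (p.obj X.right, c) from (X.hom, 𝟙 c))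
  map f := StructuredArrow.homMk (f.right, 𝟙 c)
    (Prod.ext (StructuredArrow.w f) (Category.id_comp _))
  map_id _ := rfl
  map_comp _ _ := by
    exact StructuredArrow.hom_ext _ _ (Prod.ext rfl (Category.id_comp _).symm)

/-- The projection of a coslice with parameters. -/
def cosliceFst (p : A ⥤ B) (b : B) (c : C) :
    StructuredArrow (b, c) (p.prod (𝟭 C)) ⥤ StructuredArrow b p where
  obj X := StructuredArrow.mk (Y := X.right.1) X.hom.1
  map f := StructuredArrow.homMk f.right.1 (congrArg Prod.fst (StructuredArrow.w f))
  map_id _ := rfl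
  map_comp _ _ := rfl

/-- `cosliceProd` is left adjoint to `cosliceFst`. -/
def cosliceProdAdj (p : A ⥤ B) (b : B) (c : C) : cosliceProd p b c ⊣ cosliceFst p b c :=
  Adjunction.mkOfHomEquiv
    { homEquiv X Y :=
        { toFun g := StructuredArrow.homMk g.right.1 (congrArg Prod.fst (StructuredArrow.w g))
          invFun f := StructuredArrow.homMk (f.right, Y.hom.2)
            (Prod.ext (StructuredArrow.w f) (Category.id_comp _))
          left_inv g := by
            refine StructuredArrow.hom_ext _ _ (Prod.ext rfl ?_)
            exact ((congrArg Prod.snd (StructuredArrow.w g)).symm.trans (Category.id_comp _))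
          right_inv _ := rfl }
      homEquiv_naturality_left_symm f g := by
        exact StructuredArrow.hom_ext _ _ (Prod.ext rfl (Category.id_comp _).symm)
      homEquiv_naturality_right _ _ := rfl }

/-- The slice with parameters over (b, c) contains the slice over b through the right adjoint
`sliceProd`, which is final; so parameters can be fixed one at a time. -/
theorem IsDerivator.fullyFaithfulFrom_prod_iff (hD : D.IsDerivator) (p : A ⥤ B) (X : D.Diag (B × C)) :
    FullyFaithfulFrom (D.res (p.prod (𝟭 C))) X ↔
      ∀ c, FullyFaithfulFrom (D.res p) ((D.res (Prod.sectL B c)).obj X) := by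
  simp only [hD.fullyFaithfulFrom_iff]
  rw [Prod.forall, forall_comm]
  refine forall_congr' fun c => forall_congr' fun b => ?_
  rw [isColimAt_res_iff, ← D.isColimAt_whisker_iff _ (sliceFstAdj p b c)]
  rfl

theorem IsDerivator.fullyFaithfulTo_prod_iff (hD : D.IsDerivator) (p : A ⥤ B) (X : D.Diag (B × C)) :
    FullyFaithfulTo (D.res (p.prod (𝟭 C))) X ↔
      ∀ c, FullyFaithfulTo (D.res p) ((D.res (Prod.sectL B c)).obj X) := by
  simp only [hD.fullyFaithfulTo_iff]
  rw [Prod.forall, forall_comm]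
  refine forall_congr' fun c => forall_congr' fun b => ?_
  rw [isLimAt_res_iff, ← D.isLimAt_whisker_iff _ (cosliceProdAdj p b c)]
  rfl

end

end Prederivator

/-! ### Morphisms, modifications and adjunctions by components -/

namespace Prederivator

section Morphisms

variable {E E' E'' : Prederivator.{w,v,u}}

/-- The components of the naturality isomorphisms of a morphism of prederivators. -/
abbrev natIso (G : Mor E E') {A B : Cat.{w,w}ᵒᵖ} (f : A ⟶ B) (Z : E.obj A) :
    (G.app B).toFunctor.obj ((E.map f).toFunctor.obj Z) ≅
      (E'.map f).toFunctor.obj ((G.app A).toFunctor.obj Z) :=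
  (Cat.Hom.toNatIso (G.naturality f)).app Z

theorem natIso_naturality (G : Mor E E') {A B : Cat.{w,w}ᵒᵖ} (f : A ⟶ B) {Z Z' : E.obj A}
    (k : Z ⟶ Z') : (G.app B).toFunctor.map ((E.map f).toFunctor.map k) ≫ (natIso G f Z').hom =
      (natIso G f Z).hom ≫ (E'.map f).toFunctor.map ((G.app A).toFunctor.map k) :=
  (G.naturality f).hom.toNatTrans.naturality k

theorem natIso_naturality_assoc (G : Mor E E') {A B : Cat.{w,w}ᵒᵖ} (f : A ⟶ B) {Z Z' : E.obj A}
    (k : Z ⟶ Z') {W : E'.obj B} (h : _ ⟶ W) : (G.app B).toFunctor.map ((E.map f).toFunctor.map k) ≫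
      (natIso G f Z').hom ≫ h =
        (natIso G f Z).hom ≫ (E'.map f).toFunctor.map ((G.app A).toFunctor.map k) ≫ h := by
  rw [← Category.assoc, natIso_naturality, Category.assoc]

theorem natIso_map₂ (G : Mor E E') {A B : Cat.{w,w}ᵒᵖ} {f g : A ⟶ B} (α : f ⟶ g) (Z : E.obj A) :
    (G.app B).toFunctor.map ((E.map₂ α).toNatTrans.app Z) ≫ (natIso G g Z).hom =
      (natIso G f Z).hom ≫ (E'.map₂ α).toNatTrans.app ((G.app A).toFunctor.obj Z) :=
  congrArg (fun t => t.toNatTrans.app Z) (G.naturality_naturality α)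

theorem natIso_id (G : Mor E E') (A : Cat.{w,w}ᵒᵖ) (Z : E.obj A) :
    (natIso G (𝟙 A) Z).hom ≫ (E'.mapId A).hom.toNatTrans.app ((G.app A).toFunctor.obj Z) =
      (G.app A).toFunctor.map ((E.mapId A).hom.toNatTrans.app Z) := by
  have := congrArg (fun t => t.toNatTrans.app Z) (G.naturality_id A)
  refine this.trans ?_
  exact (congrArg (fun t => _ ≫ t) (Category.comp_id _)).trans (Category.comp_id _)

theorem natIso_comp (G : Mor E E') {A B C : Cat.{w,w}ᵒᵖ} (f : A ⟶ B) (g : B ⟶ C) (Z : E.obj A) :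
    (natIso G (f ≫ g) Z).hom ≫ (E'.mapComp f g).hom.toNatTrans.app ((G.app A).toFunctor.obj Z) =
      (G.app C).toFunctor.map ((E.mapComp f g).hom.toNatTrans.app Z) ≫
        (natIso G g ((E.map f).toFunctor.obj Z)).hom ≫
          (E'.map g).toFunctor.map (natIso G f Z).hom := by
  have := congrArg (fun t => t.toNatTrans.app Z) (G.naturality_comp f g)
  refine this.trans ?_
  refine congrArg (fun t => _ ≫ t) ?_
  refine (Category.id_comp _).trans (congrArg (fun t => _ ≫ t) ?_)
  exact (Category.id_comp _).trans (Category.comp_id _)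

/-- A morphism of prederivators from functors and components of naturality isomorphisms. -/
def mkMor (app : ∀ A, E.obj A ⥤ E'.obj A)
    (nat : ∀ {A B : Cat.{w,w}ᵒᵖ} (f : A ⟶ B) (Z : E.obj A),
      (app B).obj ((E.map f).toFunctor.obj Z) ≅ (E'.map f).toFunctor.obj ((app A).obj Z))
    (h₀ : ∀ {A B : Cat.{w,w}ᵒᵖ} (f : A ⟶ B) {Z Z' : E.obj A} (k : Z ⟶ Z'),
      (app B).map ((E.map f).toFunctor.map k) ≫ (nat f Z').hom =
        (nat f Z).hom ≫ (E'.map f).toFunctor.map ((app A).map k))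
    (h₁ : ∀ {A B : Cat.{w,w}ᵒᵖ} {f g : A ⟶ B} (α : f ⟶ g) (Z : E.obj A),
      (app B).map ((E.map₂ α).toNatTrans.app Z) ≫ (nat g Z).hom =
        (nat f Z).hom ≫ (E'.map₂ α).toNatTrans.app ((app A).obj Z))
    (h₂ : ∀ (A : Cat.{w,w}ᵒᵖ) (Z : E.obj A),
      (nat (𝟙 A) Z).hom ≫ (E'.mapId A).hom.toNatTrans.app ((app A).obj Z) =
        (app A).map ((E.mapId A).hom.toNatTrans.app Z))
    (h₃ : ∀ {A B C : Cat.{w,w}ᵒᵖ} (f : A ⟶ B) (g : B ⟶ C) (Z : E.obj A),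
      (nat (f ≫ g) Z).hom ≫ (E'.mapComp f g).hom.toNatTrans.app ((app A).obj Z) =
        (app C).map ((E.mapComp f g).hom.toNatTrans.app Z) ≫ (nat g ((E.map f).toFunctor.obj Z)).hom ≫
          (E'.map g).toFunctor.map (nat f Z).hom) : Mor E E' where
  app A := (app A).toCatHom
  naturality f := Cat.Hom.isoMk (NatIso.ofComponents (fun Z => nat f Z) (fun k => h₀ f k))
  naturality_naturality α := Cat.Hom₂.ext (NatTrans.ext (funext fun Z => h₁ α Z))
  naturality_id A := by
    refine Cat.Hom₂.ext (NatTrans.ext (funext fun Z => (h₂ A Z).trans ?_))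
    exact ((congrArg (fun t => _ ≫ t) (Category.comp_id _)).trans (Category.comp_id _)).symm
  naturality_comp f g := by
    refine Cat.Hom₂.ext (NatTrans.ext (funext fun Z => (h₃ f g Z).trans ?_))
    refine congrArg (fun t => _ ≫ t) (Eq.symm ?_)
    refine (Category.id_comp _).trans (congrArg (fun t => _ ≫ t) ?_)
    exact (Category.id_comp _).trans (Category.comp_id _)

/-- A modification from its components. -/
def mkHom {G H : Mor E E'}
    (app : ∀ A (Z : E.obj A), (G.app A).toFunctor.obj Z ⟶ (H.app A).toFunctor.obj Z)
    (h₀ : ∀ A {Z Z' : E.obj A} (k : Z ⟶ Z'),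
      (G.app A).toFunctor.map k ≫ app A Z' = app A Z ≫ (H.app A).toFunctor.map k)
    (h₁ : ∀ {A B : Cat.{w,w}ᵒᵖ} (f : A ⟶ B) (Z : E.obj A),
      app B ((E.map f).toFunctor.obj Z) ≫ (natIso H f Z).hom =
        (natIso G f Z).hom ≫ (E'.map f).toFunctor.map (app A Z)) : G ⟶ H where
  as :=
    { app A := NatTrans.toCatHom₂ { app Z := app A Z, naturality _ _ k := h₀ A k }
      naturality f := Cat.Hom₂.ext (NatTrans.ext (funext fun Z => h₁ f Z)) }

theorem hom_naturality {G H : Mor E E'} (m : G ⟶ H) {A B : Cat.{w,w}ᵒᵖ} (f : A ⟶ B) (Z : E.obj A) :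
    (m.as.app B).toNatTrans.app ((E.map f).toFunctor.obj Z) ≫ (natIso H f Z).hom =
      (natIso G f Z).hom ≫ (E'.map f).toFunctor.map ((m.as.app A).toNatTrans.app Z) :=
  congrArg (fun t => t.toNatTrans.app Z) (m.as.naturality f)

theorem hom_ext' {G H : Mor E E'} {m m' : G ⟶ H}
    (h : ∀ A (Z : E.obj A), (m.as.app A).toNatTrans.app Z = (m'.as.app A).toNatTrans.app Z) : m = m' :=
  Pseudofunctor.StrongTrans.homCategory.ext fun A =>
    Cat.Hom₂.ext (NatTrans.ext (funext fun Z => h A Z))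

theorem natIso_hom_comp (G : Mor E E') (H : Mor E' E'') {A B : Cat.{w,w}ᵒᵖ} (f : A ⟶ B) (Z : E.obj A) :
    (natIso (G ≫ H) f Z).hom =
      (H.app B).toFunctor.map (natIso G f Z).hom ≫ (natIso H f ((G.app A).toFunctor.obj Z)).hom := by
  refine (Category.id_comp _).trans (congrArg (fun t => _ ≫ t) ?_)
  exact (Category.id_comp _).trans (Category.comp_id _)

/-- A modification with invertible components is invertible. -/
theorem isIso_of_components {G H : Mor E E'} (m : G ⟶ H)
    (h : ∀ A (Z : E.obj A), IsIso ((m.as.app A).toNatTrans.app Z)) : IsIso m := by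
  let n : H ⟶ G := mkHom (fun A Z => inv ((m.as.app A).toNatTrans.app Z))
    (fun A Z Z' k => by
      rw [IsIso.comp_inv_eq, Category.assoc, IsIso.eq_inv_comp]
      exact ((m.as.app A).toNatTrans.naturality k).symm)
    (fun {A B} f Z => by
      rw [IsIso.inv_comp_eq, Functor.map_inv, ← Category.assoc, IsIso.eq_comp_inv]
      exact (hom_naturality m f Z).symm)
  exact ⟨n, hom_ext' fun A Z => IsIso.hom_inv_id _, hom_ext' fun A Z => IsIso.inv_hom_id _⟩

theorem leftZigzag_eq {L : Mor E E'} {R : Mor E' E} (η : 𝟙 E.toPseudofunctor ⟶ L ≫ R)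
    (θ : R ≫ L ⟶ 𝟙 E'.toPseudofunctor) :
    Bicategory.leftZigzag η θ = η ▷ L ≫ (α_ L R L).hom ≫ L ◁ θ := by
  simp [Bicategory.leftZigzag, bicategoricalComp]

theorem rightZigzag_eq {L : Mor E E'} {R : Mor E' E} (η : 𝟙 E.toPseudofunctor ⟶ L ≫ R)
    (θ : R ≫ L ⟶ 𝟙 E'.toPseudofunctor) :
    Bicategory.rightZigzag η θ = R ◁ η ≫ (α_ R L R).inv ≫ θ ▷ R := by
  simp [Bicategory.rightZigzag, bicategoricalComp]

/-- An adjunction of morphisms of prederivators induces adjunctions of functors. -/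
def adjApp {L : Mor E E'} {R : Mor E' E} (adj : Bicategory.Adjunction L R) (A : Cat.{w,w}ᵒᵖ) :
    (L.app A).toFunctor ⊣ (R.app A).toFunctor where
  unit := (adj.unit.as.app A).toNatTrans
  counit := (adj.counit.as.app A).toNatTrans
  left_triangle_components X := by
    have := congrArg (fun t => (t.as.app A).toNatTrans.app X)
      ((leftZigzag_eq adj.unit adj.counit).symm.trans adj.left_triangle)
    refine Eq.trans ?_ (this.trans (Category.comp_id _))
    exact congrArg (fun t => _ ≫ t) (Category.id_comp _).symm
  right_triangle_components X := by
    have := congrArg (fun t => (t.as.app A).toNatTrans.app X)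
      ((rightZigzag_eq adj.unit adj.counit).symm.trans adj.right_triangle)
    refine Eq.trans ?_ (this.trans (Category.comp_id _))
    exact congrArg (fun t => _ ≫ t) (Category.id_comp _).symm

/-- Modifications satisfying the triangle identities componentwise form an adjunction. -/
theorem nonempty_adjunction {L : Mor E E'} {R : Mor E' E} (η : 𝟙 E.toPseudofunctor ⟶ L ≫ R)
    (θ : R ≫ L ⟶ 𝟙 E'.toPseudofunctor)
    (h₁ : ∀ A (X : E.obj A), (L.app A).toFunctor.map ((η.as.app A).toNatTrans.app X) ≫
      (θ.as.app A).toNatTrans.app ((L.app A).toFunctor.obj X) = 𝟙 ((L.app A).toFunctor.obj X))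
    (h₂ : ∀ A (X : E'.obj A), (η.as.app A).toNatTrans.app ((R.app A).toFunctor.obj X) ≫
      (R.app A).toFunctor.map ((θ.as.app A).toNatTrans.app X) = 𝟙 ((R.app A).toFunctor.obj X)) :
    Nonempty (Bicategory.Adjunction L R) :=
  ⟨{ unit := η
     counit := θ
     left_triangle := by
       rw [leftZigzag_eq]
       refine hom_ext' fun A X => ?_
       refine Eq.trans ?_ ((h₁ A X).trans (Category.comp_id _).symm)
       exact congrArg (fun t => _ ≫ t) (Category.id_comp _)
     right_triangle := by
       rw [rightZigzag_eq]
       refine hom_ext' fun A X => ?_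
       refine Eq.trans ?_ ((h₂ A X).trans (Category.comp_id _).symm)
       exact congrArg (fun t => _ ≫ t) (Category.id_comp _) }⟩

theorem natIso_hom_id {A B : Cat.{w,w}ᵒᵖ} (f : A ⟶ B) (Z : E.obj A) :
    (natIso (𝟙 E.toPseudofunctor) f Z).hom = 𝟙 ((E.map f).toFunctor.obj Z) :=
  Category.comp_id _

/-- A morphism of prederivators whose components have left adjoints compatible with restriction has a
left adjoint. -/
theorem exists_leftAdjoint (G : Mor E' E) (L : ∀ A, E.obj A ⥤ E'.obj A)
    (adj : ∀ A, L A ⊣ (G.app A).toFunctor)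
    (bc : ∀ {A B : Cat.{w,w}ᵒᵖ} (f : A ⟶ B) (X : E.obj A), IsUniversalArrow (G.app B).toFunctor
      ((E.map f).toFunctor.map ((adj A).unit.app X) ≫ (natIso G f ((L A).obj X)).inv)) :
    ∃ L' : Mor E E', Nonempty (Bicategory.Adjunction L' G) := by
  obtain ⟨η, hη₀⟩ : ∃ η : ∀ A (X : E.obj A), X ⟶ (G.app A).toFunctor.obj ((L A).obj X),
    ∀ A X, η A X = (adj A).unit.app X := ⟨fun A X => (adj A).unit.app X, fun _ _ => rfl⟩
  have hη : ∀ {A : Cat.{w,w}ᵒᵖ} {X Y : E.obj A} (k : X ⟶ Y),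
      η A X ≫ (G.app A).toFunctor.map ((L A).map k) = k ≫ η A Y := fun {A X Y} k => by
    rw [hη₀, hη₀]
    exact ((adj A).unit.naturality k).symm
  have hη' : ∀ {A : Cat.{w,w}ᵒᵖ} {X Y : E.obj A} (k : X ⟶ Y) {W : E.obj A} (h : _ ⟶ W),
      η A X ≫ (G.app A).toFunctor.map ((L A).map k) ≫ h = k ≫ η A Y ≫ h := fun {A X Y} k W h => by
    rw [← Category.assoc, hη, Category.assoc]
  have hext : ∀ {A : Cat.{w,w}ᵒᵖ} {X : E.obj A} {Z : E'.obj A} {k k' : (L A).obj X ⟶ Z},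
      η A X ≫ (G.app A).toFunctor.map k = η A X ≫ (G.app A).toFunctor.map k' → k = k' :=
    fun {A X Z k k'} h => by
      rw [hη₀] at h
      exact ((adj A).homEquiv X Z).injective
        (((adj A).homEquiv_unit _ _ _).trans (h.trans ((adj A).homEquiv_unit _ _ _).symm))
  -- The isomorphism commuting L with restriction is pinned down by its compatibility with the
  -- units, and base change makes it invertible. All coherence laws below follow by checking them
  -- after composing with the unit.
  have hθ₀ : ∀ {A B : Cat.{w,w}ᵒᵖ} (f : A ⟶ B) (X : E.obj A),
      ∃ θ : (L B).obj ((E.map f).toFunctor.obj X) ≅ (E'.map f).toFunctor.obj ((L A).obj X),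
        η B ((E.map f).toFunctor.obj X) ≫ (G.app B).toFunctor.map θ.hom ≫
          (natIso G f ((L A).obj X)).hom = (E.map f).toFunctor.map (η A X) := by
    intro A B f X
    let θ := ((adj B).homEquiv _ _).symm
      ((E.map f).toFunctor.map ((adj A).unit.app X) ≫ (natIso G f ((L A).obj X)).inv)
    have hiso : IsIso θ := (isUniversalArrow_iff_isIso (adj B) _).1 (bc f X)
    refine ⟨asIso θ, ?_⟩
    have h := ((adj B).homEquiv_unit _ _ θ).symm.trans (Equiv.apply_symm_apply _ _)
    rw [hη₀, hη₀, ← Category.assoc, asIso_hom]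
    refine (congrArg (fun t => t ≫ _) h).trans ?_
    rw [Category.assoc, Iso.inv_hom_id, Category.comp_id]
  choose θ hθ using @hθ₀
  have hθ' : ∀ {A B : Cat.{w,w}ᵒᵖ} (f : A ⟶ B) (X : E.obj A) {W : E.obj B} (h : _ ⟶ W),
      η B ((E.map f).toFunctor.obj X) ≫ (G.app B).toFunctor.map (θ f X).hom ≫
          (natIso G f ((L A).obj X)).hom ≫ h = (E.map f).toFunctor.map (η A X) ≫ h := by
    intro A B f X W h
    rw [← hθ]
    simp only [Category.assoc]
  let L' : Mor E E' := mkMor L (fun f X => θ f X)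
    (by
      intro A B f Z Z' k
      apply hext
      rw [← cancel_mono (natIso G f ((L A).obj Z')).hom]
      simp only [Functor.map_comp, Category.assoc]
      rw [natIso_naturality, hη', hθ, ← Functor.map_comp, ← hη, Functor.map_comp, ← hθ]
      simp only [Category.assoc])
    (by
      intro A B f g α Z
      apply hext
      rw [← cancel_mono (natIso G g ((L A).obj Z)).hom]
      simp only [Functor.map_comp, Category.assoc]
      rw [natIso_map₂, hη', hθ, hθ']
      exact ((E.map₂ α).toNatTrans.naturality (η A Z)).symm)
    (by
      intro A Z
      apply hext
      simp only [Functor.map_comp]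
      rw [hη, ← natIso_id, hθ']
      exact (E.mapId A).hom.toNatTrans.naturality (η A Z))
    (by
      intro A B C f g Z
      apply hext
      rw [← cancel_mono (natIso G g ((E'.map f).toFunctor.obj ((L A).obj Z))).hom,
        ← cancel_mono ((E.map g).toFunctor.map (natIso G f ((L A).obj Z)).hom)]
      simp only [Functor.map_comp, Category.assoc]
      rw [← natIso_comp, hη', natIso_naturality_assoc, hθ']
      refine ((E.mapComp f g).hom.toNatTrans.naturality (η A Z)).trans ?_
      refine congrArg (fun t => (E.mapComp f g).hom.toNatTrans.app Z ≫ t) (Eq.symm ?_)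
      refine (hθ' g ((E.map f).toFunctor.obj Z) _).trans ?_
      rw [← Functor.map_comp, ← Functor.map_comp, hθ]
      rfl)
  refine ⟨L', nonempty_adjunction
    (mkHom (fun A X => (adj A).unit.app X) (fun A _ _ k => (adj A).unit.naturality k) ?_)
    (mkHom (fun A X => (adj A).counit.app X) (fun A _ _ k => (adj A).counit.naturality k) ?_)
    (fun A X => (adj A).left_triangle_components X)
    (fun A X => (adj A).right_triangle_components X)⟩
  · intro A B f X
    rw [natIso_hom_comp, natIso_hom_id, ← hη₀, ← hη₀]
    exact (hθ f X).trans (Category.id_comp _).symm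
  · intro A B f X
    obtain ⟨κ, hκ⟩ : ∃ κ : ∀ A (Z : E'.obj A), (L A).obj ((G.app A).toFunctor.obj Z) ⟶ Z,
      ∀ A Z, κ A Z = (adj A).counit.app Z := ⟨fun A Z => (adj A).counit.app Z, fun _ _ => rfl⟩
    have ht : ∀ A (Z : E'.obj A), η A ((G.app A).toFunctor.obj Z) ≫
        (G.app A).toFunctor.map (κ A Z) = 𝟙 _ := fun A Z => by
      rw [hη₀, hκ]
      exact (adj A).right_triangle_components Z
    rw [natIso_hom_comp, natIso_hom_id]
    refine (Category.comp_id _).trans ?_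
    apply hext
    rw [← cancel_mono (natIso G f X).hom, ← hκ, ← hκ]
    change _ = (_ ≫ (G.app B).toFunctor.map (((L B).map (natIso G f X).hom ≫
      (θ f ((G.app A).toFunctor.obj X)).hom) ≫ (E'.map f).toFunctor.map (κ A X))) ≫ _
    rw [ht, Category.id_comp]
    simp only [Functor.map_comp, Category.assoc]
    rw [natIso_naturality, hη', hθ', ← Functor.map_comp, ht, CategoryTheory.Functor.map_id,
      Category.comp_id]

/-- A morphism of prederivators whose components have right adjoints compatible with restriction has a
right adjoint. -/
theorem exists_rightAdjoint (G : Mor E' E) (R : ∀ A, E.obj A ⥤ E'.obj A)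
    (adj : ∀ A, (G.app A).toFunctor ⊣ R A)
    (bc : ∀ {A B : Cat.{w,w}ᵒᵖ} (f : A ⟶ B) (X : E.obj A), IsCouniversalArrow (G.app B).toFunctor
      ((natIso G f ((R A).obj X)).hom ≫ (E.map f).toFunctor.map ((adj A).counit.app X))) :
    ∃ R' : Mor E E', Nonempty (Bicategory.Adjunction G R') := by
  obtain ⟨κ, hκ₀⟩ : ∃ κ : ∀ A (X : E.obj A), (G.app A).toFunctor.obj ((R A).obj X) ⟶ X,
    ∀ A X, κ A X = (adj A).counit.app X := ⟨fun A X => (adj A).counit.app X, fun _ _ => rfl⟩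
  have hκ : ∀ {A : Cat.{w,w}ᵒᵖ} {X Y : E.obj A} (k : X ⟶ Y),
      (G.app A).toFunctor.map ((R A).map k) ≫ κ A Y = κ A X ≫ k := fun {A X Y} k => by
    rw [hκ₀, hκ₀]
    exact (adj A).counit.naturality k
  have hext : ∀ {A : Cat.{w,w}ᵒᵖ} {X : E.obj A} {Z : E'.obj A} {k k' : Z ⟶ (R A).obj X},
      (G.app A).toFunctor.map k ≫ κ A X = (G.app A).toFunctor.map k' ≫ κ A X → k = k' :=
    fun {A X Z k k'} h => by
      rw [hκ₀] at h
      exact ((adj A).homEquiv Z X).symm.injective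
        (((adj A).homEquiv_counit _ _ _).trans (h.trans ((adj A).homEquiv_counit _ _ _).symm))
  -- By base change the restriction of R X has a universal property of its own, so morphisms into it
  -- can be compared before commuting R with restriction.
  have hext' : ∀ {A B : Cat.{w,w}ᵒᵖ} (f : A ⟶ B) {X : E.obj A} {Z : E'.obj B}
      {k k' : Z ⟶ (E'.map f).toFunctor.obj ((R A).obj X)},
      (G.app B).toFunctor.map k ≫ (natIso G f ((R A).obj X)).hom ≫ (E.map f).toFunctor.map (κ A X) =
      (G.app B).toFunctor.map k' ≫ (natIso G f ((R A).obj X)).hom ≫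
        (E.map f).toFunctor.map (κ A X) → k = k' :=
    fun {A B} f {X Z k k'} h => by
      rw [hκ₀] at h
      exact (bc f X Z).1 h
  have hθ₀ : ∀ {A B : Cat.{w,w}ᵒᵖ} (f : A ⟶ B) (X : E.obj A),
      ∃ θ : (R B).obj ((E.map f).toFunctor.obj X) ≅ (E'.map f).toFunctor.obj ((R A).obj X),
        (G.app B).toFunctor.map θ.hom ≫ (natIso G f ((R A).obj X)).hom ≫
          (E.map f).toFunctor.map (κ A X) = κ B ((E.map f).toFunctor.obj X) := by
    intro A B f X
    let θ := ((adj B).homEquiv _ _)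
      ((natIso G f ((R A).obj X)).hom ≫ (E.map f).toFunctor.map ((adj A).counit.app X))
    have hiso : IsIso θ := (isCouniversalArrow_iff_isIso (adj B) _).1 (bc f X)
    refine ⟨(asIso θ).symm, ?_⟩
    have h := ((adj B).homEquiv_counit _ _ θ).symm.trans (Equiv.symm_apply_apply _ _)
    rw [hκ₀, hκ₀]
    refine (congrArg (fun t => (G.app B).toFunctor.map (inv θ) ≫ t) h.symm).trans ?_
    rw [← Category.assoc, ← Functor.map_comp, IsIso.inv_hom_id, CategoryTheory.Functor.map_id,
      Category.id_comp]
    rfl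
  choose θ hθ using @hθ₀
  have hθ' : ∀ {A B : Cat.{w,w}ᵒᵖ} (f : A ⟶ B) (X : E.obj A) {W : E.obj B} (h : _ ⟶ W),
      (G.app B).toFunctor.map (θ f X).hom ≫ (natIso G f ((R A).obj X)).hom ≫
          (E.map f).toFunctor.map (κ A X) ≫ h = κ B ((E.map f).toFunctor.obj X) ≫ h := by
    intro A B f X W h
    rw [← hθ]
    simp only [Category.assoc]
  let R' : Mor E E' := mkMor R (fun f X => θ f X)
    (by
      intro A B f Z Z' k
      apply hext'
      simp only [Functor.map_comp, Category.assoc]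
      rw [natIso_naturality_assoc, hθ, hκ, ← Functor.map_comp, hκ, Functor.map_comp, hθ'])
    (by
      intro A B f g α Z
      apply hext'
      have h := natIso_map₂ G α ((R A).obj Z)
      simp only [Functor.map_comp, Category.assoc]
      rw [hθ, hκ, ← hθ', ← Category.assoc ((G.app B).toFunctor.map ((E'.map₂ α).toNatTrans.app _)), h,
        Category.assoc]
      exact congrArg (fun t => (G.app B).toFunctor.map (θ f Z).hom ≫ (natIso G f _).hom ≫ t)
        ((E.map₂ α).toNatTrans.naturality (κ A Z)))
    (by
      intro A Z
      apply hext
      simp only [Functor.map_comp, Category.assoc]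
      rw [hκ, ← natIso_id, ← hθ']
      simp only [Category.assoc]
      exact congrArg (fun t => (G.app A).toFunctor.map (θ (𝟙 A) Z).hom ≫ (natIso G (𝟙 A) _).hom ≫ t)
        ((E.mapId A).hom.toNatTrans.naturality (κ A Z)).symm)
    (by
      intro A B C f g Z
      -- This moves the target to the restriction along g of a value of R, where the cancellation
      -- property `hext'` for g applies.
      rw [← cancel_mono ((E'.map g).toFunctor.map (θ f Z).inv)]
      apply hext'
      simp only [Functor.map_comp, Category.assoc]
      rw [natIso_naturality_assoc, ← Functor.map_comp]
      have h : (G.app B).toFunctor.map (θ f Z).inv ≫ κ B ((E.map f).toFunctor.obj Z) =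
          (natIso G f ((R A).obj Z)).hom ≫ (E.map f).toFunctor.map (κ A Z) := by
        rw [← hθ, ← Category.assoc, ← Functor.map_comp, Iso.inv_hom_id, CategoryTheory.Functor.map_id,
          Category.id_comp]
      rw [h, natIso_naturality_assoc, ← Functor.map_comp, hθ, hθ, hκ, Functor.map_comp]
      have h₂ := natIso_comp G f g ((R A).obj Z)
      have h₃ : (natIso G (f ≫ g) ((R A).obj Z)).hom ≫ (E.mapComp f g).hom.toNatTrans.app _ ≫
          (E.map g).toFunctor.map ((E.map f).toFunctor.map (κ A Z)) =
          (natIso G (f ≫ g) ((R A).obj Z)).hom ≫ (E.map (f ≫ g)).toFunctor.map (κ A Z) ≫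
            (E.mapComp f g).hom.toNatTrans.app Z :=
        congrArg (fun t => (natIso G (f ≫ g) ((R A).obj Z)).hom ≫ t)
          ((E.mapComp f g).hom.toNatTrans.naturality (κ A Z)).symm
      rw [← hθ', ← h₃, ← Category.assoc (natIso G (f ≫ g) _).hom, h₂]
      simp only [Category.assoc])
  refine ⟨R', nonempty_adjunction
    (mkHom (fun A X => (adj A).unit.app X) (fun A _ _ k => (adj A).unit.naturality k) ?_)
    (mkHom (fun A X => (adj A).counit.app X) (fun A _ _ k => (adj A).counit.naturality k) ?_)
    (fun A X => (adj A).left_triangle_components X)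
    (fun A X => (adj A).right_triangle_components X)⟩
  · intro A B f X
    obtain ⟨η, hη⟩ : ∃ η : ∀ A (Z : E'.obj A), Z ⟶ (R A).obj ((G.app A).toFunctor.obj Z),
      ∀ A Z, η A Z = (adj A).unit.app Z := ⟨fun A Z => (adj A).unit.app Z, fun _ _ => rfl⟩
    have ht : ∀ A (Z : E'.obj A), (G.app A).toFunctor.map (η A Z) ≫
        κ A ((G.app A).toFunctor.obj Z) = 𝟙 _ := fun A Z => by
      rw [hη, hκ₀]
      exact (adj A).left_triangle_components Z
    rw [natIso_hom_comp, natIso_hom_id]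
    refine Eq.trans ?_ (Category.id_comp _).symm
    apply hext'
    rw [← hη, ← hη]
    change (G.app B).toFunctor.map (η B _ ≫ (R B).map (natIso G f X).hom ≫
      (θ f ((G.app A).toFunctor.obj X)).hom) ≫
        (natIso G f ((R A).obj ((G.app A).toFunctor.obj X))).hom ≫
          (E.map f).toFunctor.map (κ A ((G.app A).toFunctor.obj X)) =
      (G.app B).toFunctor.map ((E'.map f).toFunctor.map (η A X)) ≫
        (natIso G f ((R A).obj ((G.app A).toFunctor.obj X))).hom ≫
          (E.map f).toFunctor.map (κ A ((G.app A).toFunctor.obj X))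
    simp only [Functor.map_comp, Category.assoc]
    rw [natIso_naturality_assoc, hθ, hκ, ← Functor.map_comp, ht, CategoryTheory.Functor.map_id,
      Category.comp_id, ← Category.assoc, ht, Category.id_comp]
  · intro A B f X
    rw [natIso_hom_comp, natIso_hom_id, ← hκ₀, ← hκ₀]
    exact (Category.comp_id _).trans ((hθ f X).symm.trans (Category.assoc _ _ _).symm)

end Morphisms

end Prederivator

/-! ### Kan extensions and equivalences as morphisms of prederivators -/

namespace Prederivator

/-- For an invertible unit the base change arrow is itself invertible. The base change condition
then only asks that the restricted extension be a Kan extension again. -/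
theorem isUniversalArrow_map_unit_comp_iff {C C' E E' : Type*} [Category* C] [Category* C'] [Category* E]
    [Category* E'] (F : C ⥤ C') (G : E ⥤ C') {L : C ⥤ E'} {R : E' ⥤ C} (adj : L ⊣ R) {X : C}
    (h : IsIso (adj.unit.app X)) {Z : E} (i : F.obj (R.obj (L.obj X)) ≅ G.obj Z) :
    IsUniversalArrow G (F.map (adj.unit.app X) ≫ i.hom) ↔ FullyFaithfulFrom G Z :=
  isUniversalArrow_iff_of_isIso _ _

theorem isCouniversalArrow_comp_map_counit_iff {C C' E E' : Type*} [Category* C] [Category* C']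
    [Category* E] [Category* E'] (F : C ⥤ C') (G : E ⥤ C') {L : E' ⥤ C} {R : C ⥤ E'} (adj : L ⊣ R)
    {X : C} (h : IsIso (adj.counit.app X)) {Z : E} (i : G.obj Z ≅ F.obj (L.obj (R.obj X))) :
    IsCouniversalArrow G (i.hom ≫ F.map (adj.counit.app X)) ↔ FullyFaithfulTo G Z :=
  isCouniversalArrow_iff_of_isIso _ _

/-- By the triangle identity the counit at L X is inverse to the image of the unit. -/
theorem fullyFaithfulFrom_of_isIso_unit {C E : Type*} [Category* C] [Category* E] {L : C ⥤ E} {R : E ⥤ C}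
    (adj : L ⊣ R) {X : C} (h : IsIso (adj.unit.app X)) : FullyFaithfulFrom R (L.obj X) := by
  rw [fullyFaithfulFrom_iff_isIso_counit adj]
  have h2 : IsIso (L.map (adj.unit.app X) ≫ adj.counit.app (L.obj X)) :=
    (adj.left_triangle_components X).symm ▸ (inferInstance : IsIso (𝟙 (L.obj X)))
  exact IsIso.of_isIso_comp_left (L.map (adj.unit.app X)) _

theorem fullyFaithfulTo_of_isIso_counit {C E : Type*} [Category* C] [Category* E] {L : C ⥤ E} {R : E ⥤ C}
    (adj : L ⊣ R) {X : E} (h : IsIso (adj.counit.app X)) : FullyFaithfulTo L (R.obj X) := by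
  rw [fullyFaithfulTo_iff_isIso_unit adj]
  have h2 : IsIso (adj.unit.app (R.obj X) ≫ R.map (adj.counit.app X)) :=
    (adj.right_triangle_components X).symm ▸ (inferInstance : IsIso (𝟙 (R.obj X)))
  exact IsIso.of_isIso_comp_right _ (R.map (adj.counit.app X))

theorem eqToHom_conj_cancel {C : Type*} [Category* C] {a b c d : C} (h : a = b) (f : b ⟶ c) (h' : c = d) :
    (eqToHom h ≫ f ≫ eqToHom h') ≫ eqToHom h'.symm = eqToHom h ≫ f := by
  simp

instance full_prod_id {B C A : Type*} [Category* B] [Category* C] [Category* A] (p : B ⥤ C) [p.Full] :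
    (p.prod (𝟭 A)).Full where
  map_surjective f := ⟨(p.preimage f.1, f.2), Prod.ext (p.map_preimage f.1) rfl⟩

instance faithful_prod_id {B C A : Type*} [Category* B] [Category* C] [Category* A] (p : B ⥤ C)
    [p.Faithful] : (p.prod (𝟭 A)).Faithful where
  map_injective {_ _ f g} h := Prod.ext (p.map_injective (congrArg Prod.fst h))
    (show ((p.prod (𝟭 A)).map f).2 = ((p.prod (𝟭 A)).map g).2 by rw [h])

section Morphisms

variable {E E' E'' : Prederivator.{w,v,u}}

/-- Whiskering the counit of an adjunction with a morphism on whose values it is invertible. -/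
theorem nonempty_comp_counit_iso {G : Mor E' E} {L : Mor E E'} (adj : Bicategory.Adjunction L G)
    (T : Mor E'' E') (h : ∀ A (X : E''.obj A),
      FullyFaithfulFrom (G.app A).toFunctor ((T.app A).toFunctor.obj X)) :
    Nonempty (T ≫ G ≫ L ≅ T) := by
  have : IsIso (T ◁ adj.counit) := isIso_of_components _ fun A X =>
    (fullyFaithfulFrom_iff_isIso_counit (adjApp adj A) _).1 (h A X)
  exact ⟨asIso (T ◁ adj.counit) ≪≫ ρ_ T⟩

/-- Whiskering the unit of an adjunction with a morphism on whose values it is invertible. -/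
theorem nonempty_comp_unit_iso {G : Mor E' E} {R : Mor E E'} (adj : Bicategory.Adjunction G R)
    (T : Mor E'' E') (h : ∀ A (X : E''.obj A),
      FullyFaithfulTo (G.app A).toFunctor ((T.app A).toFunctor.obj X)) :
    Nonempty (T ≫ G ≫ R ≅ T) := by
  have : IsIso (T ◁ adj.unit) := isIso_of_components _ fun A X =>
    (fullyFaithfulTo_iff_isIso_unit (adjApp adj A) _).1 (h A X)
  exact ⟨(asIso (T ◁ adj.unit)).symm ≪≫ ρ_ T⟩

/-- A morphism of prederivators that consists of equivalences is an equivalence. -/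
theorem exists_inverse (G : Mor E' E) (h : ∀ A, (G.app A).toFunctor.IsEquivalence) :
    ∃ F : Mor E E', Nonempty (F ≫ G ≅ 𝟙 _) ∧ Nonempty (G ≫ F ≅ 𝟙 _) := by
  -- Base change is automatic here, since an equivalence is fully faithful from every object.
  obtain ⟨F, ⟨adj⟩⟩ := exists_leftAdjoint G (fun A => (G.app A).toFunctor.inv)
    (fun A => (G.app A).toFunctor.asEquivalence.symm.toAdjunction) (fun {A B} f X => by
      have h1 : IsIso ((G.app A).toFunctor.asEquivalence.symm.toAdjunction.unit.app X) :=
        inferInstanceAs (IsIso ((G.app A).toFunctor.asEquivalence.symm.unitIso.hom.app X))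
      exact (isUniversalArrow_map_unit_comp_iff (E.map f).toFunctor _ _ h1 (natIso G f _).symm).2
        (fullyFaithfulFrom_of_fullyFaithful _ _))
  have h1 : IsIso adj.unit := isIso_of_components _ fun A X => by
    have := (adjApp adj A).isEquivalence_left_of_isEquivalence_right
    exact inferInstanceAs (IsIso ((adjApp adj A).unit.app X))
  have h2 : IsIso adj.counit := isIso_of_components _ fun A X =>
    inferInstanceAs (IsIso ((adjApp adj A).counit.app X))
  exact ⟨F, ⟨(asIso adj.unit).symm⟩, ⟨asIso adj.counit⟩⟩

end Morphisms

section Restriction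

variable {D : Prederivator.{w,v,u}} {A B C : Type w} [SmallCategory A] [SmallCategory B]
  [SmallCategory C]

theorem natIso_obj_eq (p : B ⥤ C) {I J : Cat.{w,w}ᵒᵖ} (f : I ⟶ J) (Z : (D.shift C).obj I) :
    ((D.resMor p).app J).toFunctor.obj (((D.shift C).map f).toFunctor.obj Z) =
      ((D.shift B).map f).toFunctor.obj (((D.resMor p).app I).toFunctor.obj Z) :=
  (D.res_comp_obj (p.prod (𝟭 J.unop)) ((𝟭 C).prod f.unop.toFunctor) Z).symm.trans
    (D.res_comp_obj ((𝟭 B).prod f.unop.toFunctor) (p.prod (𝟭 I.unop)) Z)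

theorem natIso_resMor_hom (p : B ⥤ C) {I J : Cat.{w,w}ᵒᵖ} (f : I ⟶ J) (Z : (D.shift C).obj I) :
    (natIso (D.resMor p) f Z).hom = eqToHom (natIso_obj_eq p f Z) :=
  Cat.eqToHom_app _ _ _ Z

/-- Restriction morphisms are functorial. -/
theorem nonempty_resMor_comp (p : A ⥤ B) (q : B ⥤ C) :
    Nonempty (D.resMor (p ⋙ q) ≅ D.resMor q ≫ D.resMor p) := by
  have e : ∀ (I : Cat.{w,w}ᵒᵖ) (Z : (D.shift C).obj I),
      ((D.resMor (p ⋙ q)).app I).toFunctor.obj Z = ((D.resMor q ≫ D.resMor p).app I).toFunctor.obj Z :=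
    fun I Z => D.res_comp_obj (p.prod (𝟭 I.unop)) (q.prod (𝟭 I.unop)) Z
  let m : D.resMor (p ⋙ q) ⟶ D.resMor q ≫ D.resMor p := mkHom (fun I Z => eqToHom (e I Z))
    (fun I {Z Z'} k => by
      have := D.res_comp_map (p.prod (𝟭 I.unop)) (q.prod (𝟭 I.unop)) k
      exact (congrArg (fun t => t ≫ eqToHom (e I Z')) this).trans (eqToHom_conj_cancel _ _ _))
    (fun {I J} f Z => by
      have h : ((D.resMor q ≫ D.resMor p).app J).toFunctor.obj (((D.shift C).map f).toFunctor.obj Z) =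
          ((D.shift A).map f).toFunctor.obj (((D.resMor q ≫ D.resMor p).app I).toFunctor.obj Z) :=
        (e J _).symm.trans ((natIso_obj_eq (p ⋙ q) f Z).trans (congrArg _ (e I Z)))
      have h₁ : (natIso (D.resMor q ≫ D.resMor p) f Z).hom = eqToHom h := by
        refine (natIso_hom_comp _ _ _ _).trans ((congrArg₂ (fun s t => s ≫ t)
          ((congrArg (fun t => ((D.resMor p).app J).toFunctor.map t) (natIso_resMor_hom q f Z)).trans
            (eqToHom_map _ _)) (natIso_resMor_hom p f _)).trans (eqToHom_trans _ _))
      refine (congrArg (fun t => eqToHom (e J _) ≫ t) h₁).trans ((eqToHom_trans _ _).trans ?_)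
      refine ((congrArg₂ (fun s t => s ≫ t) (natIso_resMor_hom (p ⋙ q) f Z)
        (eqToHom_map _ (e I Z))).trans (eqToHom_trans _ _)).symm)
  have : IsIso m := isIso_of_components _ fun I Z => inferInstanceAs (IsIso (eqToHom (e I Z)))
  exact ⟨asIso m⟩

/-- Both sides act in the same way on objects, so identities serve as components; only their
compatibility with the naturality isomorphisms has to be checked. -/
theorem nonempty_liftTrans_incl {E E' : Prederivator.{w,v,u}} {P : ∀ A, ObjectProperty (E.obj A)}
    {hP : ∀ {A B} (f : A ⟶ B) X, P A X → P B ((E.map f).toFunctor.obj X)}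
    {P' : ∀ A, ObjectProperty (E'.obj A)}
    {hP' : ∀ {A B} (f : A ⟶ B) X, P' A X → P' B ((E'.map f).toFunctor.obj X)}
    (σ : Mor E E') (hσ : ∀ A X, P A X → P' A ((σ.app A).toFunctor.obj X)) :
    Nonempty ((liftTrans σ hσ : Mor (E.fullSub P hP) (E'.fullSub P' hP')) ≫ incl E' P' hP' ≅
      incl E P hP ≫ σ) := by
  let m : (liftTrans σ hσ : Mor (E.fullSub P hP) (E'.fullSub P' hP')) ≫ incl E' P' hP' ⟶
      incl E P hP ≫ σ := mkHom (fun I Z => 𝟙 ((σ.app I).toFunctor.obj Z.obj))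
    (fun I {Z Z'} k => (Category.comp_id _).trans (Category.id_comp _).symm)
    (fun {I J} f Z => by
      have h₁ : ((natIso (incl E P hP) f Z).hom : ((E.map f).toFunctor.obj Z.obj ⟶ _)) = 𝟙 _ :=
        rfl
      have h₂ : ((natIso (incl E' P' hP') f (((liftTrans σ hσ : Mor (E.fullSub P hP)
          (E'.fullSub P' hP')).app I).toFunctor.obj Z)).hom :
          ((E'.map f).toFunctor.obj ((σ.app I).toFunctor.obj Z.obj) ⟶ _)) = 𝟙 _ :=
        rfl
      refine (Category.id_comp _).trans (Eq.trans ?_ ((congrArg (fun t => _ ≫ t)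
        (CategoryTheory.Functor.map_id _ _)).trans (Category.comp_id _)).symm)
      refine ((natIso_hom_comp (incl E P hP) σ f Z).trans ?_).trans (natIso_hom_comp
        (liftTrans σ hσ : Mor (E.fullSub P hP) (E'.fullSub P' hP')) (incl E' P' hP') f Z).symm
      refine Eq.trans ?_ ((congrArg (fun t => (natIso σ f Z.obj).hom ≫ t) h₂).trans
        (Category.comp_id _)).symm
      exact (congrArg (fun t => (σ.app J).toFunctor.map t ≫ (natIso σ f Z.obj).hom) h₁).trans
        ((congrArg (fun t => t ≫ (natIso σ f Z.obj).hom) (CategoryTheory.Functor.map_id _ _)).trans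
          (Category.id_comp _)))
  have : IsIso m := isIso_of_components _ fun I Z =>
    inferInstanceAs (IsIso (𝟙 ((σ.app I).toFunctor.obj Z.obj)))
  exact ⟨asIso m⟩

theorem res_sectL_shift_map {I J : Cat.{w,w}ᵒᵖ} (f : I ⟶ J) (j : J.unop) (X : (D.shift C).obj I) :
    (D.res (Prod.sectL C j)).obj (((D.shift C).map f).toFunctor.obj X) =
      (D.res (Prod.sectL C (f.unop.toFunctor.obj j))).obj X := by
  have h : Prod.sectL C j ⋙ (𝟭 C).prod f.unop.toFunctor = Prod.sectL C (f.unop.toFunctor.obj j) :=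
    CategoryTheory.Functor.ext (fun _ => rfl) fun _ _ _ => by
      refine _root_.eq_conj_eqToHom ?_ rfl rfl
      exact Prod.ext rfl (f.unop.toFunctor.map_id j)
  exact D.res_res_obj h X

/-- Being a left Kan extension with parameters is tested at each parameter separately, hence
survives restriction of parameters; this gives the base change needed to assemble the adjoints. -/
theorem IsDerivator.exists_leftAdjoint_resMor (hD : D.IsDerivator) (p : B ⥤ C) [p.Full]
    [p.Faithful] : ∃ L : Mor (D.shift B) (D.shift C), Nonempty (Bicategory.Adjunction L (D.resMor p)) := by
  have hL : ∀ I : Cat.{w,w}ᵒᵖ, ((D.resMor p).app I).toFunctor.IsRightAdjoint := fun I =>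
    hD.der3_left (p.prod (𝟭 I.unop))
  refine exists_leftAdjoint (D.resMor p) (fun I => ((D.resMor p).app I).toFunctor.leftAdjoint)
    (fun I => Adjunction.ofIsRightAdjoint _) (fun {I J} f X => ?_)
  let adj : _ ⊣ D.res (p.prod (𝟭 I.unop)) :=
    Adjunction.ofIsRightAdjoint ((D.resMor p).app I).toFunctor
  have hu : IsIso (adj.unit.app X) := hD.isIso_unit (p.prod (𝟭 I.unop)) adj X
  refine (isUniversalArrow_map_unit_comp_iff ((D.shift B).map f).toFunctor _ adj hu (natIso (D.resMor p) f _).symm).2 ?_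
  refine (hD.fullyFaithfulFrom_prod_iff p _).2 fun j => ?_
  rw [res_sectL_shift_map]
  exact (hD.fullyFaithfulFrom_prod_iff p _).1 (fullyFaithfulFrom_of_isIso_unit adj hu) _

theorem IsDerivator.exists_rightAdjoint_resMor (hD : D.IsDerivator) (p : B ⥤ C) [p.Full]
    [p.Faithful] : ∃ R : Mor (D.shift B) (D.shift C), Nonempty (Bicategory.Adjunction (D.resMor p) R) := by
  have hR : ∀ I : Cat.{w,w}ᵒᵖ, ((D.resMor p).app I).toFunctor.IsLeftAdjoint := fun I =>
    hD.der3_right (p.prod (𝟭 I.unop))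
  refine exists_rightAdjoint (D.resMor p) (fun I => ((D.resMor p).app I).toFunctor.rightAdjoint)
    (fun I => Adjunction.ofIsLeftAdjoint _) (fun {I J} f X => ?_)
  let adj : D.res (p.prod (𝟭 I.unop)) ⊣ _ :=
    Adjunction.ofIsLeftAdjoint ((D.resMor p).app I).toFunctor
  have hu : IsIso (adj.counit.app X) := hD.isIso_counit (p.prod (𝟭 I.unop)) adj X
  refine (isCouniversalArrow_comp_map_counit_iff ((D.shift B).map f).toFunctor _ adj hu (natIso (D.resMor p) f _)).2 ?_
  refine (hD.fullyFaithfulTo_prod_iff p _).2 fun j => ?_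
  rw [res_sectL_shift_map]
  exact (hD.fullyFaithfulTo_prod_iff p _).1 (fullyFaithfulTo_of_isIso_counit adj hu) _

end Restriction

end Prederivator

/-- This is transitivity of Kan extensions: bijections satisfy two out of three. -/
theorem fullyFaithfulFrom_comp_iff {C E E' : Type*} [Category* C] [Category* E] [Category* E']
    (F : C ⥤ E) (G : E ⥤ E') (X : C) (h : FullyFaithfulFrom G (F.obj X)) :
    FullyFaithfulFrom (F ⋙ G) X ↔ FullyFaithfulFrom F X :=
  forall_congr' fun Y => (h (F.obj Y)).of_comp_iff' fun f : X ⟶ Y => F.map f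

theorem fullyFaithfulTo_comp_iff {C E E' : Type*} [Category* C] [Category* E] [Category* E']
    (F : C ⥤ E) (G : E ⥤ E') (X : C) (h : FullyFaithfulTo G (F.obj X)) :
    FullyFaithfulTo (F ⋙ G) X ↔ FullyFaithfulTo F X :=
  forall_congr' fun Y => (h (F.obj Y)).of_comp_iff' fun f : Y ⟶ X => F.map f

/-! ### Posets as shapes: Galois connections and slices -/

namespace Pos

variable {α β γ : Type} [Preorder α] [Preorder β] [Preorder γ]

/-- The adjunction of posets given by a Galois connection. -/
def adj {l : α → β} {r : β → α} (gc : GaloisConnection l r) :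
    Pos.map.{w} l gc.monotone_l ⊣ Pos.map.{w} r gc.monotone_u :=
  GaloisConnection.adjunction (l := fun x : Pos.{w} α => (⟨l x.pt⟩ : Pos.{w} β))
    (u := fun x : Pos.{w} β => (⟨r x.pt⟩ : Pos.{w} α)) (fun x y => gc x.pt y.pt)

/-- The cocone on a monotone map given by an upper bound. -/
def cocone (f : β → α) (hf : Monotone f) (b : α) (hb : ∀ x, f x ≤ b) :
    Limits.Cocone (Pos.map.{w} f hf) where
  pt := ⟨b⟩
  ι :=
    { app x := homOfLE (hb x.pt)
      naturality _ _ _ := Subsingleton.elim _ _ }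

/-- The cone on a monotone map given by a lower bound. -/
def cone (f : β → α) (hf : Monotone f) (b : α) (hb : ∀ x, b ≤ f x) :
    Limits.Cone (Pos.map.{w} f hf) where
  pt := ⟨b⟩
  π :=
    { app x := homOfLE (hb x.pt)
      naturality _ _ _ := Subsingleton.elim _ _ }

theorem le_of_hom {x y : Pos.{w} α} (k : x ⟶ y) : x.pt ≤ y.pt :=
  show x ≤ y from leOfHom k

/-- The morphism given by an inequality. -/
def homOf {x y : Pos.{w} α} (h : x.pt ≤ y.pt) : x ⟶ y :=
  homOfLE (show x ≤ y from h)

/-- The slices of a monotone map are posets. -/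
def ofSlice (f : β → α) (hf : Monotone f) (b : α) :
    CostructuredArrow (Pos.map.{w} f hf) ⟨b⟩ ⥤ Pos.{w} {x // f x ≤ b} where
  obj x := ⟨⟨x.left.pt, le_of_hom x.hom⟩⟩
  map k := homOf (le_of_hom k.left)
  map_id _ := rfl
  map_comp _ _ := rfl

/-- The inverse of `Pos.ofSlice`. -/
def toSlice (f : β → α) (hf : Monotone f) (b : α) :
    Pos.{w} {x // f x ≤ b} ⥤ CostructuredArrow (Pos.map.{w} f hf) ⟨b⟩ where
  obj x := CostructuredArrow.mk (Y := (⟨x.pt.1⟩ : Pos.{w} β))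
    (show (Pos.map.{w} f hf).obj ⟨x.pt.1⟩ ⟶ ⟨b⟩ from homOf x.pt.2)
  map k := CostructuredArrow.homMk (homOf (le_of_hom k)) (Subsingleton.elim _ _)
  map_id _ := rfl
  map_comp _ _ := rfl

/-- `Pos.ofSlice` is left adjoint to its inverse. -/
def sliceAdj (f : β → α) (hf : Monotone f) (b : α) : ofSlice.{w} f hf b ⊣ toSlice f hf b :=
  Adjunction.mkOfHomEquiv
    { homEquiv _ _ :=
        { toFun k := CostructuredArrow.homMk (homOf (le_of_hom k)) (Subsingleton.elim _ _)
          invFun k := homOf (le_of_hom k.left)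
          left_inv _ := rfl
          right_inv _ := rfl }
      homEquiv_naturality_left_symm _ _ := rfl
      homEquiv_naturality_right _ _ := rfl }

/-- The coslices of a monotone map are posets. -/
def ofCoslice (f : β → α) (hf : Monotone f) (b : α) :
    StructuredArrow ⟨b⟩ (Pos.map.{w} f hf) ⥤ Pos.{w} {x // b ≤ f x} where
  obj x := ⟨⟨x.right.pt, le_of_hom x.hom⟩⟩
  map k := homOf (le_of_hom k.right)
  map_id _ := rfl
  map_comp _ _ := rfl

/-- The inverse of `Pos.ofCoslice`. -/
def toCoslice (f : β → α) (hf : Monotone f) (b : α) :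
    Pos.{w} {x // b ≤ f x} ⥤ StructuredArrow ⟨b⟩ (Pos.map.{w} f hf) where
  obj x := StructuredArrow.mk (Y := (⟨x.pt.1⟩ : Pos.{w} β))
    (show ⟨b⟩ ⟶ (Pos.map.{w} f hf).obj ⟨x.pt.1⟩ from homOf x.pt.2)
  map k := StructuredArrow.homMk (homOf (le_of_hom k)) (Subsingleton.elim _ _)
  map_id _ := rfl
  map_comp _ _ := rfl

/-- `Pos.ofCoslice` is right adjoint to its inverse. -/
def cosliceAdj (f : β → α) (hf : Monotone f) (b : α) : toCoslice.{w} f hf b ⊣ ofCoslice f hf b :=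
  Adjunction.mkOfHomEquiv
    { homEquiv _ _ :=
        { toFun k := homOf (le_of_hom k.right)
          invFun k := StructuredArrow.homMk (homOf (le_of_hom k)) (Subsingleton.elim _ _)
          left_inv _ := rfl
          right_inv _ := rfl }
      homEquiv_naturality_left_symm _ _ := rfl
      homEquiv_naturality_right _ _ := rfl }

/-- The inclusion of a subset. -/
def val (S : Set α) : Pos.{w} S ⥤ Pos.{w} α := Pos.map Subtype.val fun _ _ h => h

/-- The inclusion of a subset in another one. -/
def incl {S T : Set α} (h : S ⊆ T) : Pos.{w} S ⥤ Pos.{w} T := Pos.map (Set.inclusion h) fun _ _ h => h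

instance faithful_to_pos {C : Type*} [Category* C] [Quiver.IsThin C] (p : C ⥤ Pos.{w} α) : p.Faithful :=
  ⟨fun _ => Subsingleton.elim _ _⟩

theorem full_map {f : β → α} (hf : Monotone f) (h : ∀ x y, f x ≤ f y → x ≤ y) : (Pos.map.{w} f hf).Full :=
  ⟨fun k => ⟨homOf (h _ _ (le_of_hom k)), Subsingleton.elim _ _⟩⟩

instance full_val_map (p : α → Prop) :
    (Pos.map.{w} (Subtype.val : {x // p x} → α) (fun _ _ h => h)).Full := full_map _ fun _ _ h => h

instance full_val (S : Set α) : (Pos.val.{w} S).Full := full_map _ fun _ _ h => h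

instance full_incl {S T : Set α} (h : S ⊆ T) : (Pos.incl.{w} h).Full := full_map _ fun _ _ h => h

end Pos

/-! ### Kan extensions between subsets of a poset -/

namespace Prederivator

section Posets

variable {D : Prederivator.{w,v,u}} {α β γ : Type} [Preorder α] [Preorder β] [Preorder γ]

theorem isColimAt_cocone_iff {l : β → γ} {r : γ → β} (gc : GaloisConnection l r) (f : β → α)
    (hf : Monotone f) (b : α) (hb : ∀ x, f x ≤ b) (X : D.Diag (Pos.{w} α)) :
    D.IsColimAt (Pos.cocone.{w} (f ∘ r) (hf.comp gc.monotone_u) b (fun _ => hb _)) X ↔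
      D.IsColimAt (Pos.cocone.{w} f hf b hb) X :=
  D.isColimAt_whisker_iff (Pos.cocone.{w} f hf b hb) (Pos.adj gc) X

theorem isLimAt_cone_iff {l : γ → β} {r : β → γ} (gc : GaloisConnection l r) (f : β → α)
    (hf : Monotone f) (b : α) (hb : ∀ x, b ≤ f x) (X : D.Diag (Pos.{w} α)) :
    D.IsLimAt (Pos.cone.{w} (f ∘ l) (hf.comp gc.monotone_l) b (fun _ => hb _)) X ↔
      D.IsLimAt (Pos.cone.{w} f hf b hb) X :=
  D.isLimAt_whisker_iff (Pos.cone.{w} f hf b hb) (Pos.adj gc) X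

/-- The slices of a monotone map are equivalent to posets, and the auxiliary g allows the conditions
to be read off in a larger ambient poset. -/
theorem IsDerivator.fullyFaithfulFrom_pos_iff (hD : D.IsDerivator) (f : β → γ) (hf : Monotone f) (g : γ → α)
    (hg : Monotone g) (X : D.Diag (Pos.{w} α)) :
    FullyFaithfulFrom (D.res (Pos.map.{w} f hf)) ((D.res (Pos.map.{w} g hg)).obj X) ↔
      ∀ c, D.IsColimAt (Pos.cocone.{w} (fun x : {x // f x ≤ c} => g (f x.1)) (fun _ _ h => hg (hf h)) (g c)
        (fun x => hg x.2)) X := by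
  rw [hD.fullyFaithfulFrom_iff]
  refine ⟨fun h c => ?_, fun h c => ?_⟩
  · have := h ⟨c⟩
    rw [isColimAt_res_iff, ← D.isColimAt_whisker_iff _ (Pos.sliceAdj f hf c)] at this
    exact this
  · have := h c.pt
    rw [isColimAt_res_iff, ← D.isColimAt_whisker_iff _ (Pos.sliceAdj f hf c.pt)]
    exact this

theorem IsDerivator.fullyFaithfulTo_pos_iff (hD : D.IsDerivator) (f : β → γ) (hf : Monotone f) (g : γ → α)
    (hg : Monotone g) (X : D.Diag (Pos.{w} α)) :
    FullyFaithfulTo (D.res (Pos.map.{w} f hf)) ((D.res (Pos.map.{w} g hg)).obj X) ↔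
      ∀ c, D.IsLimAt (Pos.cone.{w} (fun x : {x // c ≤ f x} => g (f x.1)) (fun _ _ h => hg (hf h)) (g c)
        (fun x => hg x.2)) X := by
  rw [hD.fullyFaithfulTo_iff]
  refine ⟨fun h c => ?_, fun h c => ?_⟩
  · have := h ⟨c⟩
    rw [isLimAt_res_iff, ← D.isLimAt_whisker_iff _ (Pos.cosliceAdj f hf c)] at this
    exact this
  · have := h c.pt
    rw [isLimAt_res_iff, ← D.isLimAt_whisker_iff _ (Pos.cosliceAdj f hf c.pt)]
    exact this

theorem isColimAt_cocone_of_isGreatest (f : β → α) (hf : Monotone f) (b : α) (hb : ∀ x, f x ≤ b) (t : β)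
    (ht : ∀ x, x ≤ t) (hbt : b ≤ f t) (X : D.Diag (Pos.{w} α)) :
    D.IsColimAt (Pos.cocone.{w} f hf b hb) X := by
  have : IsIso ((Pos.cocone.{w} f hf b hb).ι.app ⟨t⟩) :=
    ⟨Pos.homOf hbt, Subsingleton.elim _ _, Subsingleton.elim _ _⟩
  exact isColimAt_of_isTerminal _ (⟨t⟩ : Pos.{w} β)
    (Limits.IsTerminal.ofUniqueHom (fun x => Pos.homOf (ht x.pt)) fun _ _ => Subsingleton.elim _ _) X

theorem isLimAt_cone_of_isLeast (f : β → α) (hf : Monotone f) (b : α) (hb : ∀ x, b ≤ f x) (t : β)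
    (ht : ∀ x, t ≤ x) (hbt : f t ≤ b) (X : D.Diag (Pos.{w} α)) :
    D.IsLimAt (Pos.cone.{w} f hf b hb) X := by
  have : IsIso ((Pos.cone.{w} f hf b hb).π.app ⟨t⟩) :=
    ⟨Pos.homOf hbt, Subsingleton.elim _ _, Subsingleton.elim _ _⟩
  exact isLimAt_of_isInitial _ (⟨t⟩ : Pos.{w} β)
    (Limits.IsInitial.ofUniqueHom (fun x => Pos.homOf (ht x.pt)) fun _ _ => Subsingleton.elim _ _) X

variable (D) in
/-- The value of `X` at `b` is the colimit of `X` over the elements of `S` below `b`. -/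
def ColimOn (S : Set α) (b : α) (X : D.Diag (Pos.{w} α)) : Prop :=
  D.IsColimAt (Pos.cocone.{w} (fun x : {x // x ∈ S ∧ x ≤ b} => x.1) (fun _ _ h => h) b fun x => x.2.2) X

variable (D) in
/-- The value of `X` at `b` is the limit of `X` over the elements of `S` above `b`. -/
def LimOn (S : Set α) (b : α) (X : D.Diag (Pos.{w} α)) : Prop :=
  D.IsLimAt (Pos.cone.{w} (fun x : {x // x ∈ S ∧ b ≤ x} => x.1) (fun _ _ h => h) b fun x => x.2.2) X

theorem colimOn_of_mem {S : Set α} {b : α} (hb : b ∈ S) (X : D.Diag (Pos.{w} α)) : D.ColimOn S b X :=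
  isColimAt_cocone_of_isGreatest _ _ b _ ⟨b, hb, le_rfl⟩ (fun x => x.2.2) le_rfl X

theorem limOn_of_mem {S : Set α} {b : α} (hb : b ∈ S) (X : D.Diag (Pos.{w} α)) : D.LimOn S b X :=
  isLimAt_cone_of_isLeast _ _ b _ ⟨b, hb, le_rfl⟩ (fun x => x.2.2) le_rfl X

theorem IsDerivator.colimOn_iff_isZero (hD : D.IsDerivator) (h0 : Limits.HasZeroObject (D.Diag One.{w}))
    {S : Set α} {b : α} (h : ∀ x ∈ S, ¬ x ≤ b) (X : D.Diag (Pos.{w} α)) :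
    D.ColimOn S b X ↔ Limits.IsZero ((D.ev (⟨b⟩ : Pos.{w} α)).obj X) := by
  have : IsEmpty (Pos.{w} {x // x ∈ S ∧ x ≤ b}) := ⟨fun x => h _ x.pt.2.1 x.pt.2.2⟩
  exact hD.isColimAt_iff_isZero h0 _ X

theorem IsDerivator.limOn_iff_isZero (hD : D.IsDerivator) (h0 : Limits.HasZeroObject (D.Diag One.{w}))
    {S : Set α} {b : α} (h : ∀ x ∈ S, ¬ b ≤ x) (X : D.Diag (Pos.{w} α)) :
    D.LimOn S b X ↔ Limits.IsZero ((D.ev (⟨b⟩ : Pos.{w} α)).obj X) := by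
  have : IsEmpty (Pos.{w} {x // x ∈ S ∧ b ≤ x}) := ⟨fun x => h _ x.pt.2.1 x.pt.2.2⟩
  exact hD.isLimAt_iff_isZero h0 _ X

/-- Translates the predicate `ColimOn` for all points of T into one statement: X on T is the left
Kan extension of X on S. The slice of the inclusion at b is the set of elements of S below b. -/
theorem IsDerivator.fullyFaithfulFrom_incl_iff (hD : D.IsDerivator) {S T : Set α} (h : S ⊆ T)
    (X : D.Diag (Pos.{w} α)) :
    FullyFaithfulFrom (D.res (Pos.incl.{w} h)) ((D.res (Pos.val.{w} T)).obj X) ↔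
      ∀ b ∈ T, D.ColimOn S b X := by
  refine (hD.fullyFaithfulFrom_pos_iff _ _ _ _ X).trans
    (Subtype.forall.trans (forall₂_congr fun b hb => ?_))
  exact isColimAt_cocone_iff
    (l := fun x : {x // x ∈ S ∧ x ≤ b} => (⟨⟨x.1, x.2.1⟩, x.2.2⟩ : {x : S // Set.inclusion h x ≤ ⟨b, hb⟩}))
    (r := fun x => ⟨x.1.1, x.1.2, x.2⟩) (fun _ _ => Iff.rfl) (fun x : {x // x ∈ S ∧ x ≤ b} => x.1)
    (fun _ _ h => h) b (fun x => x.2.2) X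

theorem IsDerivator.fullyFaithfulTo_incl_iff (hD : D.IsDerivator) {S T : Set α} (h : S ⊆ T)
    (X : D.Diag (Pos.{w} α)) :
    FullyFaithfulTo (D.res (Pos.incl.{w} h)) ((D.res (Pos.val.{w} T)).obj X) ↔
      ∀ b ∈ T, D.LimOn S b X := by
  refine (hD.fullyFaithfulTo_pos_iff _ _ _ _ X).trans
    (Subtype.forall.trans (forall₂_congr fun b hb => ?_))
  exact isLimAt_cone_iff
    (r := fun x : {x // x ∈ S ∧ b ≤ x} => (⟨⟨x.1, x.2.1⟩, x.2.2⟩ : {x : S // ⟨b, hb⟩ ≤ Set.inclusion h x}))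
    (l := fun x => ⟨x.1.1, x.1.2, x.2⟩) (fun _ _ => Iff.rfl) (fun x : {x // x ∈ S ∧ b ≤ x} => x.1)
    (fun _ _ h => h) b (fun x => x.2.2) X

/-- Restriction from U to S factors through T, so this is transitivity of Kan extensions written
pointwise. -/
theorem IsDerivator.forall_colimOn_iff (hD : D.IsDerivator) {S T U : Set α} (h : S ⊆ T) (h' : T ⊆ U)
    {X : D.Diag (Pos.{w} α)} (hX : ∀ b ∈ T, D.ColimOn S b X) :
    (∀ b ∈ U, D.ColimOn S b X) ↔ ∀ b ∈ U, D.ColimOn T b X := by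
  rw [← hD.fullyFaithfulFrom_incl_iff (h.trans h'), ← hD.fullyFaithfulFrom_incl_iff h']
  rw [← hD.fullyFaithfulFrom_incl_iff h] at hX
  have h₁ : D.res (Pos.incl.{w} (h.trans h')) = D.res (Pos.incl.{w} h') ⋙ D.res (Pos.incl.{w} h) :=
    D.res_comp (Pos.incl.{w} h) (Pos.incl.{w} h')
  have h₂ : (D.res (Pos.val.{w} T)).obj X = (D.res (Pos.incl.{w} h')).obj ((D.res (Pos.val.{w} U)).obj X) :=
    D.res_comp_obj (Pos.incl.{w} h') (Pos.val.{w} U) X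
  rw [h₁]
  exact fullyFaithfulFrom_comp_iff _ _ _ (h₂ ▸ hX)

theorem IsDerivator.forall_limOn_iff (hD : D.IsDerivator) {S T U : Set α} (h : S ⊆ T) (h' : T ⊆ U)
    {X : D.Diag (Pos.{w} α)} (hX : ∀ b ∈ T, D.LimOn S b X) :
    (∀ b ∈ U, D.LimOn S b X) ↔ ∀ b ∈ U, D.LimOn T b X := by
  rw [← hD.fullyFaithfulTo_incl_iff (h.trans h'), ← hD.fullyFaithfulTo_incl_iff h']
  rw [← hD.fullyFaithfulTo_incl_iff h] at hX
  have h₁ : D.res (Pos.incl.{w} (h.trans h')) = D.res (Pos.incl.{w} h') ⋙ D.res (Pos.incl.{w} h) :=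
    D.res_comp (Pos.incl.{w} h) (Pos.incl.{w} h')
  have h₂ : (D.res (Pos.val.{w} T)).obj X = (D.res (Pos.incl.{w} h')).obj ((D.res (Pos.val.{w} U)).obj X) :=
    D.res_comp_obj (Pos.incl.{w} h') (Pos.val.{w} U) X
  rw [h₁]
  exact fullyFaithfulTo_comp_iff _ _ _ (h₂ ▸ hX)

/-- A left Kan extension can be performed one level at a time. -/
theorem IsDerivator.forall_colimOn_iff_of_height (hD : D.IsDerivator) {S U : Set α} (hSU : S ⊆ U)
    (h : α → ℤ) (m : ℤ) (hm : ∀ x ∈ U, x ∉ S → m ≤ h x) (X : D.Diag (Pos.{w} α)) :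
    (∀ b ∈ U, D.ColimOn S b X) ↔
      ∀ b ∈ U, b ∉ S → D.ColimOn (S ∪ {x | x ∈ U ∧ h x < h b}) b X := by
  have hsub : ∀ k : ℤ, S ∪ {x | x ∈ U ∧ h x < k} ⊆ U := fun k =>
    Set.union_subset hSU fun x hx => hx.1
  constructor
  · intro hX b hb _
    exact (hD.forall_colimOn_iff Set.subset_union_left (hsub (h b))
      (fun x hx => hX x (hsub _ hx))).1 hX b hb
  · intro hX
    -- For k = 0 the set is S, because m bounds the heights outside S from below. Each further step
    -- adds one level, and there transitivity trades the set S for everything strictly lower.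
    have key : ∀ k : ℕ, ∀ b ∈ S ∪ {x | x ∈ U ∧ h x < m + k}, D.ColimOn S b X := by
      intro k
      induction k with
      | zero =>
        rintro b (hb | ⟨hb, hb'⟩)
        · exact colimOn_of_mem hb X
        · by_cases hS : b ∈ S
          · exact colimOn_of_mem hS X
          · exact absurd (hm b hb hS) (by simpa using hb')
      | succ k ih =>
        have hk : S ∪ {x | x ∈ U ∧ h x < m + k} ⊆ S ∪ {x | x ∈ U ∧ h x < m + (k + 1 : ℕ)} :=
          Set.union_subset_union_right S fun x hx => ⟨hx.1, hx.2.trans (by push_cast; omega)⟩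
        refine (hD.forall_colimOn_iff Set.subset_union_left hk ih).2 fun b hb => ?_
        · by_cases hb' : b ∈ S ∪ {x | x ∈ U ∧ h x < m + k}
          · exact colimOn_of_mem hb' X
          · have hbS : b ∉ S := fun h => hb' (Or.inl h)
            have hbU : b ∈ U := hsub _ hb
            have h₁ : ¬ h b < m + k := fun h => hb' (Or.inr ⟨hbU, h⟩)
            have h₂ : h b < m + (k + 1 : ℕ) := (hb.resolve_left hbS).2
            have h₃ : m + k = h b := by push_cast at h₂; omega
            rw [h₃]
            exact hX b hbU hbS
    intro b hb
    by_cases hS : b ∈ S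
    · exact colimOn_of_mem hS X
    -- The extra 1 is needed because the levels are cut off by a strict inequality.
    · refine key (h b - m + 1).toNat b (Or.inr ⟨hb, ?_⟩)
      have := hm b hb hS
      omega

/-- A right Kan extension can be performed one level at a time. -/
theorem IsDerivator.forall_limOn_iff_of_height (hD : D.IsDerivator) {S U : Set α} (hSU : S ⊆ U)
    (h : α → ℤ) (m : ℤ) (hm : ∀ x ∈ U, x ∉ S → h x ≤ m) (X : D.Diag (Pos.{w} α)) :
    (∀ b ∈ U, D.LimOn S b X) ↔
      ∀ b ∈ U, b ∉ S → D.LimOn (S ∪ {x | x ∈ U ∧ h b < h x}) b X := by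
  have hsub : ∀ k : ℤ, S ∪ {x | x ∈ U ∧ k < h x} ⊆ U := fun k =>
    Set.union_subset hSU fun x hx => hx.1
  constructor
  · intro hX b hb _
    exact (hD.forall_limOn_iff Set.subset_union_left (hsub (h b))
      (fun x hx => hX x (hsub _ hx))).1 hX b hb
  · intro hX
    have key : ∀ k : ℕ, ∀ b ∈ S ∪ {x | x ∈ U ∧ m - k < h x}, D.LimOn S b X := by
      intro k
      induction k with
      | zero =>
        rintro b (hb | ⟨hb, hb'⟩)
        · exact limOn_of_mem hb X
        · by_cases hS : b ∈ S
          · exact limOn_of_mem hS X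
          · exact absurd (hm b hb hS) (by simpa using hb')
      | succ k ih =>
        have hk : S ∪ {x | x ∈ U ∧ m - k < h x} ⊆ S ∪ {x | x ∈ U ∧ m - (k + 1 : ℕ) < h x} :=
          Set.union_subset_union_right S fun x hx => ⟨hx.1, lt_trans (by push_cast; omega) hx.2⟩
        refine (hD.forall_limOn_iff Set.subset_union_left hk ih).2 fun b hb => ?_
        · by_cases hb' : b ∈ S ∪ {x | x ∈ U ∧ m - k < h x}
          · exact limOn_of_mem hb' X
          · have hbS : b ∉ S := fun h => hb' (Or.inl h)
            have hbU : b ∈ U := hsub _ hb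
            have h₁ : ¬ m - k < h b := fun h => hb' (Or.inr ⟨hbU, h⟩)
            have h₂ : m - (k + 1 : ℕ) < h b := (hb.resolve_left hbS).2
            have h₃ : m - k = h b := by push_cast at h₂; omega
            rw [h₃]
            exact hX b hbU hbS
    intro b hb
    by_cases hS : b ∈ S
    · exact limOn_of_mem hS X
    · refine key (m - h b + 1).toNat b (Or.inr ⟨hb, ?_⟩)
      have := hm b hb hS
      omega

/-- The extension along the full inclusion of the corner has invertible unit, so its essential image
consists of the squares with invertible counit. -/
theorem IsDerivator.isCocartesian_iff (hD : D.IsDerivator) (X : D.Diag (Pos.{w} Sq)) :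
    D.IsCocartesian X ↔
      FullyFaithfulFrom (D.res (Pos.map.{w} (Subtype.val : SqUL → Sq) (fun _ _ h => h))) X := by
  constructor
  · rintro ⟨L, ⟨adj⟩, Z, ⟨e⟩⟩
    exact FullyFaithfulFrom.of_iso e (fullyFaithfulFrom_of_isIso_unit adj (hD.isIso_unit _ adj Z))
  · intro h
    have := hD.der3_left (Pos.map.{w} (Subtype.val : SqUL → Sq) (fun _ _ h => h))
    have adj := Adjunction.ofIsRightAdjoint (D.res (Pos.map.{w} (Subtype.val : SqUL → Sq) (fun _ _ h => h)))
    have h1 := (fullyFaithfulFrom_iff_isIso_counit adj X).1 h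
    exact ⟨_, ⟨adj⟩, _, ⟨asIso (adj.counit.app X)⟩⟩

theorem IsDerivator.isCartesian_iff (hD : D.IsDerivator) (X : D.Diag (Pos.{w} Sq)) :
    D.IsCartesian X ↔
      FullyFaithfulTo (D.res (Pos.map.{w} (Subtype.val : SqLR → Sq) (fun _ _ h => h))) X := by
  constructor
  · rintro ⟨R, ⟨adj⟩, Z, ⟨e⟩⟩
    exact FullyFaithfulTo.of_iso e (fullyFaithfulTo_of_isIso_counit adj (hD.isIso_counit _ adj Z))
  · intro h
    have := hD.der3_right (Pos.map.{w} (Subtype.val : SqLR → Sq) (fun _ _ h => h))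
    have adj := Adjunction.ofIsLeftAdjoint (D.res (Pos.map.{w} (Subtype.val : SqLR → Sq) (fun _ _ h => h)))
    have h1 := (fullyFaithfulTo_iff_isIso_unit adj X).1 h
    exact ⟨_, ⟨adj⟩, _, ⟨(asIso (adj.unit.app X)).symm⟩⟩

/-- The hypotheses make the punctured square final among the elements of S below the tip: each such
element has a least corner above it, which defines a left adjoint to the inclusion of the three
corners. -/
theorem IsDerivator.colimOn_iff_isCocartesian (hD : D.IsDerivator) (sq : Sq → α) (hsq : Monotone sq)
    (S : Set α) (hS : ∀ s, s ≠ (1, 1) → sq s ∈ S)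
    (h₁ : ∀ x ∈ S, x ≤ sq (1, 1) → x ≤ sq (1, 0) ∨ x ≤ sq (0, 1))
    (h₂ : ∀ x ∈ S, x ≤ sq (1, 0) → x ≤ sq (0, 1) → x ≤ sq (0, 0)) (X : D.Diag (Pos.{w} α)) :
    D.ColimOn S (sq (1, 1)) X ↔ D.IsCocartesian ((D.res (Pos.map.{w} sq hsq)).obj X) := by
  classical
  refine Iff.trans ?_ ((hD.isCocartesian_iff _).trans (hD.fullyFaithfulFrom_pos_iff _ _ sq hsq X)).symm
  let r : {x : SqUL // x.1 ≤ (1, 1)} → {x // x ∈ S ∧ x ≤ sq (1, 1)} :=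
    fun x => ⟨sq x.1.1, hS _ x.1.2, hsq x.2⟩
  -- The least corner above x; the last case is (0, 1) because x lies below one of the two middle
  -- corners.
  let l : {x // x ∈ S ∧ x ≤ sq (1, 1)} → {x : SqUL // x.1 ≤ (1, 1)} := fun x =>
    if x.1 ≤ sq (0, 0) then ⟨⟨(0, 0), by decide⟩, by decide⟩ else
      if x.1 ≤ sq (1, 0) then ⟨⟨(1, 0), by decide⟩, by decide⟩ else ⟨⟨(0, 1), by decide⟩, by decide⟩
  have gc : GaloisConnection l r := by
    rintro ⟨x, hx, hx'⟩ ⟨⟨s, hs⟩, hs'⟩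
    have h00 : ∀ t, x ≤ sq (0, 0) → x ≤ sq t := fun t h => h.trans (hsq ⟨Fin.zero_le _, Fin.zero_le _⟩)
    have h12 := h₁ x hx hx'
    have h22 := h₂ x hx
    change (l ⟨x, hx, hx'⟩).1.1 ≤ s ↔ x ≤ sq s
    simp only [l]
    split_ifs with ha hb
    · exact ⟨fun _ => h00 _ ha, fun _ => ⟨Fin.zero_le _, Fin.zero_le _⟩⟩
    · constructor
      · exact fun h => hb.trans (hsq h)
      · intro h
        obtain ⟨i, j⟩ := s
        fin_cases i <;> fin_cases j
        · exact absurd h ha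
        · exact absurd (h22 hb h) ha
        · exact le_rfl
        · exact absurd rfl hs
    · have hc := h12.resolve_left hb
      constructor
      · exact fun h => hc.trans (hsq h)
      · intro h
        obtain ⟨i, j⟩ := s
        fin_cases i <;> fin_cases j
        · exact absurd h ha
        · exact le_rfl
        · exact absurd h hb
        · exact absurd rfl hs
  have key := isColimAt_cocone_iff gc (fun x : {x // x ∈ S ∧ x ≤ sq (1, 1)} => x.1)
    (fun _ _ h => h) (sq (1, 1)) (fun x => x.2.2) X
  refine ⟨fun h c => ?_, fun h => key.1 (h (1, 1))⟩
  -- At the other corners the condition is vacuous, as the corner itself belongs to its slice.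
  by_cases hc : c = (1, 1)
  · subst hc
    exact key.2 h
  · exact isColimAt_cocone_of_isGreatest (fun x : {x : SqUL // x.1 ≤ c} => sq x.1.1) _ _ _
      ⟨⟨c, hc⟩, le_rfl⟩ (fun x => x.2) le_rfl X

theorem IsDerivator.limOn_iff_isCartesian (hD : D.IsDerivator) (sq : Sq → α) (hsq : Monotone sq)
    (S : Set α) (hS : ∀ s, s ≠ (0, 0) → sq s ∈ S)
    (h₁ : ∀ x ∈ S, sq (0, 0) ≤ x → sq (1, 0) ≤ x ∨ sq (0, 1) ≤ x)
    (h₂ : ∀ x ∈ S, sq (1, 0) ≤ x → sq (0, 1) ≤ x → sq (1, 1) ≤ x) (X : D.Diag (Pos.{w} α)) :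
    D.LimOn S (sq (0, 0)) X ↔ D.IsCartesian ((D.res (Pos.map.{w} sq hsq)).obj X) := by
  classical
  refine Iff.trans ?_ ((hD.isCartesian_iff _).trans (hD.fullyFaithfulTo_pos_iff _ _ sq hsq X)).symm
  let l : {x : SqLR // (0, 0) ≤ x.1} → {x // x ∈ S ∧ sq (0, 0) ≤ x} :=
    fun x => ⟨sq x.1.1, hS _ x.1.2, hsq x.2⟩
  let r : {x // x ∈ S ∧ sq (0, 0) ≤ x} → {x : SqLR // (0, 0) ≤ x.1} := fun x =>
    if sq (1, 1) ≤ x.1 then ⟨⟨(1, 1), by decide⟩, by decide⟩ else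
      if sq (1, 0) ≤ x.1 then ⟨⟨(1, 0), by decide⟩, by decide⟩ else ⟨⟨(0, 1), by decide⟩, by decide⟩
  have gc : GaloisConnection l r := by
    rintro ⟨⟨s, hs⟩, hs'⟩ ⟨x, hx, hx'⟩
    have h11 : ∀ t, sq (1, 1) ≤ x → sq t ≤ x := fun t h => (hsq ⟨Fin.le_last _, Fin.le_last _⟩).trans h
    have h12 := h₁ x hx hx'
    have h22 := h₂ x hx
    change sq s ≤ x ↔ s ≤ (r ⟨x, hx, hx'⟩).1.1
    simp only [r]
    split_ifs with ha hb
    · exact ⟨fun _ => ⟨Fin.le_last _, Fin.le_last _⟩, fun _ => h11 _ ha⟩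
    · constructor
      · intro h
        obtain ⟨i, j⟩ := s
        fin_cases i <;> fin_cases j
        · exact absurd rfl hs
        · exact absurd (h22 hb h) ha
        · exact le_rfl
        · exact absurd h ha
      · exact fun h => (hsq h).trans hb
    · have hc := h12.resolve_left hb
      constructor
      · intro h
        obtain ⟨i, j⟩ := s
        fin_cases i <;> fin_cases j
        · exact absurd rfl hs
        · exact le_rfl
        · exact absurd h hb
        · exact absurd h ha
      · exact fun h => (hsq h).trans hc
  have key := isLimAt_cone_iff gc (fun x : {x // x ∈ S ∧ sq (0, 0) ≤ x} => x.1)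
    (fun _ _ h => h) (sq (0, 0)) (fun x => x.2.2) X
  refine ⟨fun h c => ?_, fun h => key.1 (h (0, 0))⟩
  by_cases hc : c = (0, 0)
  · subst hc
    exact key.2 h
  · exact isLimAt_cone_of_isLeast (fun x : {x : SqLR // c ≤ x.1} => sq x.1.1) _ _ _
      ⟨⟨c, hc⟩, le_rfl⟩ (fun x => x.2) le_rfl X

end Posets

end Prederivator

/-! ### The order of the mesh category, and sections -/

namespace MeshPt

variable {n : ℕ}

/-- The height of a vertex of the mesh category. -/
def ht (x : MeshPt n) : ℤ := 2 * x.k + x.l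

/-- Each generating arrow raises exactly one of the coordinates k and k + l by one. Conversely,
induction on the difference of heights builds a path between comparable points that stays in the
strip 0 ≤ l ≤ n + 1. -/
theorem le_iff {x y : MeshPt n} : x ≤ y ↔ x.k ≤ y.k ∧ x.k + x.l ≤ y.k + y.l := by
  constructor
  · intro h
    induction h with
    | refl => exact ⟨le_rfl, le_rfl⟩
    | tail _ h ih =>
      rcases h with ⟨h₁, h₂⟩ | ⟨h₁, h₂⟩ <;> unfold linArrow at h₂ <;> omega
  · rintro ⟨h₁, h₂⟩
    obtain ⟨m, hm⟩ : ∃ m : ℕ, (m : ℤ) = y.ht - x.ht := ⟨(y.ht - x.ht).toNat, by unfold ht; omega⟩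
    unfold ht at hm
    induction m generalizing x with
    | zero =>
      have : x = y := MeshPt.ext (by omega) (by omega)
      rw [this]
    | succ m ih =>
      have hx := x.le
      have hy := y.le
      push_cast at hm
      -- Raising k lowers the level, so it is done only if the level allows it. Otherwise either k
      -- is already final or the level is 0, and raising the level neither overshoots y nor leaves
      -- the strip.
      by_cases h : x.k < y.k ∧ 1 ≤ x.l
      · refine (Mesh.le_of_arrow (y := ⟨x.k + 1, x.l - 1, by omega⟩) (Or.inr ⟨rfl, ?_⟩)).trans
          (ih ?_ ?_ ?_)
        · change x.l = x.l - 1 + 1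
          omega
        all_goals (dsimp only; push_cast [h.2]; omega)
      · refine (Mesh.le_of_arrow (x := x) (y := ⟨x.k, x.l + 1, by omega⟩) (Or.inl ⟨rfl, ?_⟩)).trans
          (ih ?_ ?_ ?_)
        · change x.l + 1 = x.l + 1
          rfl
        all_goals (dsimp only; push_cast; omega)

end MeshPt

/-- A section of the mesh category: a height at each level, neighbouring heights differing by one, with
peaks at the boundary. -/
structure IsSection (n : ℕ) (σ : ℕ → ℤ) : Prop where
  step : ∀ l, l ≤ n → σ (l + 1) = σ l + 1 ∨ σ l = σ (l + 1) + 1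
  bot : σ 0 = σ 1 + 1
  top : σ (n + 1) = σ n + 1
  parity : ∃ k : ℤ, σ 0 = 2 * k

namespace IsSection

variable {n : ℕ} {σ : ℕ → ℤ}

theorem lipschitz (hσ : IsSection n σ) {l m : ℕ} (h : l ≤ m) (hm : m ≤ n + 1) : σ m - σ l ≤ m - l ∧ σ l - σ m ≤ m - l := by
  induction m, h using Nat.le_induction with
  | base => simp
  | succ m h ih =>
    have := ih (by omega)
    have := hσ.step m (by omega)
    push_cast
    omega

/-- The height of a vertex has the parity of its level. So a section runs through actual vertices,
and a vertex strictly above it is at least two units above. -/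
theorem even (hσ : IsSection n σ) {l : ℕ} (hl : l ≤ n + 1) : ∃ k : ℤ, σ l = 2 * k + l := by
  induction l with
  | zero => simpa using hσ.parity
  | succ l ih =>
    obtain ⟨k, hk⟩ := ih (by omega)
    rcases hσ.step l (by omega) with h | h
    · exact ⟨k, by push_cast; omega⟩
    · exact ⟨k - 1, by push_cast; omega⟩

end IsSection

namespace MeshPt

variable {n : ℕ}

/-- The vertices on the boundary. -/
def Bdry (x : MeshPt n) : Prop := x.l = 0 ∨ x.l = n + 1

/-- The vertices on a section. -/
def onSec (n : ℕ) (σ : ℕ → ℤ) : Set (MeshPt n) := {x | ¬ x.Bdry ∧ x.ht = σ x.l}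

/-- The vertices above a section. -/
def aboveSec (n : ℕ) (σ : ℕ → ℤ) : Set (MeshPt n) := {x | σ x.l ≤ x.ht}

/-- The vertices on a section and the boundary above it. -/
def onSecBdry (n : ℕ) (σ : ℕ → ℤ) : Set (MeshPt n) := onSec n σ ∪ {x | x ∈ aboveSec n σ ∧ x.Bdry}

/-- The vertices above a section and the boundary. -/
def aboveSecBdry (n : ℕ) (σ : ℕ → ℤ) : Set (MeshPt n) := aboveSec n σ ∪ {x | x.Bdry}

end MeshPt

/-! ### Exactness on the mesh category via a section -/

namespace Prederivator

variable {D : Prederivator.{w,v,u}} {n : ℕ} {σ : ℕ → ℤ}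

open MeshPt

/-- A boundary vertex on or above the section is below no interior vertex of the section, so the
limits concerned are empty and the extension is by zero. This is where the peaks at the boundary are
needed: heights of the section grow too slowly from there. -/
theorem IsStableDerivator.forall_limOn_onSecBdry_iff (hD : D.IsStableDerivator) (hσ : IsSection n σ)
    (X : D.Diag (Mesh.{w} n)) :
    (∀ b ∈ onSecBdry n σ, D.LimOn (onSec n σ) b X) ↔
      ∀ b ∈ aboveSec n σ, b.Bdry → Limits.IsZero ((D.ev (⟨b⟩ : Mesh.{w} n)).obj X) := by
  have key : ∀ b ∈ aboveSec n σ, b.Bdry → ∀ x ∈ onSec n σ, ¬ b ≤ x := by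
    rintro b hb hb' x ⟨hx, hx'⟩ h
    rw [MeshPt.le_iff] at h
    have hl := x.le
    have h1 := hσ.bot
    have h2 := hσ.top
    unfold MeshPt.Bdry at hx hb'
    have h3 := hσ.lipschitz (l := 1) (m := x.l) (by omega) hl
    have h4 := hσ.lipschitz (l := x.l) (m := n) (by omega) (by omega)
    change σ b.l ≤ b.ht at hb
    unfold MeshPt.ht at hb hx'
    rcases hb' with h5 | h5 <;> rw [h5] at hb h <;> push_cast at * <;> omega
  constructor
  · intro h b hb hb'
    exact (hD.limOn_iff_isZero hD.pointed (key b hb hb') X).1 (h b (Or.inr ⟨hb, hb'⟩))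
  · rintro h b (hb | ⟨hb, hb'⟩)
    · exact limOn_of_mem hb X
    · exact (hD.limOn_iff_isZero hD.pointed (key b hb hb') X).2 (h b hb hb')

/-- The region above a section is closed upwards, so a boundary vertex outside it has nothing of
that region below it and the colimits concerned are empty. -/
theorem IsStableDerivator.forall_colimOn_aboveSecBdry_iff (hD : D.IsStableDerivator) (hσ : IsSection n σ)
    (X : D.Diag (Mesh.{w} n)) :
    (∀ b ∈ aboveSecBdry n σ, D.ColimOn (aboveSec n σ) b X) ↔
      ∀ b ∉ aboveSec n σ, b.Bdry → Limits.IsZero ((D.ev (⟨b⟩ : Mesh.{w} n)).obj X) := by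
  have key : ∀ b ∉ aboveSec n σ, b.Bdry → ∀ x ∈ aboveSec n σ, ¬ x ≤ b := by
    rintro b hb hb' x hx h
    rw [MeshPt.le_iff] at h
    have hl := x.le
    have h3 := hσ.lipschitz (l := 0) (m := x.l) (by omega) hl
    have h4 := hσ.lipschitz (l := x.l) (m := n + 1) (by omega) (by omega)
    change ¬ σ b.l ≤ b.ht at hb
    change σ x.l ≤ x.ht at hx
    unfold MeshPt.ht at hb hx
    rcases hb' with h5 | h5 <;> rw [h5] at hb h <;> push_cast at * <;> omega
  constructor
  · intro h b hb hb'
    exact (hD.colimOn_iff_isZero hD.pointed (key b hb hb') X).1 (h b (Or.inr hb'))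
  · rintro h b hb'
    by_cases hb : b ∈ aboveSec n σ
    · exact colimOn_of_mem hb X
    · exact (hD.colimOn_iff_isZero hD.pointed (key b hb (hb'.resolve_left hb)) X).2
        (h b hb (hb'.resolve_left hb))

/-- Working upwards by height, each vertex added is the tip of a mesh square whose other corners are
already present, and the colimit over everything lower reduces to that square. -/
theorem IsStableDerivator.forall_colimOn_aboveSec_iff (hD : D.IsStableDerivator) (hσ : IsSection n σ)
    (X : D.Diag (Mesh.{w} n)) :
    (∀ b ∈ aboveSec n σ, D.ColimOn (onSecBdry n σ) b X) ↔
      ∀ (k : ℤ) (l : ℕ) (hl : l < n), σ (l + 1) ≤ 2 * k + (l + 1) →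
        D.IsCocartesian ((D.res (Mesh.square.{w} k l hl)).obj X) := by
  have hsub : onSecBdry n σ ⊆ aboveSec n σ := by
    rintro x (hx | hx)
    · exact hx.2.symm.le
    · exact hx.1
  -- A section changes by at most one per level over n + 1 levels, so this bounds from below all
  -- heights above it.
  rw [hD.forall_colimOn_iff_of_height hsub MeshPt.ht (σ 0 - (n + 1)) (fun x hx _ => by
    have hl := x.le
    have h3 := hσ.lipschitz (l := 0) (m := x.l) (by omega) hl
    change σ x.l ≤ x.ht at hx
    push_cast at *
    omega)]
  have key : ∀ (k : ℤ) (l : ℕ) (hl : l < n), σ (l + 1) ≤ 2 * k + (l + 1) →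
      (D.ColimOn (onSecBdry n σ ∪ {x | x ∈ aboveSec n σ ∧ x.ht < (Mesh.squarePt k l hl (1, 1)).ht})
        (Mesh.squarePt k l hl (1, 1)) X ↔ D.IsCocartesian ((D.res (Mesh.square.{w} k l hl)).obj X)) := by
    intro k l hl hk
    have s1 := hσ.step l (by omega)
    have s2 : σ (l + 2) = σ (l + 1) + 1 ∨ σ (l + 1) = σ (l + 2) + 1 := hσ.step (l + 1) (by omega)
    refine hD.colimOn_iff_isCocartesian (Mesh.squarePt k l hl) (Mesh.squarePt_mono k l hl) _ ?_ ?_ ?_ X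
    · intro s hs
      obtain rfl | rfl | rfl : s = (0, 0) ∨ s = (1, 0) ∨ s = (0, 1) := by revert s; decide
      · refine Or.inr ⟨show σ (l + 1) ≤ 2 * k + ((l + 1 : ℕ) : ℤ) from ?_,
          show 2 * k + ((l + 1 : ℕ) : ℤ) < 2 * (k + 1) + ((l + 1 : ℕ) : ℤ) from ?_⟩ <;> push_cast <;> omega
      · refine Or.inr ⟨show σ (l + 2) ≤ 2 * k + ((l + 2 : ℕ) : ℤ) from ?_,
          show 2 * k + ((l + 2 : ℕ) : ℤ) < 2 * (k + 1) + ((l + 1 : ℕ) : ℤ) from ?_⟩ <;> push_cast <;> omega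
      · refine Or.inr ⟨show σ l ≤ 2 * (k + 1) + (l : ℤ) from ?_,
          show 2 * (k + 1) + (l : ℤ) < 2 * (k + 1) + ((l + 1 : ℕ) : ℤ) from ?_⟩ <;> push_cast <;> omega
    · intro x hx h
      -- An element below the tip but different from it lies below one of the two predecessors of
      -- the tip.
      have hne : ¬ (x.k = k + 1 ∧ x.l = l + 1) := by
        rintro ⟨h₁, h₂⟩
        rcases hx with (⟨_, hx⟩ | ⟨_, hx⟩) | ⟨_, hx⟩
        · unfold MeshPt.ht at hx
          rw [h₁, h₂] at hx
          push_cast at hx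
          omega
        · unfold MeshPt.Bdry at hx
          omega
        · change 2 * x.k + (x.l : ℤ) < 2 * (k + 1) + ((l + 1 : ℕ) : ℤ) at hx
          push_cast at hx
          omega
      rw [MeshPt.le_iff] at h
      rw [MeshPt.le_iff, MeshPt.le_iff]
      change x.k ≤ k + 1 ∧ x.k + x.l ≤ k + 1 + ((l + 1 : ℕ) : ℤ) at h
      change (x.k ≤ k ∧ x.k + x.l ≤ k + ((l + 2 : ℕ) : ℤ)) ∨ (x.k ≤ k + 1 ∧ x.k + x.l ≤ k + 1 + (l : ℤ))
      push_cast at h ⊢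
      omega
    · intro x _ h h'
      rw [MeshPt.le_iff] at h h' ⊢
      change x.k ≤ k ∧ x.k + x.l ≤ k + ((l + 2 : ℕ) : ℤ) at h
      change x.k ≤ k + 1 ∧ x.k + x.l ≤ k + 1 + (l : ℤ) at h'
      change x.k ≤ k ∧ x.k + x.l ≤ k + ((l + 1 : ℕ) : ℤ)
      push_cast at h ⊢
      omega
  constructor
  · intro h k l hl hk
    refine (key k l hl hk).1 (h _ ?_ ?_)
    · change σ (l + 1) ≤ 2 * (k + 1) + ((l + 1 : ℕ) : ℤ)
      push_cast
      omega
    · rintro (⟨_, hx⟩ | ⟨_, hx⟩)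
      · change 2 * (k + 1) + ((l + 1 : ℕ) : ℤ) = σ (l + 1) at hx
        push_cast at hx
        omega
      · change l + 1 = 0 ∨ l + 1 = n + 1 at hx
        omega
  · rintro h ⟨k, l, hl⟩ hb hb'
    have hb₁ : ¬ (⟨k, l, hl⟩ : MeshPt n).Bdry := fun h => hb' (Or.inr ⟨hb, h⟩)
    have hb₂ : ¬ 2 * k + (l : ℤ) = σ l := fun h => hb' (Or.inl ⟨hb₁, h⟩)
    change σ l ≤ 2 * k + (l : ℤ) at hb
    change ¬ (l = 0 ∨ l = n + 1) at hb₁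
    -- By parity a vertex strictly above the section is at least two units above it, so the initial
    -- corner of the square ending there is still on or above the section.
    obtain ⟨m, hm⟩ := hσ.even hl
    obtain ⟨l, rfl⟩ : ∃ l', l = l' + 1 := ⟨l - 1, by omega⟩
    obtain ⟨k, rfl⟩ : ∃ k', k = k' + 1 := ⟨k - 1, by omega⟩
    have hk : σ (l + 1) ≤ 2 * k + (l + 1) := by
      push_cast at *
      omega
    exact (key k l (by omega) hk).2 (h k l (by omega) hk)

/-- Dually, one works downwards by height; each vertex added is the initial corner of a mesh square.
The boundary below the section is already present. -/
theorem IsStableDerivator.forall_limOn_aboveSecBdry_iff (hD : D.IsStableDerivator) (hσ : IsSection n σ)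
    (X : D.Diag (Mesh.{w} n)) :
    (∀ b ∈ Set.univ, D.LimOn (aboveSecBdry n σ) b X) ↔
      ∀ (k : ℤ) (l : ℕ) (hl : l < n), 2 * k + (l + 1) < σ (l + 1) →
        D.IsCartesian ((D.res (Mesh.square.{w} k l hl)).obj X) := by
  rw [hD.forall_limOn_iff_of_height (Set.subset_univ _) MeshPt.ht (σ 0 + (n + 1)) (fun x _ hx => by
    have hl := x.le
    have h3 := hσ.lipschitz (l := 0) (m := x.l) (by omega) hl
    have hx' : ¬ σ x.l ≤ x.ht := fun h => hx (Or.inl h)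
    push_cast at *
    omega)]
  have key : ∀ (k : ℤ) (l : ℕ) (hl : l < n), 2 * k + (l + 1) < σ (l + 1) →
      (D.LimOn (aboveSecBdry n σ ∪ {x | x ∈ Set.univ ∧ (Mesh.squarePt k l hl (0, 0)).ht < x.ht})
        (Mesh.squarePt k l hl (0, 0)) X ↔ D.IsCartesian ((D.res (Mesh.square.{w} k l hl)).obj X)) := by
    intro k l hl hk
    refine hD.limOn_iff_isCartesian (Mesh.squarePt k l hl) (Mesh.squarePt_mono k l hl) _ ?_ ?_ ?_ X
    · intro s hs
      obtain rfl | rfl | rfl : s = (1, 1) ∨ s = (1, 0) ∨ s = (0, 1) := by revert s; decide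
      · refine Or.inr ⟨trivial,
          show 2 * k + ((l + 1 : ℕ) : ℤ) < 2 * (k + 1) + ((l + 1 : ℕ) : ℤ) from ?_⟩
        omega
      · refine Or.inr ⟨trivial, show 2 * k + ((l + 1 : ℕ) : ℤ) < 2 * k + ((l + 2 : ℕ) : ℤ) from ?_⟩
        push_cast
        omega
      · refine Or.inr ⟨trivial, show 2 * k + ((l + 1 : ℕ) : ℤ) < 2 * (k + 1) + (l : ℤ) from ?_⟩
        push_cast
        omega
    · intro x hx h
      have hne : ¬ (x.k = k ∧ x.l = l + 1) := by
        rintro ⟨h₁, h₂⟩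
        rcases hx with (hx | hx) | ⟨_, hx⟩
        · change σ x.l ≤ 2 * x.k + x.l at hx
          rw [h₁, h₂] at hx
          push_cast at hx
          omega
        · change x.l = 0 ∨ x.l = n + 1 at hx
          omega
        · change 2 * k + ((l + 1 : ℕ) : ℤ) < 2 * x.k + (x.l : ℤ) at hx
          push_cast at hx
          omega
      rw [MeshPt.le_iff] at h
      rw [MeshPt.le_iff, MeshPt.le_iff]
      change k ≤ x.k ∧ k + ((l + 1 : ℕ) : ℤ) ≤ x.k + x.l at h
      change (k ≤ x.k ∧ k + ((l + 2 : ℕ) : ℤ) ≤ x.k + x.l) ∨ (k + 1 ≤ x.k ∧ k + 1 + (l : ℤ) ≤ x.k + x.l)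
      push_cast at h ⊢
      omega
    · intro x _ h h'
      rw [MeshPt.le_iff] at h h' ⊢
      change k ≤ x.k ∧ k + ((l + 2 : ℕ) : ℤ) ≤ x.k + x.l at h
      change k + 1 ≤ x.k ∧ k + 1 + (l : ℤ) ≤ x.k + x.l at h'
      change k + 1 ≤ x.k ∧ k + 1 + ((l + 1 : ℕ) : ℤ) ≤ x.k + x.l
      push_cast at h ⊢
      omega
  constructor
  · intro h k l hl hk
    refine (key k l hl hk).1 (h _ trivial ?_)
    rintro (hx | hx)
    · change σ (l + 1) ≤ 2 * k + ((l + 1 : ℕ) : ℤ) at hx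
      push_cast at hx
      omega
    · change l + 1 = 0 ∨ l + 1 = n + 1 at hx
      omega
  · rintro h ⟨k, l, hl⟩ - hb'
    have hb₁ : ¬ (⟨k, l, hl⟩ : MeshPt n).Bdry := fun h => hb' (Or.inr h)
    have hb₂ : ¬ σ l ≤ 2 * k + (l : ℤ) := fun h => hb' (Or.inl h)
    change ¬ (l = 0 ∨ l = n + 1) at hb₁
    obtain ⟨l, rfl⟩ : ∃ l', l = l' + 1 := ⟨l - 1, by omega⟩
    have hk : 2 * k + (l + 1) < σ (l + 1) := by
      push_cast at *
      omega
    exact (key k l (by omega) hk).2 (h k l (by omega) hk)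

/-- The exactness conditions on the mesh category amount to Kan extensions from a section. -/
theorem IsStableDerivator.isARDiagram_iff (hD : D.IsStableDerivator) (hσ : IsSection n σ)
    (X : D.Diag (Mesh.{w} n)) :
    D.IsARDiagram n X ↔
      (∀ b ∈ Set.univ, D.LimOn (aboveSecBdry n σ) b X) ∧
      (∀ b ∈ aboveSecBdry n σ, D.ColimOn (aboveSec n σ) b X) ∧
      (∀ b ∈ aboveSec n σ, D.ColimOn (onSecBdry n σ) b X) ∧
      (∀ b ∈ onSecBdry n σ, D.LimOn (onSec n σ) b X) := by
  rw [hD.forall_limOn_aboveSecBdry_iff hσ, hD.forall_colimOn_aboveSecBdry_iff hσ,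
    hD.forall_colimOn_aboveSec_iff hσ, hD.forall_limOn_onSecBdry_iff hσ]
  constructor
  · intro h
    have hz : ∀ b : MeshPt n, b.Bdry → Limits.IsZero ((D.ev (⟨b⟩ : Mesh.{w} n)).obj X) := by
      rintro ⟨k, l, hl⟩ (h' | h')
      · change l = 0 at h'
        subst h'
        exact h.zero_bot k
      · change l = n + 1 at h'
        subst h'
        exact h.zero_top k
    exact ⟨fun k l hl _ => h.cartesian k l hl, fun b _ => hz b, fun k l hl _ => h.cocartesian k l hl,
      fun b _ => hz b⟩
  · rintro ⟨h₁, h₂, h₃, h₄⟩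
    have hz : ∀ b : MeshPt n, b.Bdry → Limits.IsZero ((D.ev (⟨b⟩ : Mesh.{w} n)).obj X) := by
      intro b hb
      by_cases h : b ∈ aboveSec n σ
      · exact h₄ b h hb
      · exact h₂ b h hb
    -- Stability enters here: squares starting on or above the section are cocartesian, the others
    -- cartesian, and each property implies the other.
    have hc : ∀ (k : ℤ) (l : ℕ) (hl : l < n), D.IsCartesian ((D.res (Mesh.square.{w} k l hl)).obj X) := by
      intro k l hl
      by_cases h : σ (l + 1) ≤ 2 * k + (l + 1)
      · exact (hD.cartesian_iff _).2 (h₃ k l hl h)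
      · exact h₁ k l hl (lt_of_not_ge h)
    exact ⟨fun k => hz _ (Or.inl rfl), fun k => hz _ (Or.inr rfl), hc,
      fun k l hl => (hD.cartesian_iff _).1 (hc k l hl)⟩

end Prederivator

/-! ### Restriction to a section is an equivalence -/

/-- A chain of restrictions, each of which is bijective on the relevant morphisms and has a fully faithful
adjoint, restricts to an equivalence. -/
theorem isEquivalence_of_chain {C₄ C₃ C₂ C₁ C₀ : Type*} [Category* C₄] [Category* C₃] [Category* C₂]
    [Category* C₁] [Category* C₀] (F₄ : C₄ ⥤ C₃) (F₃ : C₃ ⥤ C₂) (F₂ : C₂ ⥤ C₁) (F₁ : C₁ ⥤ C₀)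
    (P : ObjectProperty C₄) (hP : ∀ X, P X ↔ FullyFaithfulTo F₄ X ∧ FullyFaithfulFrom F₃ (F₄.obj X) ∧
      FullyFaithfulFrom F₂ (F₃.obj (F₄.obj X)) ∧ FullyFaithfulTo F₁ (F₂.obj (F₃.obj (F₄.obj X))))
    {R₄ : C₃ ⥤ C₄} (adj₄ : F₄ ⊣ R₄) (h₄ : ∀ X, IsIso (adj₄.counit.app X))
    {L₃ : C₂ ⥤ C₃} (adj₃ : L₃ ⊣ F₃) (h₃ : ∀ X, IsIso (adj₃.unit.app X))
    {L₂ : C₁ ⥤ C₂} (adj₂ : L₂ ⊣ F₂) (h₂ : ∀ X, IsIso (adj₂.unit.app X))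
    {R₁ : C₀ ⥤ C₁} (adj₁ : F₁ ⊣ R₁) (h₁ : ∀ X, IsIso (adj₁.counit.app X)) :
    (P.ι ⋙ F₄ ⋙ F₃ ⋙ F₂ ⋙ F₁).IsEquivalence := by
  -- Each factor is bijective on morphisms for a one-sided reason: the outer two because of the
  -- target Y, the inner two because of the source X.
  have hb : ∀ X Y : P.FullSubcategory, Function.Bijective
      (fun f : X ⟶ Y => (P.ι ⋙ F₄ ⋙ F₃ ⋙ F₂ ⋙ F₁).map f) := by
    intro X Y
    obtain ⟨-, hX₃, hX₂, -⟩ := (hP _).1 X.property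
    obtain ⟨hY₄, -, -, hY₁⟩ := (hP _).1 Y.property
    exact (hY₁ _).comp ((hX₂ _).comp ((hX₃ _).comp ((hY₄ _).comp
      (P.fullyFaithfulι.map_bijective X Y))))
  have hfull : (P.ι ⋙ F₄ ⋙ F₃ ⋙ F₂ ⋙ F₁).Full := ⟨fun {X Y} => (hb X Y).2⟩
  have hfaith : (P.ι ⋙ F₄ ⋙ F₃ ⋙ F₂ ⋙ F₁).Faithful := ⟨fun {X Y} _ _ h => (hb X Y).1 h⟩
  -- Applying the four adjoints in turn gives a preimage; it satisfies P because at each stage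
  -- restricting again recovers the previous object.
  have hess : (P.ι ⋙ F₄ ⋙ F₃ ⋙ F₂ ⋙ F₁).EssSurj := ⟨fun Z => by
    let W₁ := R₁.obj Z
    let W₂ := L₂.obj W₁
    let W₃ := L₃.obj W₂
    let W₄ := R₄.obj W₃
    let e₄ : F₄.obj W₄ ≅ W₃ := @asIso _ _ _ _ (adj₄.counit.app W₃) (h₄ W₃)
    let e₃ : F₃.obj (F₄.obj W₄) ≅ W₂ := F₃.mapIso e₄ ≪≫ (@asIso _ _ _ _ (adj₃.unit.app W₂) (h₃ W₂)).symm
    let e₂ : F₂.obj (F₃.obj (F₄.obj W₄)) ≅ W₁ :=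
      F₂.mapIso e₃ ≪≫ (@asIso _ _ _ _ (adj₂.unit.app W₁) (h₂ W₁)).symm
    let e₁ : F₁.obj (F₂.obj (F₃.obj (F₄.obj W₄))) ≅ Z :=
      F₁.mapIso e₂ ≪≫ @asIso _ _ _ _ (adj₁.counit.app Z) (h₁ Z)
    have hW : P W₄ := (hP _).2 ⟨Prederivator.fullyFaithfulTo_of_isIso_counit adj₄ (h₄ W₃),
      FullyFaithfulFrom.of_iso e₄.symm (Prederivator.fullyFaithfulFrom_of_isIso_unit adj₃ (h₃ W₂)),
      FullyFaithfulFrom.of_iso e₃.symm (Prederivator.fullyFaithfulFrom_of_isIso_unit adj₂ (h₂ W₁)),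
      FullyFaithfulTo.of_iso e₂.symm (Prederivator.fullyFaithfulTo_of_isIso_counit adj₁ (h₁ Z))⟩
    exact ⟨⟨W₄, hW⟩, ⟨e₁⟩⟩⟩
  exact { }

instance isEquivalence_prod_id {B C A : Type*} [Category* B] [Category* C] [Category* A] (p : B ⥤ C)
    [p.IsEquivalence] : (p.prod (𝟭 A)).IsEquivalence where
  essSurj := ⟨fun X => ⟨(p.objPreimage X.1, X.2),
    ⟨Iso.prod (p.objObjPreimageIso X.1) (Iso.refl X.2)⟩⟩⟩

namespace Prederivator

section

variable {D : Prederivator.{w,v,u}} {α : Type} [Preorder α] {A : Type w} [SmallCategory A]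

theorem IsDerivator.fullyFaithfulFrom_incl_prod_iff (hD : D.IsDerivator) {S T : Set α} (h : S ⊆ T)
    (X : D.Diag (Pos.{w} α × A)) :
    FullyFaithfulFrom (D.res ((Pos.incl.{w} h).prod (𝟭 A))) ((D.res ((Pos.val.{w} T).prod (𝟭 A))).obj X) ↔
      ∀ a, ∀ b ∈ T, D.ColimOn S b ((D.res (Prod.sectL (Pos.{w} α) a)).obj X) := by
  rw [hD.fullyFaithfulFrom_prod_iff]
  refine forall_congr' fun a => ?_
  rw [← hD.fullyFaithfulFrom_incl_iff h, D.res_res_obj (p := Prod.sectL (Pos.{w} T) a)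
    (r := Pos.val.{w} T ⋙ Prod.sectL (Pos.{w} α) a) rfl, D.res_comp_obj]

theorem IsDerivator.fullyFaithfulTo_incl_prod_iff (hD : D.IsDerivator) {S T : Set α} (h : S ⊆ T)
    (X : D.Diag (Pos.{w} α × A)) :
    FullyFaithfulTo (D.res ((Pos.incl.{w} h).prod (𝟭 A))) ((D.res ((Pos.val.{w} T).prod (𝟭 A))).obj X) ↔
      ∀ a, ∀ b ∈ T, D.LimOn S b ((D.res (Prod.sectL (Pos.{w} α) a)).obj X) := by
  rw [hD.fullyFaithfulTo_prod_iff]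
  refine forall_congr' fun a => ?_
  rw [← hD.fullyFaithfulTo_incl_iff h, D.res_res_obj (p := Prod.sectL (Pos.{w} T) a)
    (r := Pos.val.{w} T ⋙ Prod.sectL (Pos.{w} α) a) rfl, D.res_comp_obj]

theorem IsDerivator.fullyFaithfulTo_val_prod_iff (hD : D.IsDerivator) (S : Set α)
    (X : D.Diag (Pos.{w} α × A)) :
    FullyFaithfulTo (D.res ((Pos.val.{w} S).prod (𝟭 A))) X ↔
      ∀ a, ∀ b ∈ Set.univ, D.LimOn S b ((D.res (Prod.sectL (Pos.{w} α) a)).obj X) := by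
  rw [hD.fullyFaithfulTo_prod_iff]
  refine forall_congr' fun a => ?_
  have h := hD.fullyFaithfulTo_pos_iff (Subtype.val : S → α) (fun _ _ h => h) id (fun _ _ h => h)
    ((D.res (Prod.sectL (Pos.{w} α) a)).obj X)
  have h' : Pos.map.{w} (id : α → α) (fun _ _ h => h) = 𝟭 _ := rfl
  rw [h', D.res_id_obj] at h
  have key : ∀ b, D.IsLimAt (Pos.cone.{w} (fun x : {x : S // b ≤ x.1} => x.1.1) (fun _ _ h => h) b
      fun x => x.2) ((D.res (Prod.sectL (Pos.{w} α) a)).obj X) ↔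
        D.LimOn S b ((D.res (Prod.sectL (Pos.{w} α) a)).obj X) := fun b => isLimAt_cone_iff
      (r := fun x : {x // x ∈ S ∧ b ≤ x} => (⟨⟨x.1, x.2.1⟩, x.2.2⟩ : {x : S // b ≤ x.1}))
      (l := fun x => ⟨x.1.1, x.1.2, x.2⟩) (fun _ _ => Iff.rfl) (fun x : {x // x ∈ S ∧ b ≤ x} => x.1)
      (fun _ _ h => h) b (fun x => x.2.2) _
  exact h.trans ⟨fun h b _ => (key b).1 (h b), fun h b => (key b).2 (h b trivial)⟩

end

variable {D : Prederivator.{w,v,u}} {n : ℕ} {σ : ℕ → ℤ}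

open MeshPt

theorem onSec_subset : onSec n σ ⊆ onSecBdry n σ := Set.subset_union_left

theorem onSecBdry_subset : onSecBdry n σ ⊆ aboveSec n σ := by
  rintro x (hx | hx)
  · exact hx.2.symm.le
  · exact hx.1

theorem aboveSec_subset : aboveSec n σ ⊆ aboveSecBdry n σ := Set.subset_union_left

variable (D n) in
/-- The diagrams with parameters in `A` whose values at all objects of `A` are exact. -/
def arDiag (A : Type w) [SmallCategory A] : ObjectProperty (D.Diag (Mesh.{w} n × A)) :=
  fun X => ∀ a : A, D.IsARDiagram n ((D.res (Prod.sectL (Mesh.{w} n) a)).obj X)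

/-- Restriction to a section is an equivalence. -/
theorem IsStableDerivator.isEquivalence_onSec (hD : D.IsStableDerivator) (hσ : IsSection n σ)
    (A : Type w) [SmallCategory A] :
    ((arDiag D n A).ι ⋙ D.res ((Pos.val.{w} (onSec n σ)).prod (𝟭 A))).IsEquivalence := by
  let V := Pos.val.{w} (aboveSecBdry n σ)
  let iU := Pos.incl.{w} (aboveSec_subset (n := n) (σ := σ))
  let iK := Pos.incl.{w} (onSecBdry_subset (n := n) (σ := σ))
  let iI := Pos.incl.{w} (onSec_subset (n := n) (σ := σ))
  have h4 := hD.der3_right (V.prod (𝟭 A))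
  have h3 := hD.der3_left (iU.prod (𝟭 A))
  have h2 := hD.der3_left (iK.prod (𝟭 A))
  have h1 := hD.der3_right (iI.prod (𝟭 A))
  have key := isEquivalence_of_chain (D.res (V.prod (𝟭 A))) (D.res (iU.prod (𝟭 A)))
    (D.res (iK.prod (𝟭 A))) (D.res (iI.prod (𝟭 A))) (arDiag D n A) (fun X => by
      have e₃ : (D.res (iU.prod (𝟭 A))).obj ((D.res (V.prod (𝟭 A))).obj X) =
        (D.res ((Pos.val.{w} (aboveSec n σ)).prod (𝟭 A))).obj X := D.res_res_obj rfl X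
      have e₂ : (D.res (iK.prod (𝟭 A))).obj
        ((D.res ((Pos.val.{w} (aboveSec n σ)).prod (𝟭 A))).obj X) =
        (D.res ((Pos.val.{w} (onSecBdry n σ)).prod (𝟭 A))).obj X := D.res_res_obj rfl X
      rw [e₃, e₂, hD.fullyFaithfulTo_val_prod_iff, hD.fullyFaithfulFrom_incl_prod_iff,
        hD.fullyFaithfulFrom_incl_prod_iff, hD.fullyFaithfulTo_incl_prod_iff, ← forall_and, ← forall_and,
        ← forall_and]
      exact forall_congr' fun a => hD.isARDiagram_iff hσ _)
    (Adjunction.ofIsLeftAdjoint _) (hD.isIso_counit _ _)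
    (Adjunction.ofIsRightAdjoint _) (hD.isIso_unit _ _)
    (Adjunction.ofIsRightAdjoint _) (hD.isIso_unit _ _)
    (Adjunction.ofIsLeftAdjoint _) (hD.isIso_counit _ _)
  have e : D.res ((Pos.val.{w} (onSec n σ)).prod (𝟭 A)) = D.res (V.prod (𝟭 A)) ⋙
      D.res (iU.prod (𝟭 A)) ⋙ D.res (iK.prod (𝟭 A)) ⋙ D.res (iI.prod (𝟭 A)) := by
    rw [← D.res_comp, ← D.res_comp, ← D.res_comp]
    rfl
  rw [e]
  exact key

/-- A full functor from a thin category to a poset is an equivalence onto its image. -/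
theorem exists_equivalence_of_image {α : Type} [Preorder α] (S : Set α) {J : Type w} [SmallCategory J]
    [Quiver.IsThin J] (p : J ⥤ Pos.{w} α) [p.Full] (hp : ∀ x, x ∈ S ↔ ∃ j, p.obj j = ⟨x⟩) :
    ∃ e : J ⥤ Pos.{w} S, e.IsEquivalence ∧ p = e ⋙ Pos.val.{w} S := by
  let e : J ⥤ Pos.{w} S :=
    { obj j := ⟨⟨(p.obj j).pt, (hp _).2 ⟨j, rfl⟩⟩⟩
      map k := Pos.homOf (Pos.le_of_hom (p.map k))
      map_id _ := rfl
      map_comp _ _ := rfl }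
  refine ⟨e, ?_, CategoryTheory.Functor.ext (fun _ => rfl) fun _ _ _ => Subsingleton.elim _ _⟩
  exact
    { faithful := inferInstance
      full := ⟨fun k => ⟨p.preimage (Pos.homOf (Pos.le_of_hom k)), Subsingleton.elim _ _⟩⟩
      essSurj := ⟨fun x => by
        obtain ⟨j, hj⟩ := (hp x.pt.1).1 x.pt.2
        have h : e.obj j = x := Pos.ext (Subtype.ext (congrArg Pos.pt hj))
        exact ⟨j, ⟨eqToIso h⟩⟩⟩ }

theorem res_comp_prod (D : Prederivator.{w,v,u}) {J K L : Type w} [SmallCategory J] [SmallCategory K]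
    [SmallCategory L] (e : J ⥤ K) (q : K ⥤ L) (A : Type w) [SmallCategory A] :
    D.res ((e ⋙ q).prod (𝟭 A)) = D.res (q.prod (𝟭 A)) ⋙ D.res (e.prod (𝟭 A)) :=
  D.res_comp (e.prod (𝟭 A)) (q.prod (𝟭 A))

/-- Restriction along a full embedding with image a section is an equivalence. -/
theorem IsStableDerivator.isEquivalence_of_image (hD : D.IsStableDerivator) (hσ : IsSection n σ)
    {J : Type w} [SmallCategory J] [Quiver.IsThin J] (p : J ⥤ Mesh.{w} n) [p.Full]
    (hp : ∀ x, x ∈ onSec n σ ↔ ∃ j, p.obj j = ⟨x⟩) (A : Type w) [SmallCategory A] :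
    ((arDiag D n A).ι ⋙ D.res (p.prod (𝟭 A))).IsEquivalence := by
  obtain ⟨e, he, rfl⟩ := exists_equivalence_of_image (onSec n σ) p hp
  rw [res_comp_prod]
  have := hD.isEquivalence_onSec hσ A
  exact inferInstanceAs ((((arDiag D n A).ι ⋙ D.res ((Pos.val.{w} (onSec n σ)).prod (𝟭 A))) ⋙
    D.res (e.prod (𝟭 A))).IsEquivalence)

end Prederivator

/-! ### Quivers placed in the mesh category by levels and heights -/

theorem MeshPt.ext_ht {n : ℕ} {x y : MeshPt n} (hl : x.l = y.l) (hh : x.ht = y.ht) : x = y := by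
  unfold MeshPt.ht at hh
  exact MeshPt.ext (by omega) hl

theorem MeshPt.le_iff_ht {n : ℕ} {x y : MeshPt n} :
    x ≤ y ↔ (y.l : ℤ) - x.l ≤ y.ht - x.ht ∧ (x.l : ℤ) - y.l ≤ y.ht - x.ht := by
  rw [MeshPt.le_iff]
  unfold MeshPt.ht
  omega

namespace AnQuiver

variable {n : ℕ} (Q : AnQuiver n)

theorem not_arrow_of_arrow {i j : ℕ} (h : Q.Arrow i j) : ¬ Q.Arrow j i := by
  intro h'
  obtain ⟨⟨hi, hi'⟩, ⟨hj, hj'⟩, rfl | rfl⟩ := Q.arrow_mem i j h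
  · rcases Q.orient i hi (by omega) with h₁ | h₁
    · exact h₁.2 h'
    · exact h₁.2 h
  · rcases Q.orient j hj (by omega) with h₁ | h₁
    · exact h₁.2 h
    · exact h₁.2 h'

theorem arrow_or_arrow {i j : ℕ} (hi : 1 ≤ i ∧ i ≤ n) (hj : 1 ≤ j ∧ j ≤ n) (h : j = i + 1 ∨ i = j + 1) :
    Q.Arrow i j ∨ Q.Arrow j i := by
  rcases h with rfl | rfl
  · exact (Q.orient i hi.1 (by omega)).or
  · exact (Q.orient j hj.1 (by omega)).or.symm

/-- A path in a quiver of type `A_n` never turns around. -/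
theorem path_cases {x y : (Q.Vert : Type w)} (p : Quiver.Path x y) :
    (y.pos = x.pos + p.length ∧ (p.length ≠ 0 → Q.Arrow (y.pos - 1) y.pos)) ∨
      (x.pos = y.pos + p.length ∧ (p.length ≠ 0 → Q.Arrow (y.pos + 1) y.pos)) := by
  induction p with
  | nil => exact Or.inl ⟨rfl, fun h => absurd rfl h⟩
  | @cons y z p e ih =>
    obtain ⟨e⟩ := e
    have he := Q.arrow_mem _ _ e
    rw [Quiver.Path.length_cons]
    rcases he.2.2 with h | h
    · left
      refine ⟨?_, fun _ => by rw [h, Nat.add_sub_cancel]; exact h ▸ e⟩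
      rcases ih with ⟨h₁, -⟩ | ⟨h₁, h₂⟩
      · omega
      · by_cases h₀ : p.length = 0
        · omega
        · exact absurd (h₂ h₀) (Q.not_arrow_of_arrow (h ▸ e))
    · right
      refine ⟨?_, fun _ => h ▸ e⟩
      rcases ih with ⟨h₁, h₂⟩ | ⟨h₁, -⟩
      · by_cases h₀ : p.length = 0
        · omega
        · have h₃ := h₂ h₀
          rw [h, Nat.add_sub_cancel, ← h] at h₃
          exact absurd h₃ (Q.not_arrow_of_arrow e)
      · omega

/-- Paths are monotone along the line, so the endpoints determine length and direction, hence the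
last vertex but one. -/
theorem path_subsingleton {x y : (Q.Vert : Type w)} (p q : Quiver.Path x y) : p = q := by
  induction p with
  | nil =>
    cases q with
    | nil => rfl
    | cons q e =>
      have := Q.path_cases (q.cons e)
      rw [Quiver.Path.length_cons] at this
      omega
  | @cons y z p e ih =>
    cases q with
    | nil =>
      have := Q.path_cases (p.cons e)
      rw [Quiver.Path.length_cons] at this
      omega
    | @cons y' _ q e' =>
      have h₁ := Q.path_cases (p.cons e)
      have h₂ := Q.path_cases (q.cons e')
      have h₃ := Q.path_cases p
      have h₄ := Q.path_cases q
      have h₅ := (Q.arrow_mem _ _ e.down).2.2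
      have h₆ := (Q.arrow_mem _ _ e'.down).2.2
      rw [Quiver.Path.length_cons] at h₁ h₂
      have : y = y' := Vert.ext (by omega)
      subst this
      obtain ⟨e⟩ := e
      obtain ⟨e'⟩ := e'
      rw [ih q]

instance isThin_free : Quiver.IsThin (Q.Free : Type w) := fun _ _ => ⟨Q.path_subsingleton⟩

/-- A height function: it increases by one along each arrow. -/
def IsHeight (s : ℕ → ℤ) : Prop := ∀ i j, Q.Arrow i j → s j = s i + 1

variable {Q} {s : ℕ → ℤ}

theorem IsHeight.step (hs : Q.IsHeight s) {i j : ℕ} (hi : 1 ≤ i ∧ i ≤ n) (hj : 1 ≤ j ∧ j ≤ n)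
    (h : j = i + 1 ∨ i = j + 1) : s j = s i + 1 ∨ s i = s j + 1 :=
  (Q.arrow_or_arrow hi hj h).imp (hs i j) (hs j i)

theorem IsHeight.arrow_iff (hs : Q.IsHeight s) {i j : ℕ} :
    Q.Arrow i j ↔ (1 ≤ i ∧ i ≤ n) ∧ (1 ≤ j ∧ j ≤ n) ∧ (j = i + 1 ∨ i = j + 1) ∧ s j = s i + 1 := by
  constructor
  · intro h
    have := Q.arrow_mem i j h
    exact ⟨this.1, this.2.1, this.2.2, hs i j h⟩
  · rintro ⟨h₁, h₂, h₃, h₄⟩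
    refine (Q.arrow_or_arrow h₁ h₂ h₃).resolve_right fun h => ?_
    have := hs j i h
    omega

/-- Each edge changes the height by one, so the difference of heights is at most the distance, with
equality only if every edge points towards y. -/
theorem IsHeight.exists_path_up (hs : Q.IsHeight s) (m : ℕ) {x y : (Q.Vert : Type w)}
    (h : y.pos = x.pos + m) : s y.pos - s x.pos ≤ m ∧
      (s y.pos - s x.pos = m → Nonempty (Quiver.Path x y)) := by
  induction m generalizing y with
  | zero =>
    have : x = y := Vert.ext h.symm
    subst this
    exact ⟨by simp, fun _ => ⟨.nil⟩⟩
  | succ m ih =>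
    have hx := x.one_le
    have hy := y.le
    let z : (Q.Vert : Type w) := ⟨x.pos + m, by omega, by omega⟩
    have hz : y.pos = z.pos + 1 := by rw [h]; rfl
    obtain ⟨h₁, h₂⟩ := ih (y := z) rfl
    have h₃ := hs.step (i := z.pos) (j := y.pos) ⟨z.one_le, z.le⟩ ⟨y.one_le, y.le⟩ (Or.inl hz)
    push_cast
    refine ⟨by omega, fun h₄ => ?_⟩
    obtain ⟨p⟩ := h₂ (by omega)
    exact ⟨p.cons ⟨hs.arrow_iff.2 ⟨⟨z.one_le, z.le⟩, ⟨y.one_le, y.le⟩, Or.inl hz, by omega⟩⟩⟩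

theorem IsHeight.exists_path_down (hs : Q.IsHeight s) (m : ℕ) {x y : (Q.Vert : Type w)}
    (h : x.pos = y.pos + m) : s y.pos - s x.pos ≤ m ∧
      (s y.pos - s x.pos = m → Nonempty (Quiver.Path x y)) := by
  induction m generalizing y with
  | zero =>
    have : x = y := Vert.ext h
    subst this
    exact ⟨by simp, fun _ => ⟨.nil⟩⟩
  | succ m ih =>
    have hx := x.le
    have hy := y.one_le
    let z : (Q.Vert : Type w) := ⟨y.pos + 1, by omega, by omega⟩
    have hz : z.pos = y.pos + 1 := rfl
    obtain ⟨h₁, h₂⟩ := ih (y := z) (by rw [h, hz]; omega)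
    have h₃ := hs.step (i := z.pos) (j := y.pos) ⟨z.one_le, z.le⟩ ⟨y.one_le, y.le⟩ (Or.inr hz)
    push_cast
    refine ⟨by omega, fun h₄ => ?_⟩
    obtain ⟨p⟩ := h₂ (by omega)
    exact ⟨p.cons ⟨hs.arrow_iff.2 ⟨⟨z.one_le, z.le⟩, ⟨y.one_le, y.le⟩, Or.inr hz, by omega⟩⟩⟩

variable (Q) in
/-- `e` places the vertex `q` of `Q` at level `lv q` and height `s q` of the mesh category, where `lv` is
the identity or the reversal. -/
structure IsEmbedding (e : (Q.Free : Type w) ⥤ Mesh.{w} n) (lv : ℕ → ℕ) (s : ℕ → ℤ) : Prop where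
  lv_cases : (∀ i, i ≤ n + 1 → lv i = i) ∨ ∀ i, i ≤ n + 1 → lv i = n + 1 - i
  level : ∀ x : (Q.Vert : Type w), (e.obj x).pt.l = lv x.pos
  height : ∀ x : (Q.Vert : Type w), (e.obj x).pt.ht = s x.pos
  isHeight : Q.IsHeight s

namespace IsEmbedding

variable {e : (Q.Free : Type w) ⥤ Mesh.{w} n} {lv : ℕ → ℕ} {s : ℕ → ℤ}

/-- An inequality in the mesh category says that heights differ by at least the distance of levels.
Along Q they differ by at most that distance, so equality holds and forces a path in Q. -/
theorem full (he : Q.IsEmbedding e lv s) : e.Full where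
  map_surjective {x y} k := by
    have hk := MeshPt.le_iff_ht.1 (Pos.le_of_hom k)
    have h₁ : (e.obj x).pt.l = lv x.pos := he.level x
    have h₂ : (e.obj y).pt.l = lv y.pos := he.level y
    have h₃ : (e.obj x).pt.ht = s x.pos := he.height x
    have h₄ : (e.obj y).pt.ht = s y.pos := he.height y
    rw [h₁, h₂, h₃, h₄] at hk
    have hx : x.pos ≤ n := x.le
    have hy : y.pos ≤ n := y.le
    suffices h : Nonempty (Quiver.Path (V := Q.Vert) x y) from ⟨h.some, Subsingleton.elim _ _⟩
    rcases le_total x.pos y.pos with h | h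
    · obtain ⟨m, hm⟩ := Nat.exists_eq_add_of_le h
      obtain ⟨h₁, h₂⟩ := he.isHeight.exists_path_up m hm
      refine h₂ ?_
      rcases he.lv_cases with h₃ | h₃ <;> (rw [h₃ _ (by omega), h₃ _ (by omega)] at hk; omega)
    · obtain ⟨m, hm⟩ := Nat.exists_eq_add_of_le h
      obtain ⟨h₁, h₂⟩ := he.isHeight.exists_path_down m hm
      refine h₂ ?_
      rcases he.lv_cases with h₃ | h₃ <;> (rw [h₃ _ (by omega), h₃ _ (by omega)] at hk; omega)

end IsEmbedding

end AnQuiver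

namespace AnQuiver

variable {n : ℕ} {Q : AnQuiver n} {e : (Q.Free : Type w) ⥤ Mesh.{w} n} {lv : ℕ → ℕ} {s : ℕ → ℤ}

namespace IsEmbedding

theorem lv_mem (he : Q.IsEmbedding e lv s) {i : ℕ} (hi : 1 ≤ i ∧ i ≤ n) : 1 ≤ lv i ∧ lv i ≤ n := by
  rcases he.lv_cases with h | h <;> (rw [h i (by omega)]; omega)

/-- As an involution, `lv` also serves to find the vertex at a given level. -/
theorem lv_lv (he : Q.IsEmbedding e lv s) {i : ℕ} (hi : i ≤ n + 1) : lv (lv i) = i := by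
  rcases he.lv_cases with h | h
  · rw [h i hi, h i hi]
  · rw [h i hi, h _ (by omega)]
    omega

theorem lv_step (he : Q.IsEmbedding e lv s) {i j : ℕ} (hi : i ≤ n + 1) (hj : j ≤ n + 1)
    (h : j = i + 1 ∨ i = j + 1) : lv j = lv i + 1 ∨ lv i = lv j + 1 := by
  rcases he.lv_cases with h' | h' <;> (rw [h' i hi, h' j hj]; omega)

/-- The levels and heights of the vertices of an embedding have the same parity. -/
theorem parity (he : Q.IsEmbedding e lv s) {i : ℕ} (hi : 1 ≤ i ∧ i ≤ n) :
    ∃ k : ℤ, s i = 2 * k + lv i := by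
  have h₁ := he.level ⟨i, hi.1, hi.2⟩
  have h₂ := he.height ⟨i, hi.1, hi.2⟩
  exact ⟨(e.obj (⟨i, hi.1, hi.2⟩ : (Q.Vert : Type w))).pt.k, by
    rw [← h₁]
    exact h₂.symm⟩

/-- The section of the mesh category formed by the image of an embedding. -/
def sectionOf (n : ℕ) (lv : ℕ → ℕ) (s : ℕ → ℤ) (l : ℕ) : ℤ :=
  if l = 0 then s (lv 1) + 1 else if l = n + 1 then s (lv n) + 1 else s (lv l)

theorem sectionOf_of_mem {l : ℕ} (hl : 1 ≤ l ∧ l ≤ n) : sectionOf n lv s l = s (lv l) := by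
  unfold sectionOf
  rw [if_neg (by omega), if_neg (by omega)]

theorem isSection (he : Q.IsEmbedding e lv s) (hn : 1 ≤ n) : IsSection n (sectionOf n lv s) := by
  have h₀ : sectionOf n lv s 0 = s (lv 1) + 1 := if_pos rfl
  have h₁ : sectionOf n lv s 1 = s (lv 1) := sectionOf_of_mem ⟨le_rfl, hn⟩
  have h₂ : sectionOf n lv s (n + 1) = s (lv n) + 1 := by
    unfold sectionOf
    rw [if_neg (by omega), if_pos rfl]
  have h₃ : sectionOf n lv s n = s (lv n) := sectionOf_of_mem ⟨hn, le_rfl⟩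
  refine ⟨fun l hl => ?_, by rw [h₀, h₁], by rw [h₂, h₃], ?_⟩
  · by_cases h : l = 0
    · subst h
      exact Or.inr (by rw [h₀, h₁])
    by_cases h' : l = n
    · subst h'
      exact Or.inl (by rw [h₂, h₃])
    rw [sectionOf_of_mem ⟨by omega, by omega⟩, sectionOf_of_mem ⟨by omega, by omega⟩]
    exact he.isHeight.step (he.lv_mem ⟨by omega, by omega⟩) (he.lv_mem ⟨by omega, by omega⟩)
      (he.lv_step (by omega) (by omega) (Or.inl rfl))
  · obtain ⟨k, hk⟩ := he.parity (he.lv_mem ⟨le_rfl, hn⟩)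
    rw [he.lv_lv (by omega)] at hk
    -- The peak at level 0 is one above the vertex at level 1, whose height is 2k + 1.
    exact ⟨k + 1, by rw [h₀, hk]; push_cast; ring⟩

theorem mem_onSec_iff (he : Q.IsEmbedding e lv s) (x : MeshPt n) :
    x ∈ MeshPt.onSec n (sectionOf n lv s) ↔ ∃ j, e.obj j = ⟨x⟩ := by
  constructor
  · rintro ⟨h₁, h₂⟩
    have hl := x.le
    change ¬ (x.l = 0 ∨ x.l = n + 1) at h₁
    have hx : 1 ≤ x.l ∧ x.l ≤ n := by omega
    have hm := he.lv_mem hx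
    rw [sectionOf_of_mem hx] at h₂
    refine ⟨(⟨lv x.l, hm.1, hm.2⟩ : (Q.Vert : Type w)), Pos.ext (MeshPt.ext_ht ?_ ?_)⟩
    · exact (he.level ⟨lv x.l, hm.1, hm.2⟩).trans (he.lv_lv (by omega))
    · exact (he.height ⟨lv x.l, hm.1, hm.2⟩).trans h₂.symm
  · rintro ⟨j, hj⟩
    have h₁ : (e.obj j).pt.l = lv j.pos := he.level j
    have h₂ : (e.obj j).pt.ht = s j.pos := he.height j
    have hp : 1 ≤ j.pos ∧ j.pos ≤ n := ⟨j.one_le, j.le⟩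
    rw [hj] at h₁ h₂
    change x.l = _ at h₁
    have hx : 1 ≤ x.l ∧ x.l ≤ n := h₁ ▸ he.lv_mem hp
    refine ⟨fun h => ?_, ?_⟩
    · unfold MeshPt.Bdry at h
      omega
    · rw [sectionOf_of_mem hx]
      rw [h₁, he.lv_lv (by omega)]
      exact h₂

theorem isEquivalence {D : Prederivator.{w,v,u}} (he : Q.IsEmbedding e lv s) (hD : D.IsStableDerivator)
    (hn : 1 ≤ n) (A : Type w) [SmallCategory A] :
    ((Prederivator.arDiag D n A).ι ⋙ D.res (e.prod (𝟭 A))).IsEquivalence :=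
  haveI := he.full
  hD.isEquivalence_of_image (he.isSection hn) e he.mem_onSec_iff A

end IsEmbedding

/-! ### Isomorphisms of repetitive quivers -/

namespace MeshArrow

theorem ht {x y : MeshPt n} (h : RepArrow linArrow x y) : y.ht = x.ht + 1 := by
  unfold MeshPt.ht
  rcases h with ⟨h₁, h₂⟩ | ⟨h₁, h₂⟩ <;> (unfold linArrow at h₂; omega)

theorem level {x y : MeshPt n} (h : RepArrow linArrow x y) : y.l = x.l + 1 ∨ x.l = y.l + 1 := by
  rcases h with ⟨h₁, h₂⟩ | ⟨h₁, h₂⟩ <;> (unfold linArrow at h₂; omega)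

theorem iff {x y : MeshPt n} :
    RepArrow linArrow x y ↔ y.ht = x.ht + 1 ∧ (y.l = x.l + 1 ∨ x.l = y.l + 1) := by
  refine ⟨fun h => ⟨ht h, level h⟩, ?_⟩
  unfold MeshPt.ht RepArrow linArrow
  omega

end MeshArrow

theorem extArrow_or {i j : ℕ} (hi : 1 ≤ i ∧ i ≤ n) (hj : j = i + 1 ∨ i = j + 1) :
    Q.extArrow i j ∨ Q.extArrow j i := by
  unfold extArrow
  by_cases h : 1 ≤ j ∧ j ≤ n
  · rcases Q.arrow_or_arrow hi h hj with h | h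
    · exact Or.inl (Or.inl h)
    · exact Or.inr (Or.inl h)
  · omega

theorem not_extArrow (hn : 1 ≤ n) {i j : ℕ} (h : Q.extArrow i j) : ¬ Q.extArrow j i := by
  rintro h'
  unfold extArrow at h h'
  rcases h with h | h
  · have := Q.arrow_mem _ _ h
    rcases h' with h' | h'
    · exact Q.not_arrow_of_arrow h h'
    · omega
  · rcases h' with h' | h'
    · have := Q.arrow_mem _ _ h'
      omega
    · omega

theorem extArrow_adj {i j : ℕ} (hn : 1 ≤ n) (h : Q.extArrow i j) :
    (1 ≤ i ∧ i ≤ n) ∧ j ≤ n + 1 ∧ (j = i + 1 ∨ i = j + 1) := by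
  rcases h with h | h
  · have := Q.arrow_mem _ _ h
    omega
  · omega

namespace RepIso

variable (φ : Q.RepIso)

/-- The vertex `r` of the copy `k` of the repetitive quiver, mapped to the mesh category. -/
def pt (k : ℤ) (r : ℕ) (hr : r ≤ n + 1) : MeshPt n := φ.toEquiv ⟨k, r, hr⟩

theorem pt_ne {k k' : ℤ} {r r' : ℕ} (hr hr') (h : r ≠ r') : φ.pt k r hr ≠ φ.pt k' r' hr' :=
  fun h' => h (congrArg MeshPt.l (φ.toEquiv.injective h'))

open Classical in
/-- The copy of the neighbour `j` of `i` at which an arrow starting at copy `0` of `i` ends. -/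
noncomputable def outCopy (Q : AnQuiver n) (i j : ℕ) : ℤ := if Q.extArrow i j then 0 else 1

theorem arrow_out (k : ℤ) {i j : ℕ} (hi : 1 ≤ i ∧ i ≤ n) (hi' hj') (hj : j = i + 1 ∨ i = j + 1) :
    RepArrow linArrow (φ.pt k i hi') (φ.pt (k + outCopy Q i j) j hj') := by
  refine (φ.arrow_iff _ _).1 ?_
  unfold outCopy
  split_ifs with h
  · exact Or.inl ⟨add_zero k, h⟩
  · exact Or.inr ⟨rfl, (Q.extArrow_or hi hj).resolve_left h⟩

theorem arrow_in (k : ℤ) {i j : ℕ} (hi : 1 ≤ i ∧ i ≤ n) (hi' hj') (hj : j = i + 1 ∨ i = j + 1) :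
    RepArrow linArrow (φ.pt (k + outCopy Q i j) j hj') (φ.pt (k + 1) i hi') := by
  refine (φ.arrow_iff _ _).1 ?_
  unfold outCopy
  split_ifs with h
  · exact Or.inr ⟨by rw [add_zero], h⟩
  · exact Or.inl ⟨rfl, (Q.extArrow_or hi hj).resolve_left h⟩

/-- The two successors of a vertex are distinct and have equal heights, so their levels must differ.
-/
theorem level_out_ne (k : ℤ) {i : ℕ} (hi : 1 ≤ i ∧ i ≤ n) :
    (φ.pt (k + outCopy Q i (i - 1)) (i - 1) (by omega)).l ≠
      (φ.pt (k + outCopy Q i (i + 1)) (i + 1) (by omega)).l := by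
  intro h
  refine φ.pt_ne (k := k + outCopy Q i (i - 1)) (k' := k + outCopy Q i (i + 1)) _ _
    (by omega : i - 1 ≠ i + 1) (MeshPt.ext_ht h ?_)
  have h₁ := MeshArrow.ht (φ.arrow_out k hi (by omega) (by omega) (j := i - 1) (Or.inr (by omega)))
  have h₂ := MeshArrow.ht (φ.arrow_out k hi (by omega) (by omega) (j := i + 1) (Or.inl rfl))
  rw [h₁, h₂]

/-- The vertices (k, i) and (k + 1, i) enclose the same two middle vertices. Those have distinct
levels, each differing by one from both, so they lie on either side of a single common level. -/
theorem level_succ (k : ℤ) {i : ℕ} (hi : 1 ≤ i ∧ i ≤ n) (hi') :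
    (φ.pt (k + 1) i hi').l = (φ.pt k i hi').l := by
  have h₁ := MeshArrow.level (φ.arrow_out k hi hi' (by omega) (j := i - 1) (Or.inr (by omega)))
  have h₂ := MeshArrow.level (φ.arrow_out k hi hi' (by omega) (j := i + 1) (Or.inl rfl))
  have h₃ := MeshArrow.level (φ.arrow_in k hi hi' (by omega) (j := i - 1) (Or.inr (by omega)))
  have h₄ := MeshArrow.level (φ.arrow_in k hi hi' (by omega) (j := i + 1) (Or.inl rfl))
  have h₅ := φ.level_out_ne k hi
  omega

/-- The level of the vertex `(0, r)`. -/
def level (r : ℕ) : ℕ := if h : r ≤ n + 1 then (φ.pt 0 r h).l else 0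

theorem level_eq {r : ℕ} (h : r ≤ n + 1) : φ.level r = (φ.pt 0 r h).l := dif_pos h

theorem level_le (r : ℕ) : φ.level r ≤ n + 1 := by
  unfold level
  split_ifs
  · exact MeshPt.le _
  · exact Nat.zero_le _

/-- For interior j the level does not depend on the copy. The added vertices 0 and n + 1 only
receive arrows, so there the copy is already 0. -/
theorem level_out {i j : ℕ} (hi : 1 ≤ i ∧ i ≤ n) (hj' : j ≤ n + 1) (hj : j = i + 1 ∨ i = j + 1) :
    (φ.pt (0 + outCopy Q i j) j hj').l = φ.level j := by
  rw [φ.level_eq hj']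
  by_cases h : 1 ≤ j ∧ j ≤ n
  · unfold outCopy
    split_ifs
    · rfl
    · exact φ.level_succ 0 h hj'
  · have : Q.extArrow i j := by
      unfold extArrow
      omega
    unfold outCopy
    rw [if_pos this]
    rfl

theorem level_step {i j : ℕ} (hi : 1 ≤ i ∧ i ≤ n) (hj : j = i + 1 ∨ i = j + 1) :
    φ.level j = φ.level i + 1 ∨ φ.level i = φ.level j + 1 := by
  have := MeshArrow.level (φ.arrow_out 0 hi (by omega) (by omega) hj)
  rwa [φ.level_out hi (by omega) hj, ← φ.level_eq] at this

theorem level_ne {i : ℕ} (hi : 1 ≤ i ∧ i ≤ n) : φ.level (i - 1) ≠ φ.level (i + 1) := by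
  have := φ.level_out_ne 0 hi
  rwa [φ.level_out hi (by omega) (Or.inr (by omega)), φ.level_out hi (by omega) (Or.inl rfl)] at this

/-- The levels along 0, 1, …, n + 1 move by one and never turn back, so they are monotone; n + 1
steps inside the interval from 0 to n + 1 leave only the identity and the reversal. -/
theorem level_cases (hn : 1 ≤ n) :
    (∀ i, i ≤ n + 1 → φ.level i = i) ∨ ∀ i, i ≤ n + 1 → φ.level i = n + 1 - i := by
  have hle := φ.level_le
  rcases φ.level_step (i := 1) (j := 0) ⟨le_rfl, hn⟩ (Or.inr rfl) with h | h
  · have key : ∀ i, i ≤ n → φ.level i = φ.level (i + 1) + 1 ∧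
        φ.level 0 = φ.level (i + 1) + (i + 1) := by
      intro i hi
      induction i with
      | zero => exact ⟨h, h⟩
      | succ i ih =>
        have h₁ := ih (by omega)
        have h₂ := φ.level_ne (i := i + 1) ⟨by omega, hi⟩
        have h₃ := φ.level_step (i := i + 1) (j := i + 1 + 1) ⟨by omega, hi⟩ (Or.inl rfl)
        rw [Nat.add_sub_cancel] at h₂
        omega
    have h₁ := (key n le_rfl).2
    have h₂ := hle 0
    refine Or.inr fun i hi => ?_
    rcases i with _ | i
    · omega
    · have := (key i (by omega)).2
      omega
  · have key : ∀ i, i ≤ n → φ.level (i + 1) = φ.level i + 1 ∧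
        φ.level (i + 1) = φ.level 0 + (i + 1) := by
      intro i hi
      induction i with
      | zero => exact ⟨h, h⟩
      | succ i ih =>
        have h₁ := ih (by omega)
        have h₂ := φ.level_ne (i := i + 1) ⟨by omega, hi⟩
        have h₃ := φ.level_step (i := i + 1) (j := i + 1 + 1) ⟨by omega, hi⟩ (Or.inl rfl)
        rw [Nat.add_sub_cancel] at h₂
        omega
    have h₁ := (key n le_rfl).2
    have h₂ := hle (n + 1)
    refine Or.inl fun i hi => ?_
    rcases i with _ | i
    · omega
    · have := (key i (by omega)).2
      omega

/-- The height of the vertex `(0, r)`. -/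
def height (r : ℕ) : ℤ := if h : r ≤ n + 1 then (φ.pt 0 r h).ht else 0

theorem isEmbedding (hn : 1 ≤ n) : Q.IsEmbedding φ.embedding.{w} φ.level φ.height where
  lv_cases := φ.level_cases hn
  level x := (φ.level_eq (x.le.trans (Nat.le_succ n))).symm
  height x := by
    unfold height
    rw [dif_pos (x.le.trans (Nat.le_succ n))]
    rfl
  isHeight i j h := by
    have hm := Q.arrow_mem i j h
    unfold height
    rw [dif_pos (by omega), dif_pos (by omega)]
    exact MeshArrow.ht ((φ.arrow_iff _ _).1 (Or.inl ⟨rfl, Or.inl h⟩))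

end RepIso

/-! ### Existence of isomorphisms of repetitive quivers -/

open Classical in
/-- The height function of the extended quiver with value `0` at the vertex `0`. -/
noncomputable def extHeight (Q : AnQuiver n) : ℕ → ℤ
  | 0 => 0
  | i + 1 => if Q.extArrow i (i + 1) then extHeight Q i + 1 else extHeight Q i - 1

theorem extHeight_of_extArrow (hn : 1 ≤ n) {i j : ℕ} (h : Q.extArrow i j) :
    Q.extHeight j = Q.extHeight i + 1 := by
  obtain ⟨-, -, rfl | rfl⟩ := extArrow_adj hn h
  · exact if_pos h
  · have : Q.extHeight (j + 1) = Q.extHeight j - 1 := if_neg (not_extArrow hn h)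
    omega

theorem extHeight_parity (Q : AnQuiver n) (i : ℕ) : ∃ k : ℤ, Q.extHeight i = 2 * k + i := by
  induction i with
  | zero => exact ⟨0, rfl⟩
  | succ i ih =>
    obtain ⟨k, hk⟩ := ih
    by_cases h : Q.extArrow i (i + 1)
    · exact ⟨k, by rw [extHeight, if_pos h, hk]; push_cast; ring⟩
    · exact ⟨k - 1, by rw [extHeight, if_neg h, hk]; push_cast; ring⟩

/-- The displacement of the vertex `(0, i)` in the mesh category. -/
noncomputable def shiftOf (Q : AnQuiver n) (i : ℕ) : ℤ := (Q.extHeight_parity i).choose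

theorem extHeight_eq (Q : AnQuiver n) (i : ℕ) : Q.extHeight i = 2 * Q.shiftOf i + i :=
  (Q.extHeight_parity i).choose_spec

/-- Levels are kept and k is shifted so that (k, i) gets the height 2k + `extHeight` i. On both
sides an arrow then joins neighbouring levels and raises the height by one. -/
theorem nonempty_repIso (hn : 1 ≤ n) (Q : AnQuiver n) : Nonempty Q.RepIso := by
  refine ⟨⟨⟨fun x => ⟨x.k + Q.shiftOf x.l, x.l, x.le⟩, fun x => ⟨x.k - Q.shiftOf x.l, x.l, x.le⟩,
    fun x => MeshPt.ext (add_sub_cancel_right _ _) rfl,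
    fun x => MeshPt.ext (sub_add_cancel _ _) rfl⟩, fun x y => ?_⟩⟩
  rw [MeshArrow.iff]
  change _ ↔ (2 * (y.k + Q.shiftOf y.l) + y.l = 2 * (x.k + Q.shiftOf x.l) + x.l + 1 ∧
    (y.l = x.l + 1 ∨ x.l = y.l + 1))
  have hx := Q.extHeight_eq x.l
  have hy := Q.extHeight_eq y.l
  have hxl := x.le
  have hyl := y.le
  constructor
  · rintro (⟨h₁, h₂⟩ | ⟨h₁, h₂⟩)
    · have h₃ := extHeight_of_extArrow hn h₂
      have h₄ := extArrow_adj hn h₂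
      omega
    · have h₃ := extHeight_of_extArrow hn h₂
      have h₄ := extArrow_adj hn h₂
      omega
  · rintro ⟨h₁, h₂⟩
    have h₃ : Q.extArrow x.l y.l ∨ Q.extArrow y.l x.l := by
      by_cases h : 1 ≤ x.l ∧ x.l ≤ n
      · exact Q.extArrow_or h h₂
      · exact (Q.extArrow_or (i := y.l) (j := x.l) (by omega) h₂.symm).symm
    rcases h₃ with h₃ | h₃
    · have := extHeight_of_extArrow hn h₃
      exact Or.inl ⟨by omega, h₃⟩
    · have := extHeight_of_extArrow hn h₃
      exact Or.inr ⟨by omega, h₃⟩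

end AnQuiver

/-! ### Kan extensions along full functors to posets -/

namespace Prederivator

variable {D : Prederivator.{w,v,u}} {α : Type} [Preorder α] {A : Type w} [SmallCategory A]

theorem IsDerivator.fullyFaithfulFrom_val_prod_iff (hD : D.IsDerivator) (S : Set α)
    (X : D.Diag (Pos.{w} α × A)) :
    FullyFaithfulFrom (D.res ((Pos.val.{w} S).prod (𝟭 A))) X ↔
      ∀ a, ∀ b ∈ Set.univ, D.ColimOn S b ((D.res (Prod.sectL (Pos.{w} α) a)).obj X) := by
  rw [hD.fullyFaithfulFrom_prod_iff]
  refine forall_congr' fun a => ?_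
  have h := hD.fullyFaithfulFrom_pos_iff (Subtype.val : S → α) (fun _ _ h => h) id (fun _ _ h => h)
    ((D.res (Prod.sectL (Pos.{w} α) a)).obj X)
  have h' : Pos.map.{w} (id : α → α) (fun _ _ h => h) = 𝟭 _ := rfl
  rw [h', D.res_id_obj] at h
  have key : ∀ b, D.IsColimAt (Pos.cocone.{w} (fun x : {x : S // x.1 ≤ b} => x.1.1) (fun _ _ h => h) b
      fun x => x.2) ((D.res (Prod.sectL (Pos.{w} α) a)).obj X) ↔
        D.ColimOn S b ((D.res (Prod.sectL (Pos.{w} α) a)).obj X) := fun b => isColimAt_cocone_iff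
      (l := fun x : {x // x ∈ S ∧ x ≤ b} => (⟨⟨x.1, x.2.1⟩, x.2.2⟩ : {x : S // x.1 ≤ b}))
      (r := fun x => ⟨x.1.1, x.1.2, x.2⟩) (fun _ _ => Iff.rfl) (fun x : {x // x ∈ S ∧ x ≤ b} => x.1)
      (fun _ _ h => h) b (fun x => x.2.2) _
  exact h.trans ⟨fun h b _ => (key b).1 (h b), fun h b => (key b).2 (h b trivial)⟩

variable {J : Type w} [SmallCategory J] [Quiver.IsThin J]

/-- The functor is an equivalence onto its image, and restriction along an equivalence affects no
bijection on morphisms. -/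
theorem IsDerivator.fullyFaithfulFrom_image_prod_iff (hD : D.IsDerivator) (S : Set α)
    (p : J ⥤ Pos.{w} α) [p.Full] (hp : ∀ x, x ∈ S ↔ ∃ j, p.obj j = ⟨x⟩) (X : D.Diag (Pos.{w} α × A)) :
    FullyFaithfulFrom (D.res (p.prod (𝟭 A))) X ↔
      ∀ a, ∀ b ∈ Set.univ, D.ColimOn S b ((D.res (Prod.sectL (Pos.{w} α) a)).obj X) := by
  obtain ⟨e, he, rfl⟩ := exists_equivalence_of_image S p hp
  rw [res_comp_prod, ← hD.fullyFaithfulFrom_val_prod_iff]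
  exact fullyFaithfulFrom_comp_iff _ _ _ (fullyFaithfulFrom_of_fullyFaithful _ _)

theorem IsDerivator.fullyFaithfulTo_image_prod_iff (hD : D.IsDerivator) (S : Set α)
    (p : J ⥤ Pos.{w} α) [p.Full] (hp : ∀ x, x ∈ S ↔ ∃ j, p.obj j = ⟨x⟩) (X : D.Diag (Pos.{w} α × A)) :
    FullyFaithfulTo (D.res (p.prod (𝟭 A))) X ↔
      ∀ a, ∀ b ∈ Set.univ, D.LimOn S b ((D.res (Prod.sectL (Pos.{w} α) a)).obj X) := by
  obtain ⟨e, he, rfl⟩ := exists_equivalence_of_image S p hp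
  rw [res_comp_prod, ← hD.fullyFaithfulTo_val_prod_iff]
  exact fullyFaithfulTo_comp_iff _ _ _ (fullyFaithfulTo_of_fullyFaithful _ _)

end Prederivator

namespace AnQuiver

variable {n : ℕ} {Q : AnQuiver n} {s : ℕ → ℤ}

/-! ### Reflected quivers -/

theorem IsHeight.congr (hs : Q.IsHeight s) {s' : ℕ → ℤ} (h : ∀ i, 1 ≤ i ∧ i ≤ n → s' i = s i) :
    Q.IsHeight s' := fun i j hij => by
  have := Q.arrow_mem i j hij
  rw [h i this.1, h j this.2.1]
  exact hs i j hij

/-- The neighbours of a sink lie one below it, and after reversal it must lie one below them. -/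
theorem IsHeight.reflect_sink (hs : Q.IsHeight s) {a : ℕ} (ha : Q.IsSink a) :
    (Q.reflect a).IsHeight fun i => if i = a then s i - 2 else s i := by
  intro i j h
  change (if i = a ∨ j = a then Q.Arrow j i else Q.Arrow i j) at h
  change (if j = a then s j - 2 else s j) = (if i = a then s i - 2 else s i) + 1
  have hij : i ≠ j := by
    rintro rfl
    rw [ite_self] at h
    have := Q.arrow_mem _ _ h
    omega
  by_cases hi : i = a
  · subst hi
    rw [if_pos (Or.inl rfl)] at h
    have := hs _ _ h
    rw [if_neg (Ne.symm hij), if_pos rfl]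
    omega
  · by_cases hj : j = a
    · subst hj
      rw [if_pos (Or.inr rfl)] at h
      exact absurd h (ha.2 _)
    · rw [if_neg (fun h' => h'.elim hi hj)] at h
      rw [if_neg hi, if_neg hj]
      exact hs _ _ h

/-- The opposite quiver. -/
def op (Q : AnQuiver n) : AnQuiver n where
  Arrow i j := Q.Arrow j i
  arrow_mem i j h := by
    obtain ⟨h1, h2, h3⟩ := Q.arrow_mem j i h
    exact ⟨h2, h1, h3.symm⟩
  orient i h1 h2 := (Q.orient i h1 h2).symm

theorem reflect_op (Q : AnQuiver n) (a : ℕ) : Q.op.reflect a = (Q.reflect a).op := by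
  ext i j
  change (if i = a ∨ j = a then Q.Arrow i j else Q.Arrow j i) ↔
    (if j = a ∨ i = a then Q.Arrow i j else Q.Arrow j i)
  by_cases h : i = a ∨ j = a
  · rw [if_pos h, if_pos h.symm]
  · rw [if_neg h, if_neg fun h' => h h'.symm]

theorem sinkChain_op (as : List ℕ) : ∀ Q : AnQuiver n, Q.op.SinkChain as ↔ Q.SourceChain as := by
  induction as with
  | nil => exact fun _ => Iff.rfl
  | cons a as ih =>
    intro Q
    unfold SinkChain SourceChain
    rw [reflect_op, ih]
    exact Iff.rfl

theorem IsHeight.op (hs : Q.IsHeight s) : Q.op.IsHeight fun i => - s i := fun i j h => by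
  have := hs j i h
  beta_reduce
  omega

theorem IsHeight.reflect_source (hs : Q.IsHeight s) {a : ℕ} (ha : Q.IsSource a) :
    (Q.reflect a).IsHeight fun i => if i = a then s i + 2 else s i := by
  intro i j h
  have h' : (Q.op.reflect a).Arrow j i := by
    rw [reflect_op]
    exact h
  have := hs.op.reflect_sink ha j i h'
  beta_reduce at this ⊢
  split_ifs at this ⊢ <;> omega

/-! ### Admissible sequences -/

/-- R collects the vertices still to be reflected; those already reflected are two lower. A vertex
of R of maximal height is a sink: its neighbours in R are not higher, and the others have dropped.
-/
theorem IsHeight.exists_sinkChain (s : ℕ → ℤ) (R : Finset ℕ) (hR : ∀ i ∈ R, 1 ≤ i ∧ i ≤ n)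
    (hs : ∀ i j, 1 ≤ i ∧ i ≤ n → 1 ≤ j ∧ j ≤ n → (j = i + 1 ∨ i = j + 1) → s j = s i + 1 ∨ s i = s j + 1)
    (Q : AnQuiver n) (hQ : Q.IsHeight fun i => if i ∈ R then s i else s i - 2) :
    ∃ as : List ℕ, as.Nodup ∧ (∀ a, a ∈ as ↔ a ∈ R) ∧ Q.SinkChain as := by
  induction hm : R.card generalizing R Q with
  | zero =>
    rw [Finset.card_eq_zero] at hm
    subst hm
    exact ⟨[], List.nodup_nil, by simp, trivial⟩
  | succ m ih =>
    obtain ⟨a, ha, hmax⟩ := R.exists_max_image s (Finset.card_pos.1 (by omega))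
    have hsink : Q.IsSink a := by
      refine ⟨hR a ha, fun j h => ?_⟩
      have h₁ := Q.arrow_mem a j h
      have h₂ := hQ a j h
      have h₃ := hs a j h₁.1 h₁.2.1 h₁.2.2
      beta_reduce at h₂
      rw [if_pos ha] at h₂
      split_ifs at h₂ with hj
      · have := hmax j hj
        omega
      · omega
    obtain ⟨as, h₁, h₂, h₃⟩ := ih (R.erase a) (fun i hi => hR i (Finset.mem_of_mem_erase hi))
      (Q.reflect a) ((hQ.reflect_sink hsink).congr fun i _ => by
        by_cases hi : i = a
        · subst hi
          simp [ha]
        · simp [hi]) (by rw [Finset.card_erase_of_mem ha]; omega)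
    refine ⟨a :: as, List.nodup_cons.2 ⟨fun h => ?_, h₁⟩, fun b => ?_, hsink, h₃⟩
    · exact absurd rfl (Finset.ne_of_mem_erase ((h₂ a).1 h))
    · rw [List.mem_cons, h₂, Finset.mem_erase]
      by_cases hb : b = a
      · subst hb
        simp [ha]
      · simp [hb]

theorem isHeight_extHeight (hn : 1 ≤ n) (Q : AnQuiver n) : Q.IsHeight Q.extHeight := fun _ _ h =>
  extHeight_of_extArrow hn (Or.inl h)

theorem exists_isAdmissibleSinks (hn : 1 ≤ n) (Q : AnQuiver n) : ∃ as, Q.IsAdmissibleSinks as := by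
  have hs := isHeight_extHeight hn Q
  obtain ⟨as, h₁, h₂, h₃⟩ := IsHeight.exists_sinkChain Q.extHeight (Finset.Icc 1 n)
    (fun i hi => Finset.mem_Icc.1 hi) (fun i j hi hj h => hs.step hi hj h) Q
    (hs.congr fun i hi => if_pos (Finset.mem_Icc.2 hi))
  exact ⟨as, h₁, fun a => (h₂ a).trans Finset.mem_Icc, h₃⟩

theorem exists_isAdmissibleSources (hn : 1 ≤ n) (Q : AnQuiver n) : ∃ bs, Q.IsAdmissibleSources bs := by
  obtain ⟨bs, h₁, h₂, h₃⟩ := exists_isAdmissibleSinks hn Q.op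
  exact ⟨bs, h₁, h₂, (sinkChain_op bs Q).1 h₃⟩

/-- The arrows can be read off from differences of heights. -/
theorem IsHeight.eq_of_const {Q' : AnQuiver n} (hs : Q.IsHeight s) {s' : ℕ → ℤ} (hs' : Q'.IsHeight s')
    (c : ℤ) (h : ∀ i, 1 ≤ i ∧ i ≤ n → s' i = s i + c) : Q' = Q := by
  ext i j
  rw [hs.arrow_iff, hs'.arrow_iff]
  refine and_congr_right fun hi => and_congr_right fun hj => and_congr_right fun _ => ?_
  rw [h i hi, h j hj]
  omega

end AnQuiver

/-! ### Vertices by height and level, and restrictions of exact diagrams -/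

theorem monotone_sq {α : Type*} [Preorder α] (f : Sq → α) (h₁ : f (0, 0) ≤ f (1, 0))
    (h₂ : f (0, 0) ≤ f (0, 1)) (h₃ : f (1, 0) ≤ f (1, 1)) (h₄ : f (0, 1) ≤ f (1, 1)) : Monotone f := by
  rintro ⟨a, b⟩ ⟨c, d⟩ ⟨hac, hbd⟩
  fin_cases a <;> fin_cases b <;> fin_cases c <;> fin_cases d <;>
    first
    | exact le_refl _
    | exact h₁
    | exact h₂
    | exact h₃
    | exact h₄
    | exact h₁.trans h₃
    | exact absurd hac (by decide)
    | exact absurd hbd (by decide)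

namespace MeshPt

variable {n : ℕ}

/-- The vertex with given height and level, which must have the same parity. -/
def ofHt (h : ℤ) (l : ℕ) (hl : l ≤ n + 1) : MeshPt n := ⟨(h - l) / 2, l, hl⟩

theorem ht_ofHt {h : ℤ} {l : ℕ} (hl : l ≤ n + 1) (hp : ∃ k : ℤ, h = 2 * k + l) :
    (ofHt h l hl).ht = h := by
  obtain ⟨k, rfl⟩ := hp
  change 2 * ((2 * k + l - l) / 2) + (l : ℤ) = _
  omega

end MeshPt

namespace Prederivator

variable {n : ℕ} (D : Prederivator.{w,v,u}) {J K : Type w} [SmallCategory J] [SmallCategory K]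

/-- The restriction of exact diagrams on the mesh category along a functor. -/
def restrEx (p : J ⥤ Mesh.{w} n) : Mor (D.meshEx n) (D.shift J) :=
  incl _ (D.arProp n) (D.arProp_map n) ≫ D.resMor p

theorem nonempty_restrEx_comp (p : J ⥤ K) (q : K ⥤ Mesh.{w} n) :
    Nonempty (D.restrEx (p ⋙ q) ≅ D.restrEx q ≫ D.resMor p) := by
  obtain ⟨i⟩ := nonempty_resMor_comp (D := D) p q
  exact ⟨Bicategory.whiskerLeftIso _ i ≪≫ (α_ _ _ _).symm⟩

theorem restrEx_sectL {D : Prederivator.{w,v,u}} {A : Cat.{w,w}ᵒᵖ} (X : (D.meshEx n).obj A)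
    (p : J ⥤ Mesh.{w} n) (c : A.unop) :
    ∃ Y : D.Diag (Mesh.{w} n), D.IsARDiagram n Y ∧
      (D.res (Prod.sectL J c)).obj (((D.restrEx p).app A).toFunctor.obj X) = (D.res p).obj Y := by
  refine ⟨(D.res (Prod.sectL (Mesh.{w} n) c)).obj X.obj, X.property c, ?_⟩
  refine (D.res_comp_obj (Prod.sectL J c) (p.prod (𝟭 A.unop)) X.obj).symm.trans ?_
  exact D.res_comp_obj p (Prod.sectL (Mesh.{w} n) c) X.obj

theorem IsARDiagram.isZero {D : Prederivator.{w,v,u}} {Y : D.Diag (Mesh.{w} n)} (hY : D.IsARDiagram n Y)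
    (p : J ⥤ Mesh.{w} n) (j : J) (h : (p.obj j).pt.l = 0 ∨ (p.obj j).pt.l = n + 1) :
    Limits.IsZero ((D.ev j).obj ((D.res p).obj Y)) := by
  have e : (D.ev j).obj ((D.res p).obj Y) = (D.ev (p.obj j)).obj Y := ev_res_obj D p j Y
  rw [e]
  rcases h with h | h
  · have h' : p.obj j = ⟨⟨(p.obj j).pt.k, 0, by omega⟩⟩ := Pos.ext (MeshPt.ext rfl h)
    rw [h']
    exact hY.zero_bot _
  · have h' : p.obj j = ⟨⟨(p.obj j).pt.k, n + 1, le_rfl⟩⟩ := Pos.ext (MeshPt.ext rfl h)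
    rw [h']
    exact hY.zero_top _

end Prederivator

/-! ### Reflection at a sink moves a section -/

namespace AnQuiver

variable {n : ℕ} {Q : AnQuiver n} {e : (Q.Free : Type w) ⥤ Mesh.{w} n} {lv : ℕ → ℕ} {s : ℕ → ℤ} {a : ℕ}

theorem SinkShape.not_le_new {x : SinkShape Q a} (hx : x ≠ .new) : ¬ x ≤ .new := fun h => by
  rcases Relation.ReflTransGen.cases_tail h with h | ⟨z, -, hz⟩
  · exact hx h.symm
  · cases z <;> exact hz.elim

/-- The image of Q is a cosieve: an arrow between old vertices is an arrow of Q or ends at a, so it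
ends in Q in either case. -/
theorem SinkShape.mem_image_of_le (ha : 1 ≤ a ∧ a ≤ n) {b : SinkShapeOld Q a} (j : (Q.Free : Type w))
    (h : ((Q.sinkIn.{w} a).obj j).pt ≤ b) : ∃ j, (Q.sinkIn.{w} a).obj j = ⟨b⟩ := by
  rcases Relation.ReflTransGen.cases_tail (show Relation.ReflTransGen SinkShape.Arrow _ b.1 from h) with
    h | ⟨z, hz, hzb⟩
  · exact ⟨j, Pos.ext (Subtype.ext h.symm)⟩
  · obtain ⟨b, hb⟩ := b
    cases z with
    | new => exact absurd hz (SinkShape.not_le_new fun h => by cases h)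
    | old i hi =>
      cases b with
      | new => exact absurd rfl hb
      | old l hl =>
        have h' : 1 ≤ l ∧ l ≤ n := by
          rcases hzb with h | ⟨rfl, -⟩
          · exact (Q.arrow_mem _ _ h).2.1
          · exact ha
        exact ⟨(⟨l, h'.1, h'.2⟩ : (Q.Vert : Type w)), rfl⟩

namespace IsEmbedding

theorem lv_le (he : Q.IsEmbedding e lv s) {i : ℕ} (hi : i ≤ n + 1) : lv i ≤ n + 1 := by
  rcases he.lv_cases with h | h <;> (rw [h i hi]; omega)

theorem lv_bdry (he : Q.IsEmbedding e lv s) {i : ℕ} (hi : i = 0 ∨ i = n + 1) :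
    lv i = 0 ∨ lv i = n + 1 := by
  rcases he.lv_cases with h | h <;> (rw [h i (by omega)]; omega)

/-- The embedding may reverse the line, so which of a − 1 and a + 1 sits on the level above that of
a depends on `lv`. -/
theorem exists_neighbours (he : Q.IsEmbedding e lv s) (ha : 1 ≤ a ∧ a ≤ n) :
    ∃ u d, (u + 1 = a ∨ u = a + 1) ∧ (d + 1 = a ∨ d = a + 1) ∧ u + d = 2 * a ∧ lv u = lv a + 1 ∧
      lv a = lv d + 1 := by
  obtain ⟨a, rfl⟩ : ∃ a', a = a' + 1 := ⟨a - 1, by omega⟩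
  rcases he.lv_cases with h | h
  · refine ⟨a + 2, a, Or.inr rfl, Or.inl rfl, by ring, ?_, ?_⟩ <;>
      (rw [h _ (by omega), h _ (by omega)])
  · refine ⟨a, a + 2, Or.inl rfl, Or.inr rfl, by ring, ?_, ?_⟩ <;>
      (rw [h _ (by omega), h _ (by omega)]; omega)

/-- The height at which a vertex `l` of the shape of a reflection at a sink is placed. -/
def sinkHt (n : ℕ) (s : ℕ → ℤ) (a l : ℕ) : ℤ := if 1 ≤ l ∧ l ≤ n then s l else s a - 1

theorem sinkHt_parity (he : Q.IsEmbedding e lv s) (ha : Q.IsSink a) {l : ℕ}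
    (h : (1 ≤ l ∧ l ≤ n) ∨ l + 1 = a ∨ l = a + 1) : ∃ k : ℤ, sinkHt n s a l = 2 * k + lv l := by
  unfold sinkHt
  split_ifs with hl
  · exact he.parity hl
  · have ha' := ha.1
    obtain ⟨k, hk⟩ := he.parity ha.1
    rcases he.lv_step (i := a) (j := l) (by omega) (by omega) (by omega) with h' | h'
    · exact ⟨k - 1, by rw [h']; push_cast; omega⟩
    · exact ⟨k, by rw [h'] at hk; push_cast at hk; omega⟩

theorem sinkHt_adj (he : Q.IsEmbedding e lv s) (ha : Q.IsSink a) {l : ℕ} (h : l + 1 = a ∨ l = a + 1) :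
    sinkHt n s a l = s a - 1 := by
  unfold sinkHt
  split_ifs with hl
  · have := he.isHeight l a ((Q.arrow_or_arrow hl ha.1 (by omega)).resolve_right (ha.2 _))
    omega
  · rfl

/-- The placement of the shape of a reflection at a sink in the mesh category. -/
def sinkPt (he : Q.IsEmbedding e lv s) (ha : Q.IsSink a) : SinkShape Q a → MeshPt n
  | .old l h => MeshPt.ofHt (sinkHt n s a l) (lv l) (he.lv_le (by have := ha.1; omega))
  | .new => MeshPt.ofHt (s a - 2) (lv a) (he.lv_le (by have := ha.1; omega))

theorem sinkPt_old_ht (he : Q.IsEmbedding e lv s) (ha : Q.IsSink a) (l : ℕ) (h) :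
    (he.sinkPt ha (.old l h)).ht = sinkHt n s a l :=
  MeshPt.ht_ofHt _ (he.sinkHt_parity ha h)

theorem sinkPt_new_ht (he : Q.IsEmbedding e lv s) (ha : Q.IsSink a) :
    (he.sinkPt ha .new).ht = s a - 2 := by
  obtain ⟨k, hk⟩ := he.parity ha.1
  exact MeshPt.ht_ofHt _ ⟨k - 1, by rw [hk]; ring⟩

theorem sinkPt_mono (he : Q.IsEmbedding e lv s) (ha : Q.IsSink a) : Monotone (he.sinkPt ha) := by
  intro x y h
  have ha' := ha.1
  refine Relation.ReflTransGen.lift (r := SinkShape.Arrow) (he.sinkPt ha) (fun x y hxy => ?_) _ _ h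
  refine MeshArrow.iff.2 ?_
  cases x with
  | old i hi =>
    cases y with
    | old j hj =>
      rw [he.sinkPt_old_ht, he.sinkPt_old_ht]
      rcases hxy with hxy | ⟨rfl, hxy⟩
      · have h₁ := Q.arrow_mem i j hxy
        refine ⟨?_, he.lv_step (by omega) (by omega) h₁.2.2⟩
        unfold sinkHt
        rw [if_pos h₁.1, if_pos h₁.2.1]
        exact he.isHeight i j hxy
      · refine ⟨?_, he.lv_step (by omega) (by omega) (by omega)⟩
        rw [he.sinkHt_adj ha hxy]
        unfold sinkHt
        rw [if_pos ha']
        omega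
    | new => exact hxy.elim
  | new =>
    cases y with
    | old j hj =>
      rw [he.sinkPt_old_ht, he.sinkPt_new_ht, he.sinkHt_adj ha hxy]
      change j + 1 = a ∨ j = a + 1 at hxy
      exact ⟨by ring, he.lv_step (by omega) (by omega) (by omega)⟩
    | new => exact hxy.elim

/-- The placement of the shape of a reflection at a sink in the mesh category, as a functor. -/
def sinkFunctor (he : Q.IsEmbedding e lv s) (ha : Q.IsSink a) : Pos.{w} (SinkShape Q a) ⥤ Mesh.{w} n :=
  Pos.map (he.sinkPt ha) (he.sinkPt_mono ha)

theorem sinkIn_comp (he : Q.IsEmbedding e lv s) (ha : Q.IsSink a) :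
    Q.sinkIn a ⋙ Q.sinkMid a ⋙ he.sinkFunctor ha = e := by
  refine CategoryTheory.Functor.ext (fun x => Pos.ext (MeshPt.ext_ht ?_ ?_)) fun _ _ _ =>
    Subsingleton.elim _ _
  · exact (he.level x).symm
  · refine (he.sinkPt_old_ht ha x.pos (Or.inl ⟨x.one_le, x.le⟩)).trans ?_
    unfold sinkHt
    rw [if_pos ⟨x.one_le, x.le⟩]
    exact (he.height x).symm

/-- The embedding of Q in the mesh category is full and factors through the shape by a faithful
functor. -/
theorem full_sinkIn (he : Q.IsEmbedding e lv s) (ha : Q.IsSink a) : (Q.sinkIn.{w} a).Full := by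
  have : (Q.sinkIn a ⋙ Q.sinkMid a ⋙ he.sinkFunctor ha).Full := by
    rw [he.sinkIn_comp]
    exact he.full
  exact Functor.Full.of_comp_faithful (Q.sinkIn a) (Q.sinkMid a ⋙ he.sinkFunctor ha)

theorem sinkOut_comp (he : Q.IsEmbedding e lv s) (ha : Q.IsSink a) :
    (Q.reflect a).IsEmbedding (Q.sinkOut a ha ⋙ he.sinkFunctor ha) lv
      (fun i => if i = a then s i - 2 else s i) where
  lv_cases := he.lv_cases
  level x := by
    change (he.sinkPt ha (sinkOutObj Q a x)).l = _
    unfold sinkOutObj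
    split_ifs with h
    · rw [h]
      rfl
    · rfl
  height x := by
    change (he.sinkPt ha (sinkOutObj Q a x)).ht = _
    unfold sinkOutObj
    split_ifs with h
    · rw [he.sinkPt_new_ht, h]
    · rw [he.sinkPt_old_ht]
      unfold sinkHt
      rw [if_pos ⟨x.one_le, x.le⟩]
  isHeight := he.isHeight.reflect_sink ha

variable {D : Prederivator.{w,v,u}}

/-- An added vertex has no vertex of Q below it, so the condition there is vanishing. It holds
because the vertex is placed on the boundary of the mesh category. -/
theorem fullyFaithfulFrom_sinkIn (he : Q.IsEmbedding e lv s) (ha : Q.IsSink a)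
    (hD : D.IsStableDerivator) (A : Cat.{w,w}ᵒᵖ) (X : (D.meshEx n).obj A) :
    FullyFaithfulFrom ((D.resMor (Q.sinkIn a)).app A).toFunctor
      (((D.restrEx (Q.sinkMid a ⋙ he.sinkFunctor ha)).app A).toFunctor.obj X) := by
  have := he.full_sinkIn ha
  have ha' := ha.1
  refine (hD.fullyFaithfulFrom_image_prod_iff {x | ∃ j, (Q.sinkIn.{w} a).obj j = ⟨x⟩} (Q.sinkIn a)
    (fun _ => Iff.rfl) _).2 fun c b _ => ?_
  by_cases hb : b ∈ {x | ∃ j, (Q.sinkIn.{w} a).obj j = ⟨x⟩}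
  · exact Prederivator.colimOn_of_mem hb _
  obtain ⟨Y, hY, hY'⟩ := Prederivator.restrEx_sectL X (Q.sinkMid a ⋙ he.sinkFunctor ha) c
  refine (hD.colimOn_iff_isZero hD.pointed ?_ _).2 ?_
  · rintro x ⟨j, hj⟩ h
    obtain rfl : x = _ := (congrArg Pos.pt hj).symm
    exact hb (SinkShape.mem_image_of_le ha.1 j h)
  · refine (congrArg (fun t => Limits.IsZero ((D.ev (⟨b⟩ : Pos.{w} (SinkShapeOld Q a))).obj t)) hY').mpr ?_
    refine hY.isZero _ _ ?_
    obtain ⟨b | b, hb'⟩ := b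
    · by_cases hl : 1 ≤ b ∧ b ≤ n
      · exact absurd ⟨⟨b, hl.1, hl.2⟩, rfl⟩ hb
      · exact he.lv_bdry (by omega)
    · exact absurd rfl hb'

/-- Only the new vertex imposes a condition. The limit there reduces to the square ending at a,
which is placed on a mesh square and hence becomes cartesian. -/
theorem fullyFaithfulTo_sinkMid (he : Q.IsEmbedding e lv s) (ha : Q.IsSink a)
    (hD : D.IsStableDerivator) (A : Cat.{w,w}ᵒᵖ) (X : (D.meshEx n).obj A) :
    FullyFaithfulTo ((D.resMor (Q.sinkMid a)).app A).toFunctor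
      (((D.restrEx (he.sinkFunctor ha)).app A).toFunctor.obj X) := by
  have ha' := ha.1
  refine (hD.fullyFaithfulTo_val_prod_iff {x : SinkShape Q a | x ≠ .new} _).2 fun c b _ => ?_
  cases b with
  | old l h => exact Prederivator.limOn_of_mem (fun h => by cases h) _
  | new =>
    obtain ⟨Y, hY, hY'⟩ := Prederivator.restrEx_sectL X (he.sinkFunctor ha) c
    refine (congrArg (Prederivator.LimOn D {x : SinkShape Q a | x ≠ .new} .new) hY').mpr ?_
    obtain ⟨u, d, hu, hd, hud, hu', hd'⟩ := he.exists_neighbours ha.1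
    let sq : Sq → SinkShape Q a := fun s =>
      if s.1 = 0 then if s.2 = 0 then .new else .old d (Or.inr hd)
      else if s.2 = 0 then .old u (Or.inr hu) else .old a (Or.inl ha.1)
    have hsq : Monotone sq := monotone_sq sq
      (Relation.ReflTransGen.single hu) (Relation.ReflTransGen.single hd)
      (Relation.ReflTransGen.single (Or.inr ⟨rfl, hu⟩)) (Relation.ReflTransGen.single (Or.inr ⟨rfl, hd⟩))
    refine (hD.limOn_iff_isCartesian sq hsq {x : SinkShape Q a | x ≠ .new} ?_ ?_ ?_ _).2 ?_
    · intro s hs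
      obtain rfl | rfl | rfl : s = (0, 1) ∨ s = (1, 0) ∨ s = (1, 1) := by
        revert s
        decide
      all_goals exact fun h => by cases h
    · intro x hx h
      rcases Relation.ReflTransGen.cases_head h with h | ⟨y, hy, h'⟩
      · exact absurd h.symm hx
      · cases y with
        | new => exact hy.elim
        | old l hl =>
          have : l = u ∨ l = d := by
            change l + 1 = a ∨ l = a + 1 at hy
            omega
          rcases this with rfl | rfl
          · exact Or.inl h'
          · exact Or.inr h'
    -- Common upper bounds of the two neighbours lie above a. This is read off in the mesh category
    -- and brought back through fullness of the embedding.
    · intro x hx h₁ h₂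
      cases x with
      | new => exact absurd rfl hx
      | old l hl =>
        change SinkShape.old u (Or.inr hu) ≤ _ at h₁
        change SinkShape.old d (Or.inr hd) ≤ _ at h₂
        have h₃ := MeshPt.le_iff_ht.1 (he.sinkPt_mono ha h₁)
        have h₄ := MeshPt.le_iff_ht.1 (he.sinkPt_mono ha h₂)
        change ((lv l : ℤ) - lv u ≤ _ ∧ (lv u : ℤ) - lv l ≤ _) at h₃
        change ((lv l : ℤ) - lv d ≤ _ ∧ (lv d : ℤ) - lv l ≤ _) at h₄
        rw [he.sinkPt_old_ht, he.sinkPt_old_ht, he.sinkHt_adj ha hu] at h₃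
        rw [he.sinkPt_old_ht, he.sinkPt_old_ht, he.sinkHt_adj ha hd] at h₄
        by_cases hl' : 1 ≤ l ∧ l ≤ n
        · have h₅ : (e.obj (⟨a, ha'.1, ha'.2⟩ : (Q.Vert : Type w))).pt ≤
              (e.obj (⟨l, hl'.1, hl'.2⟩ : (Q.Vert : Type w))).pt := by
            rw [MeshPt.le_iff_ht, he.level, he.level, he.height, he.height]
            unfold sinkHt at h₃ h₄
            rw [if_pos hl'] at h₃ h₄
            change (lv l : ℤ) - lv a ≤ s l - s a ∧ (lv a : ℤ) - lv l ≤ s l - s a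
            omega
          have := he.full
          exact Pos.le_of_hom ((Q.sinkIn.{w} a).map (e.preimage (Pos.homOf h₅)))
        -- An added vertex has the same height as both neighbours of a, so lying above both would
        -- force it onto two different levels.
        · unfold sinkHt at h₃ h₄
          rw [if_neg hl'] at h₃ h₄
          omega
    · have hdn : lv d < n := by
        have := he.lv_mem ha.1
        omega
      have e₁ : (D.res (Pos.map.{w} sq hsq)).obj ((D.res (he.sinkFunctor ha)).obj Y) =
          (D.res (Mesh.square.{w} (he.sinkPt ha .new).k (lv d) hdn)).obj Y := by
        refine D.res_res_obj (CategoryTheory.Functor.ext (fun x => Pos.ext ?_) fun _ _ _ =>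
          Subsingleton.elim _ _) Y
        change he.sinkPt ha (sq x.pt) = Mesh.squarePt (he.sinkPt ha .new).k (lv d) hdn x.pt
        obtain ⟨⟨i, j⟩⟩ := x
        have h₀ := he.sinkPt_new_ht ha
        have h₁ : (he.sinkPt ha .new).ht = 2 * (he.sinkPt ha .new).k + lv a := rfl
        fin_cases i <;> fin_cases j
        · exact MeshPt.ext rfl hd'
        · refine MeshPt.ext_ht rfl ((he.sinkPt_old_ht ha d _).trans ?_)
          change _ = 2 * ((he.sinkPt ha .new).k + 1) + (lv d : ℤ)
          rw [he.sinkHt_adj ha hd]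
          omega
        · refine MeshPt.ext_ht (hu'.trans (congrArg (· + 1) hd')) ((he.sinkPt_old_ht ha u _).trans ?_)
          change _ = 2 * (he.sinkPt ha .new).k + ((lv d + 2 : ℕ) : ℤ)
          rw [he.sinkHt_adj ha hu]
          omega
        · refine MeshPt.ext_ht hd' ((he.sinkPt_old_ht ha a _).trans ?_)
          change _ = 2 * ((he.sinkPt ha .new).k + 1) + ((lv d + 1 : ℕ) : ℤ)
          unfold sinkHt
          rw [if_pos ha']
          omega
      rw [e₁]
      exact hY.cartesian _ _ _

/-- A reflection functor at a sink sends the restriction of an exact diagram to a quiver placed in the mesh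
category to its restriction to the reflected quiver. -/
theorem nonempty_restrEx_sinkReflection (he : Q.IsEmbedding e lv s) (ha : Q.IsSink a)
    (hD : D.IsStableDerivator) {σ : Prederivator.Mor (D.rep Q) (D.rep (Q.reflect a))}
    (hσ : D.IsSinkReflection Q a ha σ) :
    Nonempty (D.restrEx e ≫ σ ≅ D.restrEx (Q.sinkOut a ha ⋙ he.sinkFunctor ha)) := by
  obtain ⟨L, R, ⟨adjL⟩, ⟨adjR⟩, ⟨i⟩⟩ := hσ
  -- The restriction of an exact diagram to the shape already is what the two Kan extensions produce
  -- from its restriction to Q, so each of them undoes a restriction.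
  obtain ⟨i₁⟩ := Prederivator.nonempty_comp_counit_iso adjL
    (D.restrEx (Q.sinkMid a ⋙ he.sinkFunctor ha)) (he.fullyFaithfulFrom_sinkIn ha hD)
  obtain ⟨i₂⟩ := Prederivator.nonempty_comp_unit_iso adjR
    (D.restrEx (he.sinkFunctor ha)) (he.fullyFaithfulTo_sinkMid ha hD)
  obtain ⟨i₃⟩ := D.nonempty_restrEx_comp (Q.sinkIn a) (Q.sinkMid a ⋙ he.sinkFunctor ha)
  obtain ⟨i₄⟩ := D.nonempty_restrEx_comp (Q.sinkMid a) (he.sinkFunctor ha)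
  obtain ⟨i₅⟩ := D.nonempty_restrEx_comp (Q.sinkOut a ha) (he.sinkFunctor ha)
  rw [he.sinkIn_comp] at i₃
  have i₆ : D.restrEx e ≫ L ≅ D.restrEx (Q.sinkMid a ⋙ he.sinkFunctor ha) :=
    Bicategory.whiskerRightIso i₃ L ≪≫ α_ _ _ _ ≪≫ i₁
  have i₇ : D.restrEx (Q.sinkMid a ⋙ he.sinkFunctor ha) ≫ R ≅ D.restrEx (he.sinkFunctor ha) :=
    Bicategory.whiskerRightIso i₄ R ≪≫ α_ _ _ _ ≪≫ i₂
  exact ⟨Bicategory.whiskerLeftIso _ i ≪≫ (α_ _ _ _).symm ≪≫ Bicategory.whiskerRightIso i₆ _ ≪≫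
    (α_ _ _ _).symm ≪≫ Bicategory.whiskerRightIso i₇ _ ≪≫ i₅.symm⟩

end IsEmbedding

end AnQuiver

/-! ### Reflection at a source moves a section -/

namespace AnQuiver

variable {n : ℕ} {Q : AnQuiver n} {e : (Q.Free : Type w) ⥤ Mesh.{w} n} {lv : ℕ → ℕ} {s : ℕ → ℤ} {a : ℕ}

theorem SourceShape.not_new_le {x : SourceShape Q a} (hx : x ≠ .new) : ¬ .new ≤ x := fun h => by
  rcases Relation.ReflTransGen.cases_head h with h | ⟨z, hz, -⟩
  · exact hx h.symm
  · cases z <;> exact hz.elim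

/-- The image of Q is a sieve: the arrows added between old vertices all start at the source a. -/
theorem SourceShape.mem_image_of_le (ha : 1 ≤ a ∧ a ≤ n) {b : SourceShapeOld Q a} (j : (Q.Free : Type w))
    (h : b ≤ ((Q.sourceIn.{w} a).obj j).pt) : ∃ j, (Q.sourceIn.{w} a).obj j = ⟨b⟩ := by
  rcases Relation.ReflTransGen.cases_head (show Relation.ReflTransGen SourceShape.Arrow b.1 _ from h) with
    h | ⟨z, hzb, hz⟩
  · exact ⟨j, Pos.ext (Subtype.ext h.symm)⟩
  · obtain ⟨b, hb⟩ := b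
    cases z with
    | new => exact absurd hz (SourceShape.not_new_le fun h => by cases h)
    | old i hi =>
      cases b with
      | new => exact absurd rfl hb
      | old l hl =>
        have h' : 1 ≤ l ∧ l ≤ n := by
          rcases hzb with h | ⟨rfl, -⟩
          · exact (Q.arrow_mem _ _ h).1
          · exact ha
        exact ⟨(⟨l, h'.1, h'.2⟩ : (Q.Vert : Type w)), rfl⟩

namespace IsEmbedding

/-- The height at which a vertex `l` of the shape of a reflection at a source is placed. -/
def sourceHt (n : ℕ) (s : ℕ → ℤ) (a l : ℕ) : ℤ := if 1 ≤ l ∧ l ≤ n then s l else s a + 1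

theorem sourceHt_parity (he : Q.IsEmbedding e lv s) (ha : Q.IsSource a) {l : ℕ}
    (h : (1 ≤ l ∧ l ≤ n) ∨ l + 1 = a ∨ l = a + 1) : ∃ k : ℤ, sourceHt n s a l = 2 * k + lv l := by
  unfold sourceHt
  split_ifs with hl
  · exact he.parity hl
  · have ha' := ha.1
    obtain ⟨k, hk⟩ := he.parity ha.1
    rcases he.lv_step (i := a) (j := l) (by omega) (by omega) (by omega) with h' | h'
    · exact ⟨k, by rw [h']; push_cast; omega⟩
    · exact ⟨k + 1, by rw [h'] at hk; push_cast at hk; omega⟩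

theorem sourceHt_adj (he : Q.IsEmbedding e lv s) (ha : Q.IsSource a) {l : ℕ} (h : l + 1 = a ∨ l = a + 1) :
    sourceHt n s a l = s a + 1 := by
  unfold sourceHt
  split_ifs with hl
  · have := he.isHeight a l ((Q.arrow_or_arrow hl ha.1 (by omega)).resolve_left (ha.2 _))
    omega
  · rfl

/-- The placement of the shape of a reflection at a source in the mesh category. -/
def sourcePt (he : Q.IsEmbedding e lv s) (ha : Q.IsSource a) : SourceShape Q a → MeshPt n
  | .old l h => MeshPt.ofHt (sourceHt n s a l) (lv l) (he.lv_le (by have := ha.1; omega))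
  | .new => MeshPt.ofHt (s a + 2) (lv a) (he.lv_le (by have := ha.1; omega))

theorem sourcePt_old_ht (he : Q.IsEmbedding e lv s) (ha : Q.IsSource a) (l : ℕ) (h) :
    (he.sourcePt ha (.old l h)).ht = sourceHt n s a l :=
  MeshPt.ht_ofHt _ (he.sourceHt_parity ha h)

theorem sourcePt_new_ht (he : Q.IsEmbedding e lv s) (ha : Q.IsSource a) :
    (he.sourcePt ha .new).ht = s a + 2 := by
  obtain ⟨k, hk⟩ := he.parity ha.1
  exact MeshPt.ht_ofHt _ ⟨k + 1, by rw [hk]; ring⟩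

theorem sourcePt_mono (he : Q.IsEmbedding e lv s) (ha : Q.IsSource a) : Monotone (he.sourcePt ha) := by
  intro x y h
  have ha' := ha.1
  refine Relation.ReflTransGen.lift (r := SourceShape.Arrow) (he.sourcePt ha) (fun x y hxy => ?_) _ _ h
  refine MeshArrow.iff.2 ?_
  cases x with
  | old i hi =>
    cases y with
    | old j hj =>
      rw [he.sourcePt_old_ht, he.sourcePt_old_ht]
      rcases hxy with hxy | ⟨rfl, hxy⟩
      · have h₁ := Q.arrow_mem i j hxy
        refine ⟨?_, he.lv_step (by omega) (by omega) h₁.2.2⟩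
        unfold sourceHt
        rw [if_pos h₁.1, if_pos h₁.2.1]
        exact he.isHeight i j hxy
      · refine ⟨?_, he.lv_step (by omega) (by omega) (by omega)⟩
        rw [he.sourceHt_adj ha hxy]
        unfold sourceHt
        rw [if_pos ha']
    | new =>
      rw [he.sourcePt_old_ht, he.sourcePt_new_ht, he.sourceHt_adj ha hxy]
      change i + 1 = a ∨ i = a + 1 at hxy
      exact ⟨by ring, he.lv_step (by omega) (by omega) (by omega)⟩
  | new => exact hxy.elim

/-- The placement of the shape of a reflection at a source in the mesh category, as a functor. -/
def sourceFunctor (he : Q.IsEmbedding e lv s) (ha : Q.IsSource a) : Pos.{w} (SourceShape Q a) ⥤ Mesh.{w} n :=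
  Pos.map (he.sourcePt ha) (he.sourcePt_mono ha)

theorem sourceIn_comp (he : Q.IsEmbedding e lv s) (ha : Q.IsSource a) :
    Q.sourceIn a ⋙ Q.sourceMid a ⋙ he.sourceFunctor ha = e := by
  refine CategoryTheory.Functor.ext (fun x => Pos.ext (MeshPt.ext_ht ?_ ?_)) fun _ _ _ =>
    Subsingleton.elim _ _
  · exact (he.level x).symm
  · refine (he.sourcePt_old_ht ha x.pos (Or.inl ⟨x.one_le, x.le⟩)).trans ?_
    unfold sourceHt
    rw [if_pos ⟨x.one_le, x.le⟩]
    exact (he.height x).symm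

theorem full_sourceIn (he : Q.IsEmbedding e lv s) (ha : Q.IsSource a) : (Q.sourceIn.{w} a).Full := by
  have : (Q.sourceIn a ⋙ Q.sourceMid a ⋙ he.sourceFunctor ha).Full := by
    rw [he.sourceIn_comp]
    exact he.full
  exact Functor.Full.of_comp_faithful (Q.sourceIn a) (Q.sourceMid a ⋙ he.sourceFunctor ha)

theorem sourceOut_comp (he : Q.IsEmbedding e lv s) (ha : Q.IsSource a) :
    (Q.reflect a).IsEmbedding (Q.sourceOut a ha ⋙ he.sourceFunctor ha) lv
      (fun i => if i = a then s i + 2 else s i) where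
  lv_cases := he.lv_cases
  level x := by
    change (he.sourcePt ha (sourceOutObj Q a x)).l = _
    unfold sourceOutObj
    split_ifs with h
    · rw [h]
      rfl
    · rfl
  height x := by
    change (he.sourcePt ha (sourceOutObj Q a x)).ht = _
    unfold sourceOutObj
    split_ifs with h
    · rw [he.sourcePt_new_ht, h]
    · rw [he.sourcePt_old_ht]
      unfold sourceHt
      rw [if_pos ⟨x.one_le, x.le⟩]
  isHeight := he.isHeight.reflect_source ha

variable {D : Prederivator.{w,v,u}}

/-- No vertex of Q lies above an added vertex, and exact diagrams vanish where the added vertices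
are placed. -/
theorem fullyFaithfulTo_sourceIn (he : Q.IsEmbedding e lv s) (ha : Q.IsSource a)
    (hD : D.IsStableDerivator) (A : Cat.{w,w}ᵒᵖ) (X : (D.meshEx n).obj A) :
    FullyFaithfulTo ((D.resMor (Q.sourceIn a)).app A).toFunctor
      (((D.restrEx (Q.sourceMid a ⋙ he.sourceFunctor ha)).app A).toFunctor.obj X) := by
  have := he.full_sourceIn ha
  have ha' := ha.1
  refine (hD.fullyFaithfulTo_image_prod_iff {x | ∃ j, (Q.sourceIn.{w} a).obj j = ⟨x⟩} (Q.sourceIn a)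
    (fun _ => Iff.rfl) _).2 fun c b _ => ?_
  by_cases hb : b ∈ {x | ∃ j, (Q.sourceIn.{w} a).obj j = ⟨x⟩}
  · exact Prederivator.limOn_of_mem hb _
  obtain ⟨Y, hY, hY'⟩ := Prederivator.restrEx_sectL X (Q.sourceMid a ⋙ he.sourceFunctor ha) c
  refine (hD.limOn_iff_isZero hD.pointed ?_ _).2 ?_
  · rintro x ⟨j, hj⟩ h
    obtain rfl : x = _ := (congrArg Pos.pt hj).symm
    exact hb (SourceShape.mem_image_of_le ha.1 j h)
  · refine (congrArg (fun t => Limits.IsZero ((D.ev (⟨b⟩ : Pos.{w} (SourceShapeOld Q a))).obj t)) hY').mpr ?_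
    refine hY.isZero _ _ ?_
    obtain ⟨b | b, hb'⟩ := b
    · by_cases hl : 1 ≤ b ∧ b ≤ n
      · exact absurd ⟨⟨b, hl.1, hl.2⟩, rfl⟩ hb
      · exact he.lv_bdry (by omega)
    · exact absurd rfl hb'

/-- The colimit at the new vertex reduces to the square starting at a, which is placed on a mesh
square and hence becomes cocartesian. -/
theorem fullyFaithfulFrom_sourceMid (he : Q.IsEmbedding e lv s) (ha : Q.IsSource a)
    (hD : D.IsStableDerivator) (A : Cat.{w,w}ᵒᵖ) (X : (D.meshEx n).obj A) :
    FullyFaithfulFrom ((D.resMor (Q.sourceMid a)).app A).toFunctor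
      (((D.restrEx (he.sourceFunctor ha)).app A).toFunctor.obj X) := by
  have ha' := ha.1
  refine (hD.fullyFaithfulFrom_val_prod_iff {x : SourceShape Q a | x ≠ .new} _).2 fun c b _ => ?_
  cases b with
  | old l h => exact Prederivator.colimOn_of_mem (fun h => by cases h) _
  | new =>
    obtain ⟨Y, hY, hY'⟩ := Prederivator.restrEx_sectL X (he.sourceFunctor ha) c
    refine (congrArg (Prederivator.ColimOn D {x : SourceShape Q a | x ≠ .new} .new) hY').mpr ?_
    obtain ⟨u, d, hu, hd, hud, hu', hd'⟩ := he.exists_neighbours ha.1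
    let sq : Sq → SourceShape Q a := fun s =>
      if s.1 = 0 then if s.2 = 0 then .old a (Or.inl ha.1) else .old d (Or.inr hd)
      else if s.2 = 0 then .old u (Or.inr hu) else .new
    have hsq : Monotone sq := monotone_sq sq
      (Relation.ReflTransGen.single (Or.inr ⟨rfl, hu⟩)) (Relation.ReflTransGen.single (Or.inr ⟨rfl, hd⟩))
      (Relation.ReflTransGen.single hu) (Relation.ReflTransGen.single hd)
    refine (hD.colimOn_iff_isCocartesian sq hsq {x : SourceShape Q a | x ≠ .new} ?_ ?_ ?_ _).2 ?_
    · intro s hs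
      obtain rfl | rfl | rfl : s = (0, 0) ∨ s = (0, 1) ∨ s = (1, 0) := by
        revert s
        decide
      all_goals exact fun h => by cases h
    · intro x hx h
      rcases Relation.ReflTransGen.cases_tail h with h | ⟨y, h', hy⟩
      · exact absurd h.symm hx
      · cases y with
        | new => exact hy.elim
        | old l hl =>
          have : l = u ∨ l = d := by
            change l + 1 = a ∨ l = a + 1 at hy
            omega
          rcases this with rfl | rfl
          · exact Or.inl h'
          · exact Or.inr h'
    -- Common lower bounds of the two neighbours lie below a; again the comparison is made in the
    -- mesh category and lifted by fullness.
    · intro x hx h₁ h₂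
      cases x with
      | new => exact absurd rfl hx
      | old l hl =>
        change _ ≤ SourceShape.old u (Or.inr hu) at h₁
        change _ ≤ SourceShape.old d (Or.inr hd) at h₂
        have h₃ := MeshPt.le_iff_ht.1 (he.sourcePt_mono ha h₁)
        have h₄ := MeshPt.le_iff_ht.1 (he.sourcePt_mono ha h₂)
        change ((lv u : ℤ) - lv l ≤ _ ∧ (lv l : ℤ) - lv u ≤ _) at h₃
        change ((lv d : ℤ) - lv l ≤ _ ∧ (lv l : ℤ) - lv d ≤ _) at h₄
        rw [he.sourcePt_old_ht, he.sourcePt_old_ht, he.sourceHt_adj ha hu] at h₃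
        rw [he.sourcePt_old_ht, he.sourcePt_old_ht, he.sourceHt_adj ha hd] at h₄
        by_cases hl' : 1 ≤ l ∧ l ≤ n
        · have h₅ : (e.obj (⟨l, hl'.1, hl'.2⟩ : (Q.Vert : Type w))).pt ≤
              (e.obj (⟨a, ha'.1, ha'.2⟩ : (Q.Vert : Type w))).pt := by
            rw [MeshPt.le_iff_ht, he.level, he.level, he.height, he.height]
            unfold sourceHt at h₃ h₄
            rw [if_pos hl'] at h₃ h₄
            change (lv a : ℤ) - lv l ≤ s a - s l ∧ (lv l : ℤ) - lv a ≤ s a - s l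
            omega
          have := he.full
          exact Pos.le_of_hom ((Q.sourceIn.{w} a).map (e.preimage (Pos.homOf h₅)))
        · unfold sourceHt at h₃ h₄
          rw [if_neg hl'] at h₃ h₄
          omega
    · have hdn : lv d < n := by
        have := he.lv_mem ha.1
        omega
      have e₁ : (D.res (Pos.map.{w} sq hsq)).obj ((D.res (he.sourceFunctor ha)).obj Y) =
          (D.res (Mesh.square.{w} (he.sourcePt ha (.old a (Or.inl ha'))).k (lv d) hdn)).obj Y := by
        refine D.res_res_obj (CategoryTheory.Functor.ext (fun x => Pos.ext ?_) fun _ _ _ =>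
          Subsingleton.elim _ _) Y
        change he.sourcePt ha (sq x.pt) = Mesh.squarePt (he.sourcePt ha (.old a (Or.inl ha'))).k (lv d) hdn x.pt
        obtain ⟨⟨i, j⟩⟩ := x
        have h₀ : (he.sourcePt ha (.old a (Or.inl ha'))).ht = s a :=
          (he.sourcePt_old_ht ha a _).trans (if_pos ha')
        have h₁ : (he.sourcePt ha (.old a (Or.inl ha'))).ht =
          2 * (he.sourcePt ha (.old a (Or.inl ha'))).k + lv a := rfl
        fin_cases i <;> fin_cases j
        · exact MeshPt.ext rfl hd'
        · refine MeshPt.ext_ht rfl ((he.sourcePt_old_ht ha d _).trans ?_)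
          change _ = 2 * ((he.sourcePt ha (.old a (Or.inl ha'))).k + 1) + (lv d : ℤ)
          rw [he.sourceHt_adj ha hd]
          omega
        · refine MeshPt.ext_ht (hu'.trans (congrArg (· + 1) hd')) ((he.sourcePt_old_ht ha u _).trans ?_)
          change _ = 2 * (he.sourcePt ha (.old a (Or.inl ha'))).k + ((lv d + 2 : ℕ) : ℤ)
          rw [he.sourceHt_adj ha hu]
          omega
        · refine MeshPt.ext_ht hd' ((he.sourcePt_new_ht ha).trans ?_)
          change _ = 2 * ((he.sourcePt ha (.old a (Or.inl ha'))).k + 1) + ((lv d + 1 : ℕ) : ℤ)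
          omega
      rw [e₁]
      exact hY.cocartesian _ _ _

/-- A reflection functor at a source sends the restriction of an exact diagram to a quiver placed in the mesh
category to its restriction to the reflected quiver. -/
theorem nonempty_restrEx_sourceReflection (he : Q.IsEmbedding e lv s) (ha : Q.IsSource a)
    (hD : D.IsStableDerivator) {σ : Prederivator.Mor (D.rep Q) (D.rep (Q.reflect a))}
    (hσ : D.IsSourceReflection Q a ha σ) :
    Nonempty (D.restrEx e ≫ σ ≅ D.restrEx (Q.sourceOut a ha ⋙ he.sourceFunctor ha)) := by
  obtain ⟨R, L, ⟨adjR⟩, ⟨adjL⟩, ⟨i⟩⟩ := hσ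
  obtain ⟨i₁⟩ := Prederivator.nonempty_comp_unit_iso adjR
    (D.restrEx (Q.sourceMid a ⋙ he.sourceFunctor ha)) (he.fullyFaithfulTo_sourceIn ha hD)
  obtain ⟨i₂⟩ := Prederivator.nonempty_comp_counit_iso adjL
    (D.restrEx (he.sourceFunctor ha)) (he.fullyFaithfulFrom_sourceMid ha hD)
  obtain ⟨i₃⟩ := D.nonempty_restrEx_comp (Q.sourceIn a) (Q.sourceMid a ⋙ he.sourceFunctor ha)
  obtain ⟨i₄⟩ := D.nonempty_restrEx_comp (Q.sourceMid a) (he.sourceFunctor ha)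
  obtain ⟨i₅⟩ := D.nonempty_restrEx_comp (Q.sourceOut a ha) (he.sourceFunctor ha)
  rw [he.sourceIn_comp] at i₃
  have i₆ : D.restrEx e ≫ R ≅ D.restrEx (Q.sourceMid a ⋙ he.sourceFunctor ha) :=
    Bicategory.whiskerRightIso i₃ R ≪≫ α_ _ _ _ ≪≫ i₁
  have i₇ : D.restrEx (Q.sourceMid a ⋙ he.sourceFunctor ha) ≫ L ≅ D.restrEx (he.sourceFunctor ha) :=
    Bicategory.whiskerRightIso i₄ L ≪≫ α_ _ _ _ ≪≫ i₂
  exact ⟨Bicategory.whiskerLeftIso _ i ≪≫ (α_ _ _ _).symm ≪≫ Bicategory.whiskerRightIso i₆ _ ≪≫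
    (α_ _ _ _).symm ≪≫ Bicategory.whiskerRightIso i₇ _ ≪≫ i₅.symm⟩

end IsEmbedding

end AnQuiver

/-! ### Composites of reflections translate the section -/

namespace AnQuiver

variable {n : ℕ} {Q Q' : AnQuiver n} {e : (Q.Free : Type w) ⥤ Mesh.{w} n} {lv : ℕ → ℕ} {s : ℕ → ℤ} {a : ℕ}

namespace IsEmbedding

variable {D : Prederivator.{w,v,u}}

theorem congr (he : Q.IsEmbedding e lv s) {s' : ℕ → ℤ} (h : ∀ i, 1 ≤ i ∧ i ≤ n → s' i = s i) :
    Q.IsEmbedding e lv s' where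
  lv_cases := he.lv_cases
  level := he.level
  height x := (he.height x).trans (h _ ⟨x.one_le, x.le⟩).symm
  isHeight := he.isHeight.congr h

/-- Along the chain the levels never change, and the height of i drops by two each time i is
reflected. The placement of the final quiver is thus known from the list alone. -/
theorem exists_of_isSinkComposite (hD : D.IsStableDerivator) {as : List ℕ}
    {Φ : Prederivator.Mor (D.rep Q) (D.rep Q')} (hΦ : D.IsSinkComposite Q Q' as Φ)
    (he : Q.IsEmbedding e lv s) : ∃ e' : (Q'.Free : Type w) ⥤ Mesh.{w} n,
      Q'.IsEmbedding e' lv (fun i => s i - 2 * as.count i) ∧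
        Nonempty (D.restrEx e ≫ Φ ≅ D.restrEx e') := by
  induction hΦ generalizing s with
  | nil Q => exact ⟨e, he.congr fun i _ => by simp, ⟨ρ_ _⟩⟩
  | @cons Q Q' a as ha σ hσ Φ _ ih =>
    obtain ⟨e', he', ⟨i'⟩⟩ := ih (he.sinkOut_comp ha)
    obtain ⟨i⟩ := he.nonempty_restrEx_sinkReflection ha hD hσ
    refine ⟨e', he'.congr fun i _ => ?_, ⟨(α_ _ _ _).symm ≪≫ Bicategory.whiskerRightIso i Φ ≪≫ i'⟩⟩
    rw [List.count_cons]
    by_cases h : i = a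
    · subst h
      simp
      ring
    · simp [h, Ne.symm h]

theorem exists_of_isSourceComposite (hD : D.IsStableDerivator) {bs : List ℕ}
    {Φ : Prederivator.Mor (D.rep Q) (D.rep Q')} (hΦ : D.IsSourceComposite Q Q' bs Φ)
    (he : Q.IsEmbedding e lv s) : ∃ e' : (Q'.Free : Type w) ⥤ Mesh.{w} n,
      Q'.IsEmbedding e' lv (fun i => s i + 2 * bs.count i) ∧
        Nonempty (D.restrEx e ≫ Φ ≅ D.restrEx e') := by
  induction hΦ generalizing s with
  | nil Q => exact ⟨e, he.congr fun i _ => by simp, ⟨ρ_ _⟩⟩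
  | @cons Q Q' b bs hb σ hσ Φ _ ih =>
    obtain ⟨e', he', ⟨i'⟩⟩ := ih (he.sourceOut_comp hb)
    obtain ⟨i⟩ := he.nonempty_restrEx_sourceReflection hb hD hσ
    refine ⟨e', he'.congr fun i _ => ?_, ⟨(α_ _ _ _).symm ≪≫ Bicategory.whiskerRightIso i Φ ≪≫ i'⟩⟩
    rw [List.count_cons]
    by_cases h : i = b
    · subst h
      simp
      ring
    · simp [h, Ne.symm h]

/-- Levels and heights determine the vertices, morphisms are unique, and at a fixed level two units
of height are one unit of k. -/
theorem eq_translate (he : Q.IsEmbedding e lv s) {e' : (Q.Free : Type w) ⥤ Mesh.{w} n} {s' : ℕ → ℤ}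
    (he' : Q.IsEmbedding e' lv s') (c : ℤ) (h : ∀ i, 1 ≤ i ∧ i ≤ n → s' i = s i + 2 * c) :
    e' = e ⋙ Mesh.translate.{w} c := by
  refine CategoryTheory.Functor.ext (fun x => Pos.ext (MeshPt.ext_ht ?_ ?_)) fun _ _ _ =>
    Subsingleton.elim _ _
  · exact (he'.level x).trans (he.level x).symm
  · refine (he'.height x).trans ((h _ ⟨x.one_le, x.le⟩).trans ?_)
    rw [← he.height x]
    change 2 * (e.obj x).pt.k + ((e.obj x).pt.l : ℤ) + 2 * c =
      2 * ((e.obj x).pt.k + c) + ((e.obj x).pt.l : ℤ)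
    ring

theorem count_eq_one {as : List ℕ} (h : as.Nodup) (h' : ∀ a, a ∈ as ↔ 1 ≤ a ∧ a ≤ n) {i : ℕ}
    (hi : 1 ≤ i ∧ i ≤ n) : as.count i = 1 := List.count_eq_one_of_mem h ((h' i).2 hi)

theorem nonempty_restrEx_translate (D : Prederivator.{w,v,u}) (e : (Q.Free : Type w) ⥤ Mesh.{w} n) (c : ℤ) :
    Nonempty (D.restrEx (e ⋙ Mesh.translate.{w} c) ≅ D.meshTranslate n c ≫ D.restrEx e) := by
  obtain ⟨i⟩ := D.nonempty_restrEx_comp e (Mesh.translate.{w} (n := n) c)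
  obtain ⟨j⟩ := Prederivator.nonempty_liftTrans_incl (hP := D.arProp_map n) (hP' := D.arProp_map n)
    (D.resMor (Mesh.translate.{w} (n := n) c)) (D.arProp_translate n c)
  exact ⟨i ≪≫ Bicategory.whiskerRightIso j.symm (D.resMor e) ≪≫ α_ _ _ _⟩

/-- Every vertex occurs exactly once in the sequence, so all heights drop by two and the section is
translated by −1. The order of the sequence plays no further role. -/
theorem nonempty_restrEx_sinks (he : Q.IsEmbedding e lv s) (hD : D.IsStableDerivator) {as : List ℕ}
    (has : Q.IsAdmissibleSinks as) {Φ : Prederivator.Mor (D.rep Q) (D.rep Q)}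
    (hΦ : D.IsSinkComposite Q Q as Φ) : Nonempty (D.restrEx e ≫ Φ ≅ D.arTau n ≫ D.restrEx e) := by
  obtain ⟨e', he', ⟨i⟩⟩ := he.exists_of_isSinkComposite hD hΦ
  obtain rfl := he.eq_translate he' (-1) fun i hi => by
    rw [count_eq_one has.1 has.2.1 hi]
    ring
  obtain ⟨j⟩ := nonempty_restrEx_translate D e (-1)
  exact ⟨i ≪≫ j⟩

theorem nonempty_restrEx_sources (he : Q.IsEmbedding e lv s) (hD : D.IsStableDerivator) {bs : List ℕ}
    (hbs : Q.IsAdmissibleSources bs) {Φ : Prederivator.Mor (D.rep Q) (D.rep Q)}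
    (hΦ : D.IsSourceComposite Q Q bs Φ) :
    Nonempty (D.restrEx e ≫ Φ ≅ D.arTauInv n ≫ D.restrEx e) := by
  obtain ⟨e', he', ⟨i⟩⟩ := he.exists_of_isSourceComposite hD hΦ
  obtain rfl := he.eq_translate he' 1 fun i hi => by
    rw [count_eq_one hbs.1 hbs.2.1 hi]
    ring
  obtain ⟨j⟩ := nonempty_restrEx_translate D e 1
  exact ⟨i ≪≫ j⟩

/-! ### Existence of composites of reflection functors -/

/-- Both inclusions of shapes are fully faithful, so the Kan extensions exist as morphisms of
prederivators. -/
theorem exists_isSinkReflection (he : Q.IsEmbedding e lv s) (ha : Q.IsSink a) (hD : D.IsDerivator) :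
    ∃ σ, D.IsSinkReflection Q a ha σ := by
  have := he.full_sinkIn ha
  have : (Q.sinkMid.{w} a).Full := Pos.full_val_map fun x : SinkShape Q a => x ≠ .new
  obtain ⟨L, hL⟩ := hD.exists_leftAdjoint_resMor (Q.sinkIn.{w} a)
  obtain ⟨R, hR⟩ := hD.exists_rightAdjoint_resMor (Q.sinkMid.{w} a)
  exact ⟨_, L, R, hL, hR, ⟨Iso.refl _⟩⟩

theorem exists_isSourceReflection (he : Q.IsEmbedding e lv s) (ha : Q.IsSource a) (hD : D.IsDerivator) :
    ∃ σ, D.IsSourceReflection Q a ha σ := by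
  have := he.full_sourceIn ha
  have : (Q.sourceMid.{w} a).Full := Pos.full_val_map fun x : SourceShape Q a => x ≠ .new
  obtain ⟨R, hR⟩ := hD.exists_rightAdjoint_resMor (Q.sourceIn.{w} a)
  obtain ⟨L, hL⟩ := hD.exists_leftAdjoint_resMor (Q.sourceMid.{w} a)
  exact ⟨_, R, L, hR, hL, ⟨Iso.refl _⟩⟩

theorem exists_isSinkComposite (he : Q.IsEmbedding e lv s) (hD : D.IsDerivator) {as : List ℕ}
    (has : Q.SinkChain as) : ∃ Q' Φ, D.IsSinkComposite Q Q' as Φ := by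
  induction as generalizing Q s with
  | nil => exact ⟨Q, _, .nil Q⟩
  | cons a as ih =>
    obtain ⟨σ, hσ⟩ := he.exists_isSinkReflection has.1 hD
    obtain ⟨Q', Φ, hΦ⟩ := ih (he.sinkOut_comp has.1) has.2
    exact ⟨Q', _, .cons has.1 hσ hΦ⟩

theorem exists_isSourceComposite (he : Q.IsEmbedding e lv s) (hD : D.IsDerivator) {bs : List ℕ}
    (hbs : Q.SourceChain bs) : ∃ Q' Φ, D.IsSourceComposite Q Q' bs Φ := by
  induction bs generalizing Q s with
  | nil => exact ⟨Q, _, .nil Q⟩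
  | cons b bs ih =>
    obtain ⟨σ, hσ⟩ := he.exists_isSourceReflection hbs.1 hD
    obtain ⟨Q', Φ, hΦ⟩ := ih (he.sourceOut_comp hbs.1) hbs.2
    exact ⟨Q', _, .cons hbs.1 hσ hΦ⟩

theorem exists_sinks (he : Q.IsEmbedding e lv s) (hD : D.IsStableDerivator) {as : List ℕ}
    (has : Q.IsAdmissibleSinks as) : ∃ Φ, D.IsSinkComposite Q Q as Φ := by
  obtain ⟨Q', Φ, hΦ⟩ := he.exists_isSinkComposite hD.toIsDerivator has.2.2
  obtain ⟨e', he', -⟩ := he.exists_of_isSinkComposite hD hΦ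
  -- The composite a priori ends at some quiver obtained by reflections; its heights are those of Q
  -- lowered by two, so it is Q.
  obtain rfl : Q' = Q := he.isHeight.eq_of_const he'.isHeight (-2) fun i hi => by
    rw [count_eq_one has.1 has.2.1 hi]
    ring
  exact ⟨Φ, hΦ⟩

theorem exists_sources (he : Q.IsEmbedding e lv s) (hD : D.IsStableDerivator) {bs : List ℕ}
    (hbs : Q.IsAdmissibleSources bs) : ∃ Φ, D.IsSourceComposite Q Q bs Φ := by
  obtain ⟨Q', Φ, hΦ⟩ := he.exists_isSourceComposite hD.toIsDerivator hbs.2.2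
  obtain ⟨e', he', -⟩ := he.exists_of_isSourceComposite hD hΦ
  obtain rfl : Q' = Q := he.isHeight.eq_of_const he'.isHeight 2 fun i hi => by
    rw [count_eq_one hbs.1 hbs.2.1 hi]
    ring
  exact ⟨Φ, hΦ⟩

end IsEmbedding

end AnQuiver

/-! ### Transport along the equivalence and conclusion -/

namespace Prederivator

theorem nonempty_comp_inverse {E E' : Prederivator.{w,v,u}} {G : Mor E' E} {F : Mor E E'} (i : F ≫ G ≅ 𝟙 _)
    (j : G ≫ F ≅ 𝟙 _) {Φ : Mor E E} {T : Mor E' E'} (k : G ≫ Φ ≅ T ≫ G) : Nonempty (Φ ≫ F ≅ F ≫ T) :=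
  ⟨(λ_ _).symm ≪≫ Bicategory.whiskerRightIso i.symm _ ≪≫ α_ _ _ _ ≪≫
    Bicategory.whiskerLeftIso F ((α_ _ _ _).symm ≪≫ Bicategory.whiskerRightIso k F ≪≫ α_ _ _ _ ≪≫
      Bicategory.whiskerLeftIso T j ≪≫ ρ_ _)⟩

theorem nonempty_iso_of_inverse {E E' : Prederivator.{w,v,u}} {G : Mor E' E} {F : Mor E E'}
    (i : F ≫ G ≅ 𝟙 _) {Φ Φ' : Mor E E} (k : G ≫ Φ ≅ G ≫ Φ') : Nonempty (Φ ≅ Φ') :=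
  ⟨(λ_ _).symm ≪≫ Bicategory.whiskerRightIso i.symm _ ≪≫ α_ _ _ _ ≪≫ Bicategory.whiskerLeftIso F k ≪≫
    (α_ _ _ _).symm ≪≫ Bicategory.whiskerRightIso i _ ≪≫ λ_ _⟩

theorem exists_isInverseToIStar {D : Prederivator.{w,v,u}} (hD : D.IsStableDerivator) {n : ℕ} (hn : 1 ≤ n)
    {Q : AnQuiver n} (φ : Q.RepIso) : ∃ F : Mor (D.rep Q) (D.meshEx n), D.IsInverseToIStar φ F :=
  exists_inverse (D.iStar φ) fun A => (φ.isEmbedding.{w} hn).isEquivalence hD hn A.unop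

end Prederivator

theorem mainTheorem6 (D : Prederivator.{w,v,u}) (hD : D.IsStableDerivator) {n : ℕ} (hn : 1 ≤ n)
    (Q : AnQuiver n) :
    ((∃ as, Q.IsAdmissibleSinks as) ∧
      (∀ as, Q.IsAdmissibleSinks as →
        ∃ Φ : Prederivator.Mor (D.rep Q) (D.rep Q), D.IsSinkComposite Q Q as Φ) ∧
      (∀ as as', Q.IsAdmissibleSinks as → Q.IsAdmissibleSinks as' →
        ∀ Φ Φ' : Prederivator.Mor (D.rep Q) (D.rep Q), D.IsSinkComposite Q Q as Φ →
          D.IsSinkComposite Q Q as' Φ' → Nonempty (Φ ≅ Φ'))) ∧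
    ((∃ bs, Q.IsAdmissibleSources bs) ∧
      (∀ bs, Q.IsAdmissibleSources bs →
        ∃ Φ : Prederivator.Mor (D.rep Q) (D.rep Q), D.IsSourceComposite Q Q bs Φ) ∧
      (∀ bs bs', Q.IsAdmissibleSources bs → Q.IsAdmissibleSources bs' →
        ∀ Φ Φ' : Prederivator.Mor (D.rep Q) (D.rep Q), D.IsSourceComposite Q Q bs Φ →
          D.IsSourceComposite Q Q bs' Φ' → Nonempty (Φ ≅ Φ'))) ∧
    Nonempty Q.RepIso ∧
    ∀ φ : Q.RepIso,
      (∃ F : Prederivator.Mor (D.rep Q) (D.meshEx n), D.IsInverseToIStar φ F) ∧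
      ∀ F : Prederivator.Mor (D.rep Q) (D.meshEx n), D.IsInverseToIStar φ F →
        (∀ Φ : Prederivator.Mor (D.rep Q) (D.rep Q), D.IsCoxeterPlus Q Φ →
          Nonempty (Φ ≫ F ≅ F ≫ D.arTau n)) ∧
        (∀ Φ : Prederivator.Mor (D.rep Q) (D.rep Q), D.IsCoxeterMinus Q Φ →
          Nonempty (Φ ≫ F ≅ F ≫ D.arTauInv n)) := by
  -- The first two parts do not mention the mesh category; any one placement serves to prove them.
  obtain ⟨φ₀⟩ := AnQuiver.nonempty_repIso hn Q
  have he := φ₀.isEmbedding.{w} hn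
  obtain ⟨F₀, ⟨i₀⟩, -⟩ := Prederivator.exists_isInverseToIStar hD hn φ₀
  refine ⟨⟨AnQuiver.exists_isAdmissibleSinks hn Q, fun as has => he.exists_sinks hD has,
    fun as as' has has' Φ Φ' hΦ hΦ' => ?_⟩, ⟨AnQuiver.exists_isAdmissibleSources hn Q,
    fun bs hbs => he.exists_sources hD hbs, fun bs bs' hbs hbs' Φ Φ' hΦ hΦ' => ?_⟩, ⟨φ₀⟩, fun φ =>
    ⟨Prederivator.exists_isInverseToIStar hD hn φ, fun F hF => ⟨?_, ?_⟩⟩⟩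
  · obtain ⟨k⟩ := he.nonempty_restrEx_sinks hD has hΦ
    obtain ⟨k'⟩ := he.nonempty_restrEx_sinks hD has' hΦ'
    -- Both composites become the same translation after restriction from the mesh category, and the
    -- restriction can be cancelled because it has an inverse.
    exact Prederivator.nonempty_iso_of_inverse i₀ (k ≪≫ k'.symm)
  · obtain ⟨k⟩ := he.nonempty_restrEx_sources hD hbs hΦ
    obtain ⟨k'⟩ := he.nonempty_restrEx_sources hD hbs' hΦ'
    exact Prederivator.nonempty_iso_of_inverse i₀ (k ≪≫ k'.symm)
  · rintro Φ ⟨as, has, hΦ⟩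
    obtain ⟨k⟩ := (φ.isEmbedding.{w} hn).nonempty_restrEx_sinks hD has hΦ
    exact Prederivator.nonempty_comp_inverse hF.1.some hF.2.some k
  · rintro Φ ⟨bs, hbs, hΦ⟩
    obtain ⟨k⟩ := (φ.isEmbedding.{w} hn).nonempty_restrEx_sources hD hbs hΦ
    exact Prederivator.nonempty_comp_inverse hF.1.some hF.2.some k
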